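/- Let $\Sigma=\{1,\dots,N\}^{\mathbb N}$ with left shift $\sigma$, let $[\mathtt i]\subset\Sigma$ be the cylinder of the finite word $\mathtt i$, and let $\mathtt i|_n$ be the prefix of length $n$ of $\mathtt i\in\Sigma$. A function $\theta$ from finite words to $(0,\infty)$ is called almost-multiplicative if there is $C\ge 1$ with $C^{-1}\theta(\mathtt i)\theta(\mathtt j)\le\theta(\mathtt i\mathtt j)\le C\theta(\mathtt i)\theta(\mathtt j)$ for all finite words $\mathtt i,\mathtt j$. Let $\mathsf A=(A_1,\dots,A_N)\in GL_2(\mathbb R)^N$ with $\|A_i\|<1$ (Euclidean operator norm) for all $i$; for $\mathtt i=i_1\cdots i_n$ put $A_{\mathtt i}=A_{i_1}\cdots A_{i_n}$, $\alpha_1(\mathtt i)=\|A_{\mathtt i}\|$ and $\alpha_2(\mathtt i)=\|A_{\mathtt i}^{-1}\|^{-1}$. Assume that $\mathsf A$ is dominated: there are $C>0$ and $0<\rho<1$ with $\alpha_2(\mathtt i)\le C\rho^{n}\alpha_1(\mathtt i)$ for all words $\mathtt i$ of length $n$ and all $n$. Let $\mu$ be a Borel probability measure on $\Sigma$ that is fully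 supported (each cylinder has positive measure) and quasi-Bernoulli ($\mathtt i\mapsto\mu([\mathtt i])$ is almost-multiplicative); $\mu$ need not be $\sigma$-invariant. For a potential $\theta$ and a $\sigma$-invariant Borel probability measure $\nu$ write $$\Lambda(\theta,\nu)=\lim_{n\to\infty}\tfrac1n\int_\Sigma\log\theta(\mathtt i|_n)\,d\nu(\mathtt i),\qquad P(\theta)=\lim_{n\to\infty}\tfrac1n\log\sum_{|\mathtt i|=n}\theta(\mathtt i),$$ $$h(\nu)=-\lim_{n\to\infty}\tfrac1n\sum_{|\mathtt i|=n}\nu([\mathtt i])\log\nu([\mathtt i]),\qquad h(\mu,\nu)=-\lim_{n\to\infty}\tfrac1n\sum_{|\mathtt i|=n}\nu([\mathtt i])\log\mu([\mathtt i]),$$ $\lambda_1(\nu)=\Lambda(\alpha_1,\nu)$ and $\lambda_2(\nu)=-\Lambda(1/\alpha_2,\nu)$. A $\sigma$-invariant Borel probability measure $\nu$ is an equilibrium state for $\theta$ if $P(\theta)=h(\nu)+\Lambda(\theta,\nu)$. For $s\ge 0$ let $\varphi^s=\alpha_1^s$ if $s<1$, $\varphi^s=\alpha_1\alpha_2^{s-1}$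 if $1\le s<2$, and $\varphi^s(\mathtt i)=|\det A_{\mathtt i}|^{s/2}$ if $s\ge 2$; for $q\in\mathbb R$ let $\psi^{q,s}(\mathtt i)=\mu([\mathtt i])^q\varphi^s(\mathtt i)^{1-q}$. The Lyapunov cross-dimension $\dim_L(\mu,\nu)$ is the unique $s\ge 0$ with $h(\mu,\nu)+\Lambda(\varphi^s,\nu)=0$. The $L^q$-spectrum is $\tau(1)=0$ and $\tau(q)=(q-1)s_q$ for $q\neq 1$, where $s_q$ is the unique $s\ge 0$ with $P(\psi^{q,s})=0$. Let $q\ne 1$. Then $s_q=\tau(q)/(q-1)$ is well defined (exactly one such zero exists), and $\psi^{q,\tau(q)/(q-1)}$ has exactly one equilibrium state $\nu$. If $\tau(q)/(q-1)\notin\{1,2\}$, then $\tau$ is continuously differentiable on a neighbourhood of $q$. Moreover $\lambda_1(\nu),\lambda_2(\nu)<0$ and $$\tau'(q)=\begin{cases}-\dfrac{h(\mu,\nu)}{\lambda_1(\nu)},&\text{if }0<\tau(q)/(q-1)<1,\\[2mm] 1-\dfrac{h(\mu,\nu)+\lambda_1(\nu)}{\lambda_2(\nu)},&\text{if }1<\tau(q)/(q-1)<2,\\[2mm]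 -\dfrac{2h(\mu,\nu)}{\lambda_1(\nu)+\lambda_2(\nu)},&\text{if }2<\tau(q)/(q-1)<\infty.\end{cases}$$ In particular, $\dim_L(\mu,\nu)$ is well defined (exactly one such $s$ exists), and if $\tau'(q)$ and $\tau(q)/(q-1)$ are contained in the same interval, $(0,1)$, $(1,2)$ or $(2,\infty)$, then $\tau'(q)=\dim_L(\mu,\nu)$. -/

import Mathlib

open MeasureTheory Filter Topology

noncomputable section

namespace SelfAffine

/-! ### The shift space

Letters are the elements of `Fin N`, finite words are lists of letters, and a word of length `n`
is also given by a function `Fin n → Fin N`. -/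

/-- The full shift over `N` letters, with the product σ-algebra (which is the Borel σ-algebra). -/
abbrev Shift (N : ℕ) : Type := ℕ → Fin N

/-- The left shift. -/
def shift {N : ℕ} (x : Shift N) : Shift N := fun k => x (k + 1)

/-- The prefix of length `n` of an infinite word. -/
def pref {N : ℕ} (x : Shift N) (n : ℕ) : List (Fin N) := List.ofFn fun k : Fin n => x k

/-- The cylinder set of a finite word. -/
def wordCylinder {N : ℕ} (w : List (Fin N)) : Set (Shift N) := {x | pref x w.length = w}

/-- The set of shift invariant Borel probability measures. -/
def invariantMeasures (N : ℕ) : Set (Measure (Shift N)) :=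
  {ν | IsProbabilityMeasure ν ∧ MeasurePreserving shift ν ν}

/-- The potential given by the measures of the cylinder sets. -/
def cylMeasure {N : ℕ} (μ : Measure (Shift N)) (w : List (Fin N)) : ℝ := μ.real (wordCylinder w)

/-- Every cylinder set has positive measure. -/
def IsFullySupported {N : ℕ} (μ : Measure (Shift N)) : Prop :=
  ∀ w : List (Fin N), 0 < μ (wordCylinder w)

/-! ### Potentials -/

def IsSubmultiplicative {N : ℕ} (θ : List (Fin N) → ℝ) : Prop :=
  ∀ u v : List (Fin N), θ (u ++ v) ≤ θ u * θ v

def IsSupermultiplicative {N : ℕ} (θ : List (Fin N) → ℝ) : Prop :=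
  IsSubmultiplicative fun w => 1 / θ w

def IsAlmostMultiplicative {N : ℕ} (θ : List (Fin N) → ℝ) : Prop :=
  ∃ C : ℝ, 1 ≤ C ∧ IsSubmultiplicative (fun w => C * θ w) ∧
    IsSupermultiplicative (fun w => C⁻¹ * θ w)

/-- A fully supported measure is quasi-Bernoulli if the potential given by the measures of the
cylinder sets is almost-multiplicative. -/
def IsQuasiBernoulli {N : ℕ} (μ : Measure (Shift N)) : Prop :=
  IsFullySupported μ ∧ IsAlmostMultiplicative (cylMeasure μ)

/-- `Λ(θ, ν)`, the limit of `(1/n) ∫ log θ(i|ₙ) dν(i)`. -/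
def Lam {N : ℕ} (θ : List (Fin N) → ℝ) (ν : Measure (Shift N)) : ℝ :=
  limUnder atTop fun n : ℕ => (1 / (n : ℝ)) * ∫ x, Real.log (θ (pref x n)) ∂ν

/-- The pressure `P(θ)`, the limit of `(1/n) log ∑ θ(w)`, the sum over all words of length `n`. -/
def pressure {N : ℕ} (θ : List (Fin N) → ℝ) : ℝ :=
  limUnder atTop fun n : ℕ => (1 / (n : ℝ)) * Real.log (∑ w : Fin n → Fin N, θ (List.ofFn w))

/-- The entropy `h(ν)`; note that `Real.negMulLog t = -t * log t`. -/
def entropy {N : ℕ} (ν : Measure (Shift N)) : ℝ :=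
  limUnder atTop fun n : ℕ =>
    (1 / (n : ℝ)) * ∑ w : Fin n → Fin N, Real.negMulLog (cylMeasure ν (List.ofFn w))

/-- The cross-entropy `h(μ, ν)` of `μ` relative to `ν`. -/
def crossEntropy {N : ℕ} (μ ν : Measure (Shift N)) : ℝ := -Lam (cylMeasure μ) ν

/-- `ν` is an equilibrium state for the potential `θ`. -/
def IsEquilibriumState {N : ℕ} (θ : List (Fin N) → ℝ) (ν : Measure (Shift N)) : Prop :=
  ν ∈ invariantMeasures N ∧ pressure θ = entropy ν + Lam θ ν

/-! ### Matrix tuples -/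

/-- The product of the matrices along a finite word. -/
def wordMat {N : ℕ} (A : Fin N → GL (Fin 2) ℝ) (w : List (Fin N)) : GL (Fin 2) ℝ :=
  (w.map A).prod

/-- The operator norm of a real `2 × 2` matrix with respect to the Euclidean norm. -/
def opNorm (M : Matrix (Fin 2) (Fin 2) ℝ) : ℝ :=
  ‖(Matrix.toEuclideanCLM (n := Fin 2) (𝕜 := ℝ) M :
    EuclideanSpace ℝ (Fin 2) →L[ℝ] EuclideanSpace ℝ (Fin 2))‖

/-- The larger singular value of the product along a word: the operator norm. -/
def alpha1 {N : ℕ} (A : Fin N → GL (Fin 2) ℝ) (w : List (Fin N)) : ℝ :=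
  opNorm (wordMat A w : Matrix (Fin 2) (Fin 2) ℝ)

/-- The smaller singular value of the product along a word: the reciprocal of the operator norm of
the inverse. -/
def alpha2 {N : ℕ} (A : Fin N → GL (Fin 2) ℝ) (w : List (Fin N)) : ℝ :=
  (opNorm ((wordMat A w)⁻¹ : GL (Fin 2) ℝ))⁻¹

/-- Every matrix of the tuple is a strict contraction in the Euclidean norm. -/
def IsContractive {N : ℕ} (A : Fin N → GL (Fin 2) ℝ) : Prop :=
  ∀ i, opNorm (A i : Matrix (Fin 2) (Fin 2) ℝ) < 1

def IsDominated {N : ℕ} (A : Fin N → GL (Fin 2) ℝ) : Prop :=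
  ∃ C ρ : ℝ, 0 < C ∧ 0 < ρ ∧ ρ < 1 ∧
    ∀ w : List (Fin N), alpha2 A w ≤ C * ρ ^ w.length * alpha1 A w

/-- The singular value function `φ^s` (for `s ≥ 0`). -/
def svf {N : ℕ} (A : Fin N → GL (Fin 2) ℝ) (s : ℝ) (w : List (Fin N)) : ℝ :=
  if s < 1 then alpha1 A w ^ s
  else if s < 2 then alpha1 A w * alpha2 A w ^ (s - 1)
  else |(wordMat A w : Matrix (Fin 2) (Fin 2) ℝ).det| ^ (s / 2)

/-- The larger Lyapunov exponent. -/
def lyap1 {N : ℕ} (A : Fin N → GL (Fin 2) ℝ) (ν : Measure (Shift N)) : ℝ := Lam (alpha1 A) ν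

/-- The smaller Lyapunov exponent. -/
def lyap2 {N : ℕ} (A : Fin N → GL (Fin 2) ℝ) (ν : Measure (Shift N)) : ℝ :=
  -Lam (fun w => 1 / alpha2 A w) ν

/-- The set of all `s ≥ 0` with `h(μ, ν) + Λ(φ^s, ν) = 0`. -/
def crossDimSet {N : ℕ} (A : Fin N → GL (Fin 2) ℝ) (μ ν : Measure (Shift N)) : Set ℝ :=
  {s | 0 ≤ s ∧ crossEntropy μ ν + Lam (svf A s) ν = 0}

/-- The Lyapunov cross-dimension of `μ` relative to `ν`: the unique element of
`crossDimSet A μ ν`. -/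
def lyapCrossDim {N : ℕ} (A : Fin N → GL (Fin 2) ℝ) (μ ν : Measure (Shift N)) : ℝ :=
  sInf (crossDimSet A μ ν)

/-! ### The `L^q`-spectrum -/

/-- The potential `ψ^{q,s}(w) = μ([w])^q φ^s(w)^(1-q)`. -/
def psi {N : ℕ} (A : Fin N → GL (Fin 2) ℝ) (μ : Measure (Shift N)) (q s : ℝ)
    (w : List (Fin N)) : ℝ :=
  cylMeasure μ w ^ q * svf A s w ^ (1 - q)

/-- The set of all `s ≥ 0` with `P(ψ^{q,s}) = 0`. -/
def pressureZeros {N : ℕ} (A : Fin N → GL (Fin 2) ℝ) (μ : Measure (Shift N)) (q : ℝ) : Set ℝ :=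
  {s | 0 ≤ s ∧ pressure (psi A μ q s) = 0}

/-- The `L^q`-spectrum `τ(q) = (q - 1) s_q`, where for `q ≠ 1` the number `s_q` is the unique
element of `pressureZeros A μ q`; in particular `τ(1) = 0`. -/
def tau {N : ℕ} (A : Fin N → GL (Fin 2) ℝ) (μ : Measure (Shift N)) (q : ℝ) : ℝ :=
  (q - 1) * sInf (pressureZeros A μ q)

end SelfAffine

end

noncomputable section

namespace SelfAffine

variable {N : ℕ}

/-! ### Words and prefixes -/

/-! Every potential is written as `exp u`, where `u` is almost additive: `u (v ++ w)` differs from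
`u v + u w` by at most a constant. For such `u` the thermodynamic formalism holds with bounded
errors on every level. Fekete's lemma gives the pressure (`logPressure_spec`) and the rates `Λ`
(`rate_spec`), Gibbs' inequality gives the variational inequality (`entropy_add_rate_le`), and a
weak limit of normalized partition measures, averaged along the shift, is an invariant Gibbs measure
(`exists_isGibbs`). A Gibbs measure is ergodic, and every equilibrium state is absolutely continuous
with respect to it. Hence the equilibrium state is unique (`existsUnique_isEquilibriumState`), and
by compactness it depends continuously on the potential (`tendsto_rate`).

The geometric input is that domination makes `α₁` almost multiplicative
(`exists_isAlmostAdditive_la1`); then so is `α₂ = |det| / α₁`. The proof is a Morse lemma in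
elementary form. The images of two orthogonal singular vectors under the suffix products of a word
are orthogonal at both ends. If they became nearly parallel in between, both would be expanded at
nearly the same rate, and domination allows this only for a bounded time. Thus the angle stays
bounded away from zero, the most expanded vector realizes the norm of both parts of the word up to a
constant, and `log α₁` is almost additive.

For fixed `q ≠ 1` the quotient `P(ψ^{q,s}) / (1 - q)` is strictly decreasing in `s`, with slopes
bounded away from zero and infinity, and nonnegative at `s = 0`. So `s_q` exists uniquely, and it is
continuous in `q`. While `s` stays in one of the three intervals, `log ψ^{q,s}` has the form `w₀ + q
u + t v` with `t = (q - 1) s` and `v` positive of linear growth, so `t = τ(q)` solves `P(w₀ + q u +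
t v) = 0`. Let `ν'` be the equilibrium state at `q'`. Comparing equality in the variational
inequality at `q'` with the inequality at `q`, both for `ν'`, gives `τ(q) - τ(q') ≤ -(q - q') Λ(u,
ν') / Λ(v, ν')`. Thus `-Λ(u) / Λ(v)` is a supergradient; it is continuous in `q`, hence it is the
derivative (`hasDerivAt_zero_of_logPressure`). The three formulas are its values for the three
choices of `w₀`, `u`, `v`. If the derivative `d` lies in the same interval as `s_q`, its formula
rearranges to `h(μ, ν) + Λ(φ^d, ν) = 0`. -/

lemma shift_iterate (x : Shift N) (m k : ℕ) : (shift^[m] x) k = x (m + k) := by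
  induction m generalizing x with
  | zero => simp
  | succ m ih =>
    rw [Function.iterate_succ_apply, ih]
    simp only [shift]
    congr 1
    omega

@[simp] lemma length_pref (x : Shift N) (n : ℕ) : (pref x n).length = n := by simp [pref]

lemma pref_add (x : Shift N) (m n : ℕ) :
    pref x (m + n) = pref x m ++ pref (shift^[m] x) n := by
  simp only [pref]
  rw [← List.ofFn_fin_append]
  congr 1
  funext k
  refine Fin.addCases (fun i => ?_) (fun i => ?_) k
  · simp
  · simp [shift_iterate]

lemma measurable_shift : Measurable (shift : Shift N → Shift N) :=
  measurable_pi_lambda _ fun k => measurable_pi_apply (k + 1)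

/-- The sum of a function over all words of a given length. -/
def wordSum (n : ℕ) (f : List (Fin N) → ℝ) : ℝ := ∑ w : Fin n → Fin N, f (List.ofFn w)

lemma wordSum_add_length (m n : ℕ) (f : List (Fin N) → ℝ) :
    wordSum (m + n) f = wordSum m fun v => wordSum n fun w => f (v ++ w) := by
  simp only [wordSum]
  rw [← Fintype.sum_prod_type']
  refine (Fintype.sum_equiv (Fin.appendEquiv m n) _ _ ?_).symm
  rintro ⟨v, w⟩
  simp [Fin.appendEquiv, List.ofFn_fin_append]

lemma wordSum_congr {n : ℕ} {f g : List (Fin N) → ℝ} (h : ∀ w, w.length = n → f w = g w) :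
    wordSum n f = wordSum n g :=
  Finset.sum_congr rfl fun w _ => h _ (by simp)

lemma wordSum_le {n : ℕ} {f g : List (Fin N) → ℝ} (h : ∀ w, w.length = n → f w ≤ g w) :
    wordSum n f ≤ wordSum n g :=
  Finset.sum_le_sum fun w _ => h _ (by simp)

lemma wordSum_nonneg {n : ℕ} {f : List (Fin N) → ℝ} (h : ∀ w, 0 ≤ f w) : 0 ≤ wordSum n f :=
  Finset.sum_nonneg fun _ _ => h _

lemma wordSum_pos [NeZero N] {n : ℕ} {f : List (Fin N) → ℝ} (h : ∀ w, 0 < f w) :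
    0 < wordSum n f :=
  Finset.sum_pos (fun _ _ => h _) ⟨fun _ => 0, Finset.mem_univ _⟩

lemma wordSum_const_mul (n : ℕ) (c : ℝ) (f : List (Fin N) → ℝ) :
    wordSum n (fun w => c * f w) = c * wordSum n f := (Finset.mul_sum _ _ _).symm

lemma wordSum_mul_const (n : ℕ) (c : ℝ) (f : List (Fin N) → ℝ) :
    wordSum n (fun w => f w * c) = wordSum n f * c := (Finset.sum_mul _ _ _).symm

/-! ### Measures of cylinders -/

lemma cylMeasure_nonneg (ν : Measure (Shift N)) (w : List (Fin N)) : 0 ≤ cylMeasure ν w :=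
  measureReal_nonneg

lemma measurable_coords (n : ℕ) : Measurable fun (x : Shift N) (k : Fin n) => x k :=
  measurable_pi_lambda _ fun k => measurable_pi_apply (k : ℕ)

lemma measurable_comp_pref (g : List (Fin N) → ℝ) (n : ℕ) :
    Measurable fun x : Shift N => g (pref x n) :=
  (measurable_of_finite fun w : Fin n → Fin N => g (List.ofFn w)).comp (measurable_coords n)

lemma measurableSet_pref_mem (S : Set (List (Fin N))) (n : ℕ) :
    MeasurableSet {x : Shift N | pref x n ∈ S} :=
  measurable_coords n (Set.toFinite {w : Fin n → Fin N | List.ofFn w ∈ S}).measurableSet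

lemma measurableSet_wordCylinder (w : List (Fin N)) : MeasurableSet (wordCylinder w) :=
  measurableSet_pref_mem {w} w.length

lemma integrable_comp_pref (ν : Measure (Shift N)) [IsFiniteMeasure ν] (g : List (Fin N) → ℝ)
    (n : ℕ) : Integrable (fun x => g (pref x n)) ν :=
  Integrable.comp_measurable (g := fun w : Fin n → Fin N => g (List.ofFn w))
    Integrable.of_finite (measurable_coords n)

lemma wordCylinder_ofFn {n : ℕ} (w : Fin n → Fin N) :
    wordCylinder (List.ofFn w) = (fun (x : Shift N) (k : Fin n) => x k) ⁻¹' {w} := by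
  ext x
  simp only [wordCylinder, Set.mem_ofPred_eq, Set.mem_preimage, Set.mem_singleton_iff, pref]
  have : ∀ k, k = n → ((List.ofFn fun i : Fin k => x i) = List.ofFn w ↔
      (fun i : Fin n => x i) = w) := by
    rintro k rfl
    exact List.ofFn_inj
  exact this _ (by simp)

lemma integral_comp_pref (ν : Measure (Shift N)) [IsFiniteMeasure ν] (g : List (Fin N) → ℝ)
    (n : ℕ) : ∫ x, g (pref x n) ∂ν = wordSum n fun w => cylMeasure ν w * g w := by
  have h := integral_map (μ := ν) (measurable_coords (N := N) n).aemeasurable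
    (f := fun w : Fin n → Fin N => g (List.ofFn w))
    (measurable_of_finite _).aestronglyMeasurable
  refine h.symm.trans ?_
  rw [integral_fintype (Integrable.of_finite)]
  refine Finset.sum_congr rfl fun w _ => ?_
  simp only [cylMeasure]
  rw [smul_eq_mul, wordCylinder_ofFn, measureReal_def, measureReal_def,
    Measure.map_apply (measurable_coords n) (MeasurableSet.singleton w)]

lemma wordSum_cylMeasure (ν : Measure (Shift N)) [IsProbabilityMeasure ν] (n : ℕ) :
    wordSum n (cylMeasure ν) = 1 := by
  have h := integral_comp_pref ν (fun _ => 1) n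
  simpa using h.symm

/-- The indicator of "the prefix is `v`" is integrated once at level `v.length` and once at level
`v.length + n`. -/
lemma cylMeasure_eq_wordSum (ν : Measure (Shift N)) [IsFiniteMeasure ν] (v : List (Fin N))
    (n : ℕ) : cylMeasure ν v = wordSum n fun w => cylMeasure ν (v ++ w) := by
  classical
  have h1 := integral_comp_pref ν (fun w => if w = v then 1 else 0) v.length
  have h2 := integral_comp_pref ν (fun w => if w.take v.length = v then 1 else 0) (v.length + n)
  have h3 : ∀ x : Shift N, (pref x (v.length + n)).take v.length = pref x v.length := fun x => by
    rw [pref_add, List.take_left' (by simp)]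
  simp only [h3] at h2
  have h4 : ∫ x, (if pref x v.length = v then (1 : ℝ) else 0) ∂ν = cylMeasure ν v := by
    rw [cylMeasure, ← integral_indicator_one (measurableSet_wordCylinder v)]
    refine integral_congr_ae (Eventually.of_forall fun x => ?_)
    simp [Set.indicator_apply, wordCylinder]
  rw [h4] at h1 h2
  rw [h2, wordSum_add_length]
  rw [wordSum, Finset.sum_eq_single_of_mem (fun k => v.get k) (Finset.mem_univ _)]
  · refine wordSum_congr fun w _ => ?_
    rw [List.ofFn_get]
    simp
  · intro b _ hb
    refine Finset.sum_eq_zero fun w _ => ?_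
    beta_reduce
    rw [List.take_left' (by simp), if_neg, mul_zero]
    intro hv
    refine hb (List.ofFn_injective ?_)
    rw [hv]
    exact (List.ofFn_get v).symm

lemma measureReal_pref_mem (ν : Measure (Shift N)) [IsFiniteMeasure ν] (S : Set (List (Fin N)))
    (n : ℕ) [DecidablePred (· ∈ S)] :
    ν.real {x | pref x n ∈ S} = wordSum n fun w => cylMeasure ν w * if w ∈ S then 1 else 0 := by
  rw [← integral_comp_pref ν (fun w => if w ∈ S then 1 else 0),
    ← integral_indicator_one (measurableSet_pref_mem S n)]
  refine integral_congr_ae (Eventually.of_forall fun x => ?_)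
  simp [Set.indicator_apply]

lemma cylMeasure_append_le_left (ν : Measure (Shift N)) [IsFiniteMeasure ν]
    (v w : List (Fin N)) : cylMeasure ν (v ++ w) ≤ cylMeasure ν v := by
  refine measureReal_mono fun x hx => ?_
  simp only [wordCylinder, Set.mem_ofPred_eq, List.length_append, pref_add] at hx ⊢
  exact (List.append_inj hx (by simp)).1

lemma measurePreserving_iterate {ν : Measure (Shift N)} (hν : ν ∈ invariantMeasures N) (n : ℕ) :
    MeasurePreserving shift^[n] ν ν := hν.2.iterate n

lemma cylMeasure_append_le_right {ν : Measure (Shift N)} (hν : ν ∈ invariantMeasures N)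
    (v w : List (Fin N)) : cylMeasure ν (v ++ w) ≤ cylMeasure ν w := by
  have := hν.1
  have h := (measurePreserving_iterate hν v.length).measureReal_preimage
    (measurableSet_wordCylinder w).nullMeasurableSet
  rw [cylMeasure, cylMeasure, ← h]
  refine measureReal_mono fun x hx => ?_
  simp only [wordCylinder, Set.mem_ofPred_eq, List.length_append, pref_add, Set.mem_preimage]
    at hx ⊢
  exact (List.append_inj hx (by simp)).2

lemma integral_comp_pref_shift {ν : Measure (Shift N)} (hν : ν ∈ invariantMeasures N)
    (g : List (Fin N) → ℝ) (m n : ℕ) :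
    ∫ x, g (pref (shift^[m] x) n) ∂ν = ∫ x, g (pref x n) ∂ν := by
  have h := measurePreserving_iterate hν m
  conv_rhs => rw [← h.map_eq]
  rw [integral_map h.measurable.aemeasurable
    (measurable_comp_pref g n).aestronglyMeasurable]

lemma neZero_of_isProbabilityMeasure (ν : Measure (Shift N)) [IsProbabilityMeasure ν] :
    NeZero N := by
  constructor
  rintro rfl
  obtain ⟨x⟩ := nonempty_of_isProbabilityMeasure ν
  exact (x 0).elim0

/-! ### Almost additive sequences and potentials -/

/-- An almost additive sequence has a linear rate, up to a bounded error. -/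
lemma exists_rate_of_almostAdditive {a : ℕ → ℝ} {C : ℝ}
    (h : ∀ m n, |a (m + n) - a m - a n| ≤ C) :
    ∃ L, Tendsto (fun n : ℕ => a n / n) atTop (𝓝 L) ∧ ∀ n : ℕ, |a n - n * L| ≤ C := by
  have h' := fun m n => abs_le.1 (h m n)
  have h0 : |a 0| ≤ C := by simpa using h 0 0
  have hC : 0 ≤ C := (abs_nonneg _).trans h0
  -- A crude linear bound, needed only for the boundedness hypothesis in Fekete's lemma.
  have hlin : ∀ n : ℕ, |a n| ≤ n * (|a 1| + C) + C := by
    intro n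
    induction n with
    | zero => simpa using h0
    | succ n ih =>
      have h1 := h' n 1
      have h2 := abs_le.1 ih
      have h3 := neg_abs_le (a 1)
      have h4 := le_abs_self (a 1)
      push_cast
      rw [abs_le]
      constructor <;> linarith
  have hbd : ∀ b : ℕ → ℝ, (∀ n : ℕ, -(n * (|a 1| + C) + C + C) ≤ b n) →
      BddBelow (Set.range fun n : ℕ => b n / n) := by
    rintro b hb
    refine ⟨-(|a 1| + C + C + C), ?_⟩
    rintro _ ⟨n, rfl⟩
    simp only
    rcases Nat.eq_zero_or_pos n with rfl | hn
    · simp only [Nat.cast_zero, div_zero]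
      have := abs_nonneg (a 1)
      linarith
    · have hn' : (1 : ℝ) ≤ n := by exact_mod_cast hn
      rw [le_div_iff₀ (by linarith)]
      have := hb n
      nlinarith
  -- Both `a + C` and `-a + C` are subadditive. Their Fekete limits are infima, so the common rate
  -- bounds `a n` from both sides with error `C`.
  have s1 : Subadditive fun n => a n + C := fun m n => by
    have := h' m n
    linarith
  have s2 : Subadditive fun n => -a n + C := fun m n => by
    have := h' m n
    linarith
  have b1 := hbd (fun n => a n + C) fun n => by
    have := abs_le.1 (hlin n)
    linarith
  have b2 := hbd (fun n => -a n + C) fun n => by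
    have := abs_le.1 (hlin n)
    linarith
  have hz : Tendsto (fun n : ℕ => C / (n : ℝ)) atTop (𝓝 0) := tendsto_const_div_atTop_nhds_zero_nat C
  have t1 : Tendsto (fun n : ℕ => a n / n) atTop (𝓝 s1.lim) := by
    have := (s1.tendsto_lim b1).sub hz
    simp only [sub_zero] at this
    refine this.congr fun n => ?_
    ring
  have t2 : Tendsto (fun n : ℕ => a n / n) atTop (𝓝 (-s2.lim)) := by
    have := ((s2.tendsto_lim b2).sub hz).neg
    simp only [sub_zero] at this
    refine this.congr fun n => ?_
    ring
  have e := tendsto_nhds_unique t1 t2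
  refine ⟨s1.lim, t1, fun n => ?_⟩
  rcases Nat.eq_zero_or_pos n with rfl | hn
  · simpa using h0
  · have hn' : (0 : ℝ) < n := by exact_mod_cast hn
    have u1 := s1.lim_le_div b1 hn.ne'
    have u2 := s2.lim_le_div b2 hn.ne'
    rw [le_div_iff₀ hn'] at u1 u2
    rw [abs_le]
    constructor
    · linarith
    · have : s2.lim = -s1.lim := by linarith
      rw [this] at u2
      linarith

/-- The function `u` on words is additive under concatenation up to the error `C`. -/
def IsAlmostAdditive (u : List (Fin N) → ℝ) (C : ℝ) : Prop :=
  ∀ v w, |u (v ++ w) - u v - u w| ≤ C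

namespace IsAlmostAdditive

variable {u v : List (Fin N) → ℝ} {C D : ℝ}

lemma nonneg (h : IsAlmostAdditive u C) : 0 ≤ C := (abs_nonneg _).trans (h [] [])

lemma mono (h : IsAlmostAdditive u C) (hCD : C ≤ D) : IsAlmostAdditive u D :=
  fun x y => (h x y).trans hCD

lemma add (h : IsAlmostAdditive u C) (h' : IsAlmostAdditive v D) :
    IsAlmostAdditive (fun w => u w + v w) (C + D) := fun x y => by
  have h1 := h x y
  have h2 := h' x y
  rw [abs_le] at *
  constructor <;> linarith [h1.1, h1.2, h2.1, h2.2]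

lemma const_mul (h : IsAlmostAdditive u C) (c : ℝ) :
    IsAlmostAdditive (fun w => c * u w) (|c| * C) := fun x y => by
  have : c * u (x ++ y) - c * u x - c * u y = c * (u (x ++ y) - u x - u y) := by ring
  rw [this, abs_mul]
  exact mul_le_mul_of_nonneg_left (h x y) (abs_nonneg c)

end IsAlmostAdditive

/-! ### Exponents, entropy and pressure -/

/-- The limit `Λ` of an almost additive potential, given by its logarithm. -/
def rate (u : List (Fin N) → ℝ) (ν : Measure (Shift N)) : ℝ := Lam (fun w => Real.exp (u w)) ν

/-- The entropy of the partition into cylinders of level `n`. -/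
def cylEntropy (ν : Measure (Shift N)) (n : ℕ) : ℝ :=
  -∫ x, Real.log (cylMeasure ν (pref x n)) ∂ν

/-- The logarithm of the partition function. -/
def logPart (u : List (Fin N) → ℝ) (n : ℕ) : ℝ := Real.log (wordSum n fun w => Real.exp (u w))

lemma almostAdditive_integral {u : List (Fin N) → ℝ} {C : ℝ} (h : IsAlmostAdditive u C)
    {ν : Measure (Shift N)} (hν : ν ∈ invariantMeasures N) (m n : ℕ) :
    |∫ x, u (pref x (m + n)) ∂ν - ∫ x, u (pref x m) ∂ν - ∫ x, u (pref x n) ∂ν| ≤ C := by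
  have := hν.1
  rw [← integral_comp_pref_shift hν u m n]
  have i2 : Integrable (fun x => u (pref (shift^[m] x) n)) ν :=
    (measurePreserving_iterate hν m).integrable_comp_of_integrable (integrable_comp_pref ν u n)
  have i1 : Integrable (fun x => u (pref x (m + n)) - u (pref x m)) ν :=
    (integrable_comp_pref ν u _).sub (integrable_comp_pref ν u _)
  rw [← integral_sub (integrable_comp_pref ν u _) (integrable_comp_pref ν u _),
    ← integral_sub i1 i2]
  have := norm_integral_le_of_norm_le_const (μ := ν) (C := C)
    (f := fun x => u (pref x (m + n)) - u (pref x m) - u (pref (shift^[m] x) n))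
    (Eventually.of_forall fun x => by
      rw [pref_add]
      exact h _ _)
  simpa using this

lemma rate_spec {u : List (Fin N) → ℝ} {C : ℝ} (h : IsAlmostAdditive u C)
    {ν : Measure (Shift N)} (hν : ν ∈ invariantMeasures N) :
    Tendsto (fun n : ℕ => (∫ x, u (pref x n) ∂ν) / n) atTop (𝓝 (rate u ν)) ∧
      ∀ n : ℕ, |∫ x, u (pref x n) ∂ν - n * rate u ν| ≤ C := by
  obtain ⟨L, hL, hL'⟩ := exists_rate_of_almostAdditive (a := fun n => ∫ x, u (pref x n) ∂ν)
    (almostAdditive_integral h hν)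
  have : rate u ν = L := by
    refine Tendsto.limUnder_eq (hL.congr fun n => ?_)
    simp only [Real.log_exp]
    ring
  rw [this]
  exact ⟨hL, hL'⟩

lemma cylEntropy_eq (ν : Measure (Shift N)) [IsFiniteMeasure ν] (n : ℕ) :
    cylEntropy ν n = wordSum n fun w => Real.negMulLog (cylMeasure ν w) := by
  rw [cylEntropy, integral_comp_pref ν fun w => Real.log (cylMeasure ν w)]
  simp [wordSum, Real.negMulLog]

/-- Gibbs' inequality. -/
lemma cylEntropy_le (ν : Measure (Shift N)) [IsProbabilityMeasure ν] (n : ℕ)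
    (g : List (Fin N) → ℝ) (hg : ∀ w, 0 ≤ g w) (hg1 : wordSum n g ≤ 1)
    (hac : ∀ w, w.length = n → g w = 0 → cylMeasure ν w = 0) :
    cylEntropy ν n ≤ -∫ x, Real.log (g (pref x n)) ∂ν := by
  rw [cylEntropy_eq, integral_comp_pref ν fun w => Real.log (g w)]
  -- Termwise this is `log t ≤ t - 1` at `t = g w / ν([w])`; terms with `ν([w]) = 0` are treated
  -- apart.
  have key : wordSum n (fun w => Real.negMulLog (cylMeasure ν w)
      + cylMeasure ν w * Real.log (g w)) ≤ wordSum n fun w => g w - cylMeasure ν w := by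
    refine wordSum_le fun w hw => ?_
    rcases (cylMeasure_nonneg ν w).eq_or_lt with h0 | h0
    · rw [← h0]
      simpa using hg w
    · have hgw : 0 < g w := (hg w).lt_of_ne fun h => h0.ne' (hac w hw h.symm)
      have := Real.log_le_sub_one_of_pos (div_pos hgw h0)
      rw [Real.log_div hgw.ne' h0.ne'] at this
      have h2 := mul_le_mul_of_nonneg_left this h0.le
      have h3 : cylMeasure ν w * (g w / cylMeasure ν w - 1) = g w - cylMeasure ν w := by
        field_simp
      rw [Real.negMulLog]
      linarith
  simp only [wordSum, Finset.sum_add_distrib, Finset.sum_sub_distrib] at key hg1 ⊢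
  have := wordSum_cylMeasure ν n
  rw [wordSum] at this
  linarith

lemma cylEntropy_nonneg (ν : Measure (Shift N)) [IsProbabilityMeasure ν] (n : ℕ) :
    0 ≤ cylEntropy ν n := by
  rw [cylEntropy_eq]
  exact wordSum_nonneg fun w => Real.negMulLog_nonneg (cylMeasure_nonneg ν w) measureReal_le_one

/-- Gibbs' inequality against the product of the level `m` and level `n` distributions; by
invariance the second factor integrates to the entropy of level `n`. -/
lemma subadditive_cylEntropy {ν : Measure (Shift N)} (hν : ν ∈ invariantMeasures N) :
    Subadditive (cylEntropy ν) := by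
  intro m n
  have := hν.1
  have h := cylEntropy_le ν (m + n)
    (fun w => cylMeasure ν (w.take m) * cylMeasure ν (w.drop m))
    (fun w => mul_nonneg (cylMeasure_nonneg _ _) (cylMeasure_nonneg _ _)) (by
      rw [wordSum_add_length]
      have : ∀ v : List (Fin N), v.length = m → (wordSum n fun w =>
          cylMeasure ν ((v ++ w).take m) * cylMeasure ν ((v ++ w).drop m)) = cylMeasure ν v := by
        intro v hv
        simp only [List.take_left' hv, List.drop_left' hv]
        rw [wordSum_const_mul, wordSum_cylMeasure, mul_one]
      rw [wordSum_congr this, wordSum_cylMeasure]) (by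
      intro w _ h0
      rw [← List.take_append_drop m w]
      rcases mul_eq_zero.1 h0 with h | h
      · exact le_antisymm ((cylMeasure_append_le_left ν _ _).trans_eq h) (cylMeasure_nonneg _ _)
      · exact le_antisymm ((cylMeasure_append_le_right hν _ _).trans_eq h)
          (cylMeasure_nonneg _ _))
  refine h.trans_eq ?_
  have i1 := integrable_comp_pref ν (fun w => Real.log (cylMeasure ν w)) m
  have i2 : Integrable (fun x => Real.log (cylMeasure ν (pref (shift^[m] x) n))) ν :=
    (measurePreserving_iterate hν m).integrable_comp_of_integrable
      (integrable_comp_pref ν (fun w => Real.log (cylMeasure ν w)) n)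
  rw [cylEntropy, cylEntropy,
    ← integral_comp_pref_shift hν (fun w => Real.log (cylMeasure ν w)) m n, ← neg_add,
    ← integral_add i1 i2]
  congr 1
  -- Splitting the logarithm of the product requires nonzero factors, since `Real.log 0 = 0`.
  have hpos : ∀ k, ∀ᵐ x ∂ν, cylMeasure ν (pref x k) ≠ 0 := by
    intro k
    rw [ae_iff, ← measureReal_eq_zero_iff]
    classical
    have := measureReal_pref_mem ν {w | cylMeasure ν w = 0} k
    simp only [Set.mem_ofPred_eq, mul_ite, mul_one, mul_zero] at this
    simp only [ne_eq, not_not]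
    rw [this]
    refine Finset.sum_eq_zero fun w _ => ?_
    beta_reduce
    split_ifs with h
    · exact h
    · rfl
  have h1 := hpos m
  have h2 := (measurePreserving_iterate hν m).quasiMeasurePreserving.ae (hpos n)
  refine integral_congr_ae ?_
  filter_upwards [h1, h2] with x h1 h2
  rw [pref_add, List.take_left' (by simp), List.drop_left' (by simp), Real.log_mul h1 h2]

lemma entropy_spec {ν : Measure (Shift N)} (hν : ν ∈ invariantMeasures N) :
    Tendsto (fun n : ℕ => cylEntropy ν n / n) atTop (𝓝 (entropy ν)) ∧
      ∀ n : ℕ, n * entropy ν ≤ cylEntropy ν n := by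
  have := hν.1
  have s := subadditive_cylEntropy hν
  have hb : BddBelow (Set.range fun n : ℕ => cylEntropy ν n / n) := by
    refine ⟨0, ?_⟩
    rintro _ ⟨n, rfl⟩
    exact div_nonneg (cylEntropy_nonneg ν n) (Nat.cast_nonneg n)
  have ht := s.tendsto_lim hb
  have : entropy ν = s.lim := by
    refine Tendsto.limUnder_eq (ht.congr fun n => ?_)
    rw [cylEntropy_eq, wordSum]
    ring
  rw [this]
  refine ⟨ht, fun n => ?_⟩
  rcases Nat.eq_zero_or_pos n with rfl | hn
  · simpa using cylEntropy_nonneg ν 0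
  · have h := s.lim_le_div hb hn.ne'
    rw [le_div_iff₀ (by exact_mod_cast hn)] at h
    linarith

lemma exp_logPart [NeZero N] (u : List (Fin N) → ℝ) (n : ℕ) :
    Real.exp (logPart u n) = wordSum n fun w => Real.exp (u w) :=
  Real.exp_log (wordSum_pos fun _ => Real.exp_pos _)

/-- The partition sum over words of length `m + n` is the product of the two shorter sums up to a
factor `exp (±C)`. -/
lemma almostAdditive_logPart [NeZero N] {u : List (Fin N) → ℝ} {C : ℝ}
    (h : IsAlmostAdditive u C) (m n : ℕ) :
    |logPart u (m + n) - logPart u m - logPart u n| ≤ C := by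
  have e : ∀ c : ℝ, Real.exp (c + logPart u m + logPart u n)
      = wordSum m fun v => wordSum n fun w => Real.exp (c + u v + u w) := by
    intro c
    rw [Real.exp_add, Real.exp_add, exp_logPart, exp_logPart]
    simp only [Real.exp_add]
    have : ∀ v : List (Fin N), (wordSum n fun w => Real.exp c * Real.exp (u v) * Real.exp (u w))
        = Real.exp c * Real.exp (u v) * wordSum n fun w => Real.exp (u w) := fun v =>
      wordSum_const_mul _ _ _
    simp only [this]
    rw [wordSum_mul_const, wordSum_const_mul]
  have l : Real.exp (-C + logPart u m + logPart u n) ≤ Real.exp (logPart u (m + n)) := by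
    rw [e, exp_logPart, wordSum_add_length]
    refine wordSum_le fun v _ => wordSum_le fun w _ => Real.exp_le_exp.2 ?_
    have := (abs_le.1 (h v w)).1
    linarith
  have r : Real.exp (logPart u (m + n)) ≤ Real.exp (C + logPart u m + logPart u n) := by
    rw [e, exp_logPart, wordSum_add_length]
    refine wordSum_le fun v _ => wordSum_le fun w _ => Real.exp_le_exp.2 ?_
    have := (abs_le.1 (h v w)).2
    linarith
  rw [Real.exp_le_exp] at l r
  rw [abs_le]
  constructor <;> linarith

/-- The pressure of the potential `exp u`. -/
def logPressure (u : List (Fin N) → ℝ) : ℝ := pressure fun w => Real.exp (u w)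

lemma logPressure_spec [NeZero N] {u : List (Fin N) → ℝ} {C : ℝ} (h : IsAlmostAdditive u C) :
    Tendsto (fun n : ℕ => logPart u n / n) atTop (𝓝 (logPressure u)) ∧
      ∀ n : ℕ, |logPart u n - n * logPressure u| ≤ C := by
  obtain ⟨L, hL, hL'⟩ := exists_rate_of_almostAdditive (almostAdditive_logPart h)
  have : logPressure u = L := by
    refine Tendsto.limUnder_eq (hL.congr fun n => ?_)
    rw [logPart, wordSum]
    ring
  rw [this]
  exact ⟨hL, hL'⟩

/-- Gibbs' inequality against the normalized weights `exp (u w) / Z_n`. -/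
lemma cylEntropy_add_integral_le (u : List (Fin N) → ℝ) (ν : Measure (Shift N))
    [IsProbabilityMeasure ν] (n : ℕ) :
    cylEntropy ν n + ∫ x, u (pref x n) ∂ν ≤ logPart u n := by
  have := neZero_of_isProbabilityMeasure ν
  have h := cylEntropy_le ν n (fun w => Real.exp (u w - logPart u n))
    (fun w => (Real.exp_pos _).le) (by
      simp only [Real.exp_sub, div_eq_mul_inv]
      rw [wordSum_mul_const, exp_logPart, mul_inv_cancel₀]
      exact (wordSum_pos fun _ => Real.exp_pos _).ne')
    (fun w _ h0 => absurd h0 (Real.exp_pos _).ne')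
  simp only [Real.log_exp] at h
  rw [integral_sub (integrable_comp_pref ν u n) (integrable_const _)] at h
  simp only [integral_const, probReal_univ, one_smul] at h
  linarith

/-- The variational inequality. -/
lemma entropy_add_rate_le {u : List (Fin N) → ℝ} {C : ℝ} (h : IsAlmostAdditive u C)
    {ν : Measure (Shift N)} (hν : ν ∈ invariantMeasures N) :
    entropy ν + rate u ν ≤ logPressure u := by
  have := hν.1
  have := neZero_of_isProbabilityMeasure ν
  refine le_of_tendsto_of_tendsto' ((entropy_spec hν).1.add (rate_spec h hν).1)
    (logPressure_spec h).1 fun n => ?_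
  rw [← add_div]
  exact div_le_div_of_nonneg_right (cylEntropy_add_integral_le u ν n) (Nat.cast_nonneg n)

lemma isEquilibriumState_iff {u : List (Fin N) → ℝ} {ν : Measure (Shift N)}
    (hν : ν ∈ invariantMeasures N) :
    IsEquilibriumState (fun w => Real.exp (u w)) ν ↔
      entropy ν + rate u ν = logPressure u :=
  ⟨fun H => H.2.symm, fun H => ⟨hν, H.symm⟩⟩

/-- A measure is an equilibrium state if the variational inequality is sharp up to a bounded error
on every level. -/
lemma isEquilibriumState_of_le {u : List (Fin N) → ℝ} {C K : ℝ} (h : IsAlmostAdditive u C)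
    {ν : Measure (Shift N)} (hν : ν ∈ invariantMeasures N)
    (hK : ∀ n : ℕ, n * logPressure u - K ≤ cylEntropy ν n + ∫ x, u (pref x n) ∂ν) :
    IsEquilibriumState (fun w => Real.exp (u w)) ν := by
  refine (isEquilibriumState_iff hν).2 ((entropy_add_rate_le h hν).antisymm ?_)
  have hz : Tendsto (fun n : ℕ => logPressure u - K / (n : ℝ)) atTop (𝓝 (logPressure u)) := by
    simpa using tendsto_const_nhds.sub (tendsto_const_div_atTop_nhds_zero_nat K)
  refine le_of_tendsto_of_tendsto hz ((entropy_spec hν).1.add (rate_spec h hν).1) ?_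
  filter_upwards [eventually_gt_atTop 0] with n hn
  have hn' : (0 : ℝ) < n := by exact_mod_cast hn
  rw [← add_div, le_div_iff₀ hn', sub_mul, div_mul_cancel₀ _ hn'.ne']
  linarith [hK n]

/-- The entropy is the infimum of the normalized cylinder entropies, and the rate of `u` has error
`C`. This finite-level form involves finitely many cylinders, so it passes to weak limits. -/
lemma IsEquilibriumState.le {u : List (Fin N) → ℝ} {C : ℝ} (h : IsAlmostAdditive u C)
    {ν : Measure (Shift N)} (H : IsEquilibriumState (fun w => Real.exp (u w)) ν) (n : ℕ) :
    n * logPressure u - C ≤ cylEntropy ν n + ∫ x, u (pref x n) ∂ν := by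
  have h1 := (isEquilibriumState_iff H.1).1 H
  have h2 := (entropy_spec H.1).2 n
  have h3 := (abs_le.1 ((rate_spec h H.1).2 n)).1
  rw [← h1, mul_add]
  linarith

/-! ### Cylinders determine measures -/

lemma exists_eq_pref_mem {t : Set (Shift N)} (ht : t ∈ measurableCylinders fun _ : ℕ => Fin N) :
    ∃ (n : ℕ) (S : Set (List (Fin N))), t = {x | pref x n ∈ S} := by
  obtain ⟨s, T, -, rfl⟩ := (mem_measurableCylinders t).1 ht
  -- A set determined by the coordinates in `s` is determined by the prefix whose last index is the
  -- largest element of `s`.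
  refine ⟨s.sup id + 1, {w | ∃ y ∈ cylinder s T, pref y (s.sup id + 1) = w}, ?_⟩
  ext x
  simp only [Set.mem_ofPred_eq]
  refine ⟨fun hx => ⟨x, hx, rfl⟩, ?_⟩
  rintro ⟨y, hy, hxy⟩
  have h := List.ofFn_injective hxy
  rw [mem_cylinder] at hy ⊢
  convert hy using 1
  funext i
  have hi : (i : ℕ) < s.sup id + 1 := Nat.lt_succ_of_le (Finset.le_sup (f := id) i.2)
  exact (congrFun h ⟨i, hi⟩).symm

/-- The cylinder sets form a ring generating the σ-algebra, so every Borel set is approximated by a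
set depending on one prefix. -/
lemma exists_symmDiff_lt (m : Measure (Shift N)) [IsFiniteMeasure m] {B : Set (Shift N)}
    (hB : MeasurableSet B) {ε : ℝ} (hε : 0 < ε) :
    ∃ (n : ℕ) (S : Set (List (Fin N))),
      m.real ({x | pref x n ∈ S} \ B) < ε ∧ m.real (B \ {x | pref x n ∈ S}) < ε := by
  obtain ⟨t, ht, h⟩ := exists_measure_symmDiff_lt_of_generateFrom_isSetRing (μ := m)
    (isSetRing_measurableCylinders (α := fun _ : ℕ => Fin N))
    ⟨{Set.univ}, Set.countable_singleton _, by
      simpa using univ_mem_measurableCylinders (fun _ : ℕ => Fin N), by simp⟩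
    (generateFrom_measurableCylinders).symm hB (ENNReal.ofReal_pos.2 hε)
  obtain ⟨n, S, rfl⟩ := exists_eq_pref_mem ht
  have h' : m.real (symmDiff {x | pref x n ∈ S} B) < ε := by
    rw [measureReal_def]
    exact ENNReal.toReal_lt_of_lt_ofReal h
  exact ⟨n, S, (measureReal_mono (fun x hx => Or.inl hx)).trans_lt h',
    (measureReal_mono (fun x hx => Or.inr hx)).trans_lt h'⟩

lemma ext_cylMeasure {ν ν' : Measure (Shift N)} [IsProbabilityMeasure ν]
    [IsProbabilityMeasure ν'] (h : ∀ w, cylMeasure ν w = cylMeasure ν' w) : ν = ν' := by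
  refine ext_of_generate_finite _ (generateFrom_measurableCylinders).symm
    isPiSystem_measurableCylinders (fun t ht => ?_) (by simp)
  obtain ⟨n, S, rfl⟩ := exists_eq_pref_mem ht
  classical
  have : ν.real {x | pref x n ∈ S} = ν'.real {x | pref x n ∈ S} := by
    rw [measureReal_pref_mem, measureReal_pref_mem]
    exact wordSum_congr fun w _ => by rw [h]
  rwa [measureReal_def, measureReal_def,
    ENNReal.toReal_eq_toReal_iff' (measure_ne_top _ _) (measure_ne_top _ _)] at this

lemma cylMeasure_map_iterate (ν : Measure (Shift N)) [IsFiniteMeasure ν] (k : ℕ)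
    (w : List (Fin N)) :
    cylMeasure (ν.map shift^[k]) w = wordSum k fun v => cylMeasure ν (v ++ w) := by
  classical
  rw [cylMeasure, measureReal_def,
    Measure.map_apply (measurable_shift.iterate k) (measurableSet_wordCylinder w),
    ← measureReal_def]
  have h := measureReal_pref_mem ν {u | u.drop k = w} (k + w.length)
  have e : (shift^[k] ⁻¹' wordCylinder w : Set (Shift N))
      = {x | pref x (k + w.length) ∈ {u | u.drop k = w}} := by
    ext x
    simp only [wordCylinder, Set.mem_preimage, Set.mem_ofPred_eq]
    rw [pref_add, List.drop_left' (by simp)]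
  rw [e, h, wordSum_add_length]
  refine wordSum_congr fun v hv => ?_
  rw [wordSum, Finset.sum_eq_single_of_mem (fun k => w.get k) (Finset.mem_univ _)]
  · rw [List.ofFn_get]
    simp [List.drop_left' hv]
  · intro b _ hb
    rw [if_neg, mul_zero]
    rw [Set.mem_ofPred_eq, List.drop_left' hv]
    intro hw
    refine hb (List.ofFn_injective ?_)
    rw [hw]
    exact (List.ofFn_get w).symm

/-- Invariance becomes a family of finite linear identities between cylinder measures, and these
survive weak limits. -/
lemma mem_invariantMeasures_iff (ν : Measure (Shift N)) [IsProbabilityMeasure ν] :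
    ν ∈ invariantMeasures N ↔
      ∀ w, (wordSum 1 fun v => cylMeasure ν (v ++ w)) = cylMeasure ν w := by
  have h := fun w => cylMeasure_map_iterate ν 1 w
  simp only [Function.iterate_one] at h
  constructor
  · intro hν w
    rw [← h, hν.2.map_eq]
  · intro hν
    refine ⟨inferInstance, measurable_shift, ?_⟩
    have := Measure.isProbabilityMeasure_map (μ := ν) measurable_shift.aemeasurable (f := shift)
    exact ext_cylMeasure fun w => by rw [h, hν]

lemma isClopen_wordCylinder (w : List (Fin N)) : IsClopen (wordCylinder w) := by
  have hc : Continuous fun (x : Shift N) (k : Fin w.length) => x k :=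
    continuous_pi fun k => continuous_apply (k : ℕ)
  have : wordCylinder w = (fun (x : Shift N) (k : Fin w.length) => x k) ⁻¹' {w.get} := by
    rw [← wordCylinder_ofFn]
    congr 1
    exact (List.ofFn_get w).symm
  rw [this]
  exact (isClopen_discrete _).preimage hc

/-- Weak compactness of the probability measures on the shift. -/
lemma exists_tendsto_cylMeasure {ι : Type*} (F : Ultrafilter ι) (ν : ι → Measure (Shift N))
    (hν : ∀ᶠ i in F, IsProbabilityMeasure (ν i)) :
    ∃ m : Measure (Shift N), IsProbabilityMeasure m ∧
      ∀ w, Tendsto (fun i => cylMeasure (ν i) w) F (𝓝 (cylMeasure m w)) := by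
  classical
  obtain ⟨i₀, hi₀⟩ := hν.exists
  -- Indices outside the good set receive the arbitrary value `ν i₀`; the ultrafilter does not see
  -- them.
  let P : ι → ProbabilityMeasure (Shift N) := fun i =>
    if h : IsProbabilityMeasure (ν i) then ⟨ν i, h⟩ else ⟨ν i₀, hi₀⟩
  have hP := Ultrafilter.le_nhds_lim (F.map P)
  refine ⟨(F.map P).lim, inferInstance, fun w => ?_⟩
  have ht : Tendsto P F (𝓝 (F.map P).lim) := hP
  have h1 := ProbabilityMeasure.tendsto_measure_of_null_frontier_of_tendsto' ht
    (E := wordCylinder w) (by rw [(isClopen_wordCylinder w).frontier_eq]; simp)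
  have h2 := (ENNReal.tendsto_toReal (measure_ne_top _ _)).comp h1
  refine h2.congr' ?_
  filter_upwards [hν] with i hi
  have : P i = ⟨ν i, hi⟩ := dif_pos hi
  simp only [Function.comp_apply, this]
  rfl

lemma tendsto_wordSum {ι : Type*} {l : Filter ι} {n : ℕ} {f : ι → List (Fin N) → ℝ}
    {g : List (Fin N) → ℝ} (h : ∀ w, Tendsto (fun i => f i w) l (𝓝 (g w))) :
    Tendsto (fun i => wordSum n (f i)) l (𝓝 (wordSum n g)) :=
  tendsto_finsetSum _ fun _ _ => h _

/-- There is a probability measure with prescribed measures of the cylinders of one level. -/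
lemma exists_cylMeasure_eq [NeZero N] (n : ℕ) (c : List (Fin N) → ℝ) (hc : ∀ w, 0 ≤ c w)
    (hc1 : wordSum n c = 1) :
    ∃ m : Measure (Shift N), IsProbabilityMeasure m ∧
      ∀ v j, v.length + j = n → cylMeasure m v = wordSum j fun w => c (v ++ w) := by
  -- Each word of length `n` carries one atom, at its continuation by the letter `0`.
  let x : (Fin n → Fin N) → Shift N := fun w k => if h : k < n then w ⟨k, h⟩ else 0
  have hx : ∀ w (k : Fin n), x w k = w k := fun w k => by simp [x]
  let m : Measure (Shift N) := ∑ w : Fin n → Fin N,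
    ENNReal.ofReal (c (List.ofFn w)) • Measure.dirac (x w)
  have hm : IsProbabilityMeasure m := by
    constructor
    simp only [m, Measure.coe_finsetSum, Finset.sum_apply, Measure.smul_apply, measure_univ,
      smul_eq_mul, mul_one]
    rw [← ENNReal.ofReal_sum_of_nonneg fun w _ => hc _]
    rw [wordSum] at hc1
    rw [hc1, ENNReal.ofReal_one]
  have key : ∀ v : Fin n → Fin N, cylMeasure m (List.ofFn v) = c (List.ofFn v) := by
    intro v
    have hd : ∀ w : Fin n → Fin N, Measure.dirac (x w) (wordCylinder (List.ofFn v))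
        = if w = v then 1 else 0 := by
      intro w
      have hxw : (x w ∈ wordCylinder (List.ofFn v)) ↔ w = v := by
        rw [wordCylinder_ofFn, Set.mem_preimage, Set.mem_singleton_iff]
        exact Eq.congr_left (funext (hx w))
      rw [Measure.dirac_apply' _ (measurableSet_wordCylinder _)]
      by_cases hwv : w = v
      · rw [Set.indicator_of_mem (hxw.2 hwv), if_pos hwv]
        rfl
      · rw [Set.indicator_of_notMem (mt hxw.1 hwv), if_neg hwv]
    simp only [cylMeasure, measureReal_def, m, Measure.coe_finsetSum, Finset.sum_apply,
      Measure.smul_apply, smul_eq_mul, hd, mul_ite, mul_one, mul_zero, Finset.sum_ite_eq',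
      Finset.mem_univ, if_true]
    exact ENNReal.toReal_ofReal (hc _)
  refine ⟨m, hm, fun v j hj => ?_⟩
  rw [cylMeasure_eq_wordSum m v j]
  refine wordSum_congr fun w hw => ?_
  have hl : (v ++ w).length = n := by simp [hw, hj]
  subst hl
  have := key (v ++ w).get
  rwa [List.ofFn_get] at this

/-! ### Gibbs measures -/

/-- The measures of the cylinders are comparable to `exp (u w - n P)`. -/
def IsGibbs (u : List (Fin N) → ℝ) (K : ℝ) (ν : Measure (Shift N)) : Prop :=
  ∀ w : List (Fin N), Real.exp (-K + u w - w.length * logPressure u) ≤ cylMeasure ν w ∧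
    cylMeasure ν w ≤ Real.exp (K + u w - w.length * logPressure u)

lemma exp_mul_wordSum_le [NeZero N] (u : List (Fin N) → ℝ) (n : ℕ) (a : ℝ)
    (f : List (Fin N) → ℝ) (h : ∀ w, w.length = n → Real.exp (a + u w) ≤ f w) :
    Real.exp (a + logPart u n) ≤ wordSum n f := by
  rw [Real.exp_add, exp_logPart, ← wordSum_const_mul]
  exact wordSum_le fun w hw => by
    rw [← Real.exp_add]
    exact h w hw

lemma wordSum_le_exp_mul [NeZero N] (u : List (Fin N) → ℝ) (n : ℕ) (a : ℝ)
    (f : List (Fin N) → ℝ) (h : ∀ w, w.length = n → f w ≤ Real.exp (a + u w)) :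
    wordSum n f ≤ Real.exp (a + logPart u n) := by
  rw [Real.exp_add, exp_logPart, ← wordSum_const_mul]
  exact wordSum_le fun w hw => by
    rw [← Real.exp_add]
    exact h w hw

/-- The approximants have weights `exp (u w) / Z_n` on level `n`. One error `C` comes from splitting
`u`, one from splitting `log Z`, and one from replacing `log Z` by the pressure. -/
lemma exists_isGibbs_limit [NeZero N] {u : List (Fin N) → ℝ} {C : ℝ} (h : IsAlmostAdditive u C) :
    ∃ m : Measure (Shift N), IsProbabilityMeasure m ∧ IsGibbs u (3 * C) m := by
  have h1 : ∀ n, ∃ m : Measure (Shift N), IsProbabilityMeasure m ∧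
      ∀ v j, v.length + j = n →
        cylMeasure m v = wordSum j fun w => Real.exp (u (v ++ w) - logPart u n) := by
    refine fun n => exists_cylMeasure_eq n (fun w => Real.exp (u w - logPart u n))
      (fun w => (Real.exp_pos _).le) ?_
    simp only [Real.exp_sub, div_eq_mul_inv]
    rw [wordSum_mul_const, exp_logPart, mul_inv_cancel₀]
    exact (wordSum_pos fun _ => Real.exp_pos _).ne'
  choose m hm hmc using h1
  obtain ⟨ν, hν, hlim⟩ := exists_tendsto_cylMeasure (hyperfilter ℕ) m
    (Eventually.of_forall hm)
  have hP := (logPressure_spec h).2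
  have hA := almostAdditive_logPart h
  refine ⟨ν, hν, fun v => ?_⟩
  have hle : ((hyperfilter ℕ : Ultrafilter ℕ) : Filter ℕ) ≤ atTop := Nat.hyperfilter_le_atTop
  have hev : ∀ᶠ n in ((hyperfilter ℕ : Ultrafilter ℕ) : Filter ℕ), v.length ≤ n :=
    hle (eventually_ge_atTop _)
  have hb : ∀ᶠ n in ((hyperfilter ℕ : Ultrafilter ℕ) : Filter ℕ),
      Real.exp (-(3 * C) + u v - v.length * logPressure u) ≤ cylMeasure (m n) v ∧
      cylMeasure (m n) v ≤ Real.exp (3 * C + u v - v.length * logPressure u) := by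
    filter_upwards [hev] with n hn
    obtain ⟨j, rfl⟩ := Nat.exists_eq_add_of_le hn
    rw [hmc _ v j rfl]
    have a1 := abs_le.1 (hA v.length j)
    have a2 := abs_le.1 (hP v.length)
    constructor
    · refine le_trans (Real.exp_le_exp.2 ?_) (exp_mul_wordSum_le u j
        (-C + u v - logPart u (v.length + j)) _ fun w _ => Real.exp_le_exp.2 ?_)
      · linarith
      · linarith [abs_le.1 (h v w)]
    · refine le_trans (wordSum_le_exp_mul u j
        (C + u v - logPart u (v.length + j)) _ fun w _ => Real.exp_le_exp.2 ?_)
        (Real.exp_le_exp.2 ?_)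
      · linarith [abs_le.1 (h v w)]
      · linarith
  exact ⟨ge_of_tendsto (hlim v) (hb.mono fun _ => And.left),
    le_of_tendsto (hlim v) (hb.mono fun _ => And.right)⟩

/-- Cesàro averages along the shift restore invariance. Pushing forward by `k` steps costs one more
`C` for splitting `u` and one for `log Z_k`, uniformly in `k`, so the Gibbs bounds survive. -/
lemma exists_isGibbs [NeZero N] {u : List (Fin N) → ℝ} {C : ℝ} (h : IsAlmostAdditive u C) :
    ∃ ν ∈ invariantMeasures N, IsGibbs u (5 * C) ν := by
  obtain ⟨m, hm, hG⟩ := exists_isGibbs_limit h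
  have hmap : ∀ k, IsProbabilityMeasure (m.map shift^[k]) := fun k =>
    Measure.isProbabilityMeasure_map (measurable_shift.iterate k).aemeasurable
  have hP := (logPressure_spec h).2
  have hk : ∀ k w, Real.exp (-(5 * C) + u w - w.length * logPressure u)
      ≤ cylMeasure (m.map shift^[k]) w ∧
      cylMeasure (m.map shift^[k]) w ≤ Real.exp (5 * C + u w - w.length * logPressure u) := by
    intro k w
    rw [cylMeasure_map_iterate]
    have a2 := abs_le.1 (hP k)
    constructor
    · refine le_trans (Real.exp_le_exp.2 ?_) (exp_mul_wordSum_le u k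
        (-(4 * C) + u w - (k + w.length) * logPressure u) _ fun v hv =>
          le_trans (Real.exp_le_exp.2 ?_) (hG (v ++ w)).1)
      · linarith
      · rw [List.length_append, hv]
        push_cast
        linarith [abs_le.1 (h v w)]
    · refine le_trans (wordSum_le_exp_mul u k
        (4 * C + u w - (k + w.length) * logPressure u) _ fun v hv =>
          le_trans (hG (v ++ w)).2 (Real.exp_le_exp.2 ?_)) (Real.exp_le_exp.2 ?_)
      · rw [List.length_append, hv]
        push_cast
        linarith [abs_le.1 (h v w)]
      · linarith
  let ν : ℕ → Measure (Shift N) := fun n =>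
    ((n + 1 : ℕ) : ENNReal)⁻¹ • ∑ k ∈ Finset.range (n + 1), m.map shift^[k]
  have hνp : ∀ n, IsProbabilityMeasure (ν n) := by
    intro n
    constructor
    simp only [ν, Measure.smul_apply, Measure.coe_finsetSum, Finset.sum_apply, measure_univ,
      Finset.sum_const, Finset.card_range, smul_eq_mul, nsmul_eq_mul, mul_one]
    exact ENNReal.inv_mul_cancel (by simp) (ENNReal.natCast_ne_top _)
  have hνc : ∀ n w, cylMeasure (ν n) w
      = ((n + 1 : ℕ) : ℝ)⁻¹ * ∑ k ∈ Finset.range (n + 1), cylMeasure (m.map shift^[k]) w := by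
    intro n w
    simp only [ν, cylMeasure, measureReal_def, Measure.smul_apply, Measure.coe_finsetSum,
      Finset.sum_apply, smul_eq_mul, ENNReal.toReal_mul, ENNReal.toReal_inv,
      ENNReal.toReal_natCast]
    rw [ENNReal.toReal_sum fun k _ => measure_ne_top _ _]
  obtain ⟨μ, hμ, hlim⟩ := exists_tendsto_cylMeasure (hyperfilter ℕ) ν
    (Eventually.of_forall hνp)
  have hle : ((hyperfilter ℕ : Ultrafilter ℕ) : Filter ℕ) ≤ atTop := Nat.hyperfilter_le_atTop
  have hinv : ∀ w, (wordSum 1 fun v => cylMeasure μ (v ++ w)) = cylMeasure μ w := by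
    intro w
    have t1 : Tendsto (fun n => (wordSum 1 fun v => cylMeasure (ν n) (v ++ w))
        - cylMeasure (ν n) w) (hyperfilter ℕ)
        (𝓝 ((wordSum 1 fun v => cylMeasure μ (v ++ w)) - cylMeasure μ w)) :=
      (tendsto_wordSum fun v => hlim (v ++ w)).sub (hlim w)
    -- The average and its shift differ by a telescoping sum, so only the two boundary terms remain.
    have e : ∀ n, (wordSum 1 fun v => cylMeasure (ν n) (v ++ w)) - cylMeasure (ν n) w
        = ((n + 1 : ℕ) : ℝ)⁻¹ * (cylMeasure (m.map shift^[n + 1]) w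
          - cylMeasure (m.map shift^[0]) w) := by
      intro n
      have e1 : ∀ k, (wordSum 1 fun v => cylMeasure (m.map shift^[k]) (v ++ w))
          = cylMeasure (m.map shift^[k + 1]) w := by
        intro k
        rw [cylMeasure_map_iterate, wordSum_add_length]
        simp only [cylMeasure_map_iterate, List.append_assoc]
        simp only [wordSum]
        exact Finset.sum_comm
      simp only [hνc]
      rw [wordSum_const_mul, ← mul_sub]
      congr 1
      rw [← Finset.sum_range_sub (fun k => cylMeasure (m.map shift^[k]) w),
        Finset.sum_sub_distrib]
      congr 1
      simp only [← e1]
      simp only [wordSum]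
      exact Finset.sum_comm
    have t2 : Tendsto (fun n => (wordSum 1 fun v => cylMeasure (ν n) (v ++ w))
        - cylMeasure (ν n) w) atTop (𝓝 0) := by
      simp only [e]
      refine squeeze_zero_norm (a := fun n : ℕ => ((n + 1 : ℕ) : ℝ)⁻¹) (fun n => ?_)
        ((tendsto_inv_atTop_nhds_zero_nat (𝕜 := ℝ)).comp (tendsto_add_atTop_nat 1))
      rw [norm_mul, Real.norm_of_nonneg (by positivity)]
      refine mul_le_of_le_one_right (by positivity) ?_
      rw [Real.norm_eq_abs, abs_le]
      have b1 := cylMeasure_nonneg (m.map shift^[n + 1]) w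
      have b2 := cylMeasure_nonneg (m.map shift^[0]) w
      have b3 : cylMeasure (m.map shift^[n + 1]) w ≤ 1 := measureReal_le_one
      have b4 : cylMeasure (m.map shift^[0]) w ≤ 1 := measureReal_le_one
      constructor <;> linarith
    have := tendsto_nhds_unique t1 (t2.mono_left hle)
    linarith
  refine ⟨μ, (mem_invariantMeasures_iff μ).2 hinv, fun w => ?_⟩
  have hb : ∀ n, Real.exp (-(5 * C) + u w - w.length * logPressure u) ≤ cylMeasure (ν n) w ∧
      cylMeasure (ν n) w ≤ Real.exp (5 * C + u w - w.length * logPressure u) := by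
    intro n
    have hn : (0 : ℝ) < ((n + 1 : ℕ) : ℝ) := by positivity
    rw [hνc, inv_mul_eq_div, le_div_iff₀ hn, div_le_iff₀ hn]
    constructor
    · have := Finset.card_nsmul_le_sum (Finset.range (n + 1))
        (fun k => cylMeasure (m.map shift^[k]) w) _ fun k _ => (hk k w).1
      rw [Finset.card_range, nsmul_eq_mul] at this
      linarith
    · have := Finset.sum_le_card_nsmul (Finset.range (n + 1))
        (fun k => cylMeasure (m.map shift^[k]) w) _ fun k _ => (hk k w).2
      rw [Finset.card_range, nsmul_eq_mul] at this
      linarith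
  exact ⟨ge_of_tendsto' (hlim w) fun n => (hb n).1, le_of_tendsto' (hlim w) fun n => (hb n).2⟩

lemma IsGibbs.pos {u : List (Fin N) → ℝ} {K : ℝ} {ν : Measure (Shift N)} (hG : IsGibbs u K ν)
    (w : List (Fin N)) : 0 < cylMeasure ν w := (Real.exp_pos _).trans_le (hG w).1

lemma IsGibbs.log_le {u : List (Fin N) → ℝ} {K : ℝ} {ν : Measure (Shift N)}
    (hG : IsGibbs u K ν) (w : List (Fin N)) :
    Real.log (cylMeasure ν w) ≤ K + u w - w.length * logPressure u := by
  rw [Real.log_le_iff_le_exp (hG.pos w)]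
  exact (hG w).2

lemma IsGibbs.le_log {u : List (Fin N) → ℝ} {K : ℝ} {ν : Measure (Shift N)}
    (hG : IsGibbs u K ν) (w : List (Fin N)) :
    -K + u w - w.length * logPressure u ≤ Real.log (cylMeasure ν w) := by
  rw [Real.le_log_iff_exp_le (hG.pos w)]
  exact (hG w).1

lemma IsGibbs.isEquilibriumState {u : List (Fin N) → ℝ} {C K : ℝ} (h : IsAlmostAdditive u C)
    {ν : Measure (Shift N)} (hν : ν ∈ invariantMeasures N) (hG : IsGibbs u K ν) :
    IsEquilibriumState (fun w => Real.exp (u w)) ν := by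
  have := hν.1
  refine isEquilibriumState_of_le (K := K) h hν fun n => ?_
  have i1 := integrable_comp_pref ν (fun w => Real.log (cylMeasure ν w)) n
  have i2 := integrable_comp_pref ν (fun w => K + u w - n * logPressure u) n
  have := integral_mono i1 i2 fun x => by
    have := hG.log_le (pref x n)
    rwa [length_pref] at this
  rw [integral_sub (integrable_comp_pref ν (fun w => K + u w) n) (integrable_const _),
    integral_add (integrable_const _) (integrable_comp_pref ν u n)] at this
  simp only [integral_const, probReal_univ, one_smul] at this
  rw [cylEntropy]
  linarith

lemma exists_isEquilibriumState [NeZero N] {u : List (Fin N) → ℝ} {C : ℝ}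
    (h : IsAlmostAdditive u C) :
    ∃ ν : Measure (Shift N), IsEquilibriumState (fun w => Real.exp (u w)) ν := by
  obtain ⟨ν, hν, hG⟩ := exists_isGibbs h
  exact ⟨ν, hG.isEquilibriumState h hν⟩

/-! ### Uniqueness of equilibrium states -/

/-- The pressure terms cancel because lengths add. Summed over words, this one-sided quasi-Bernoulli
bound is a weak mixing property sufficient for ergodicity. -/
lemma IsGibbs.mul_le {u : List (Fin N) → ℝ} {C K : ℝ} (h : IsAlmostAdditive u C)
    {ν : Measure (Shift N)} (hG : IsGibbs u K ν) (v w : List (Fin N)) :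
    Real.exp (-(3 * K + C)) * (cylMeasure ν v * cylMeasure ν w) ≤ cylMeasure ν (v ++ w) := by
  have h1 := mul_le_mul (hG v).2 (hG w).2 (cylMeasure_nonneg ν w) (Real.exp_pos _).le
  refine (mul_le_mul_of_nonneg_left h1 (Real.exp_pos _).le).trans (le_trans ?_ (hG (v ++ w)).1)
  rw [← Real.exp_add, ← Real.exp_add, Real.exp_le_exp, List.length_append]
  push_cast
  linarith [abs_le.1 (h v w)]

lemma IsGibbs.mul_measureReal_le {u : List (Fin N) → ℝ} {C K : ℝ} (h : IsAlmostAdditive u C)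
    {ν : Measure (Shift N)} [IsFiniteMeasure ν] (hG : IsGibbs u K ν) (S T : Set (List (Fin N)))
    (n : ℕ) :
    Real.exp (-(3 * K + C)) * (ν.real {x | pref x n ∈ S} * ν.real {x | pref x n ∈ T}) ≤
      ν.real ({x | pref x n ∈ S} ∩ shift^[n] ⁻¹' {x | pref x n ∈ T}) := by
  classical
  have e : ({x | pref x n ∈ S} ∩ shift^[n] ⁻¹' {x | pref x n ∈ T} : Set (Shift N))
      = {x | pref x (n + n) ∈ {w | w.take n ∈ S ∧ w.drop n ∈ T}} := by
    ext x
    simp only [Set.mem_inter_iff, Set.mem_preimage, Set.mem_ofPred_eq]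
    rw [pref_add, List.drop_left' (by simp), List.take_left' (by simp)]
  rw [e, measureReal_pref_mem, measureReal_pref_mem, measureReal_pref_mem, wordSum_add_length,
    ← wordSum_mul_const, ← wordSum_const_mul]
  refine wordSum_le fun v hv => ?_
  rw [← wordSum_const_mul, ← wordSum_const_mul]
  refine wordSum_le fun w _ => ?_
  simp only [Set.mem_ofPred_eq, List.drop_left' hv, List.take_left' hv]
  have := hG.mul_le h v w
  by_cases h1 : v ∈ S <;> by_cases h2 : w ∈ T <;>
    simp only [h1, h2, this, and_true, and_false, and_self, if_true, if_false, mul_one, mul_zero,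
      zero_mul, le_refl]

/-- Let a set `E` of level `n` approximate the invariant set `B`. Then `E ∩ shift^[n] ⁻¹' Eᶜ` is
almost null, while the product bound makes its measure at least `c ν(E) ν(Eᶜ)`. So `B` or its
complement is null. -/
lemma IsGibbs.ergodic {u : List (Fin N) → ℝ} {C K : ℝ} (h : IsAlmostAdditive u C)
    {ν : Measure (Shift N)} (hν : ν ∈ invariantMeasures N) (hG : IsGibbs u K ν) :
    Ergodic shift ν := by
  have := hν.1
  refine { hν.2 with aeconst_set := fun B hB hBs => ?_ }
  set c := Real.exp (-(3 * K + C)) with hc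
  have hc0 : 0 < c := Real.exp_pos _
  have hbound : ∀ ε : ℝ, 0 < ε → ε ≤ 1 → ν.real B * ν.real Bᶜ ≤ (2 / c + 3) * ε := by
    intro ε hε hε1
    obtain ⟨n, S, h1, h2⟩ := exists_symmDiff_lt ν hB hε
    set E : Set (Shift N) := {x | pref x n ∈ S} with hE
    have hEc : ({x | pref x n ∈ Sᶜ} : Set (Shift N)) = Eᶜ := by
      ext x
      simp [hE]
    have hEm : MeasurableSet E := measurableSet_pref_mem S n
    have h3 := hG.mul_measureReal_le h S Sᶜ n
    rw [hEc, ← hE, ← hc] at h3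
    have hBn : ∀ x : Shift N, shift^[n] x ∈ B ↔ x ∈ B := by
      have : ∀ k : ℕ, ∀ x : Shift N, shift^[k] x ∈ B ↔ x ∈ B := by
        intro k
        induction k with
        | zero => simp
        | succ k ih =>
          intro x
          rw [Function.iterate_succ_apply, ih]
          exact (Set.ext_iff.1 hBs x)
      exact this n
    have h4 : ν.real (E ∩ shift^[n] ⁻¹' Eᶜ) ≤ 2 * ε := by
      have hsub : E ∩ shift^[n] ⁻¹' Eᶜ ⊆ (E \ B) ∪ shift^[n] ⁻¹' (B \ E) := by
        rintro x ⟨hx1, hx2⟩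
        by_cases hxB : x ∈ B
        · exact Or.inr ⟨(hBn x).2 hxB, hx2⟩
        · exact Or.inl ⟨hx1, hxB⟩
      have h5 := (measurePreserving_iterate hν n).measureReal_preimage
        (hB.diff hEm).nullMeasurableSet
      have := (measureReal_mono (μ := ν) hsub).trans (measureReal_union_le _ _)
      rw [h5] at this
      linarith
    have h6 : ν.real B ≤ ν.real E + ε := by
      have hsub : B ⊆ E ∪ (B \ E) := fun x hx => by
        by_cases hxE : x ∈ E
        · exact Or.inl hxE
        · exact Or.inr ⟨hx, hxE⟩
      have := (measureReal_mono (μ := ν) hsub).trans (measureReal_union_le _ _)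
      linarith
    have h7 : ν.real Bᶜ ≤ ν.real Eᶜ + ε := by
      have hsub : Bᶜ ⊆ Eᶜ ∪ (E \ B) := fun x hx => by
        by_cases hxE : x ∈ E
        · exact Or.inr ⟨hxE, hx⟩
        · exact Or.inl hxE
      have := (measureReal_mono (μ := ν) hsub).trans (measureReal_union_le _ _)
      linarith
    have h8 : ν.real E * ν.real Eᶜ ≤ 2 / c * ε := by
      rw [div_mul_eq_mul_div, le_div_iff₀ hc0]
      linarith
    have n1 : ν.real E ≤ 1 := measureReal_le_one
    have n2 : ν.real Eᶜ ≤ 1 := measureReal_le_one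
    have n3 : 0 ≤ ν.real E := measureReal_nonneg
    have h9 := mul_le_mul h6 h7 measureReal_nonneg (by linarith)
    nlinarith
  have hzero : ν.real B * ν.real Bᶜ = 0 := by
    refine le_antisymm ?_ (mul_nonneg measureReal_nonneg measureReal_nonneg)
    have ht : Tendsto (fun ε : ℝ => (2 / c + 3) * ε) (𝓝[>] 0) (𝓝 0) := by
      have : Tendsto (fun ε : ℝ => (2 / c + 3) * ε) (𝓝 0) (𝓝 ((2 / c + 3) * 0)) :=
        (continuous_const.mul continuous_id).tendsto 0
      rw [mul_zero] at this
      exact this.mono_left nhdsWithin_le_nhds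
    refine ge_of_tendsto ht ?_
    filter_upwards [Ioc_mem_nhdsGT (zero_lt_one' ℝ)] with ε hε
    exact hbound ε hε.1 hε.2
  rw [eventuallyConst_set']
  rcases mul_eq_zero.1 hzero with h0 | h0
  · left
    rw [measureReal_eq_zero_iff] at h0
    exact ae_eq_empty.2 h0
  · right
    rw [measureReal_eq_zero_iff] at h0
    exact ae_eq_univ.2 h0

/-- If `ν'` gave substantial mass to a set of tiny `ν`-measure, its level `n` entropy would fall
short of the equilibrium bound by more than a constant. -/
lemma IsEquilibriumState.measureReal_mul_log_le {u : List (Fin N) → ℝ} {C K : ℝ}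
    (h : IsAlmostAdditive u C) {ν ν' : Measure (Shift N)} [IsProbabilityMeasure ν]
    (hG : IsGibbs u K ν) (hν' : IsEquilibriumState (fun w => Real.exp (u w)) ν') (n : ℕ)
    (S : Set (List (Fin N))) {δ : ℝ} (hδ : 0 < δ) (hS : ν.real {x | pref x n ∈ S} ≤ δ) :
    ν'.real {x | pref x n ∈ S} * Real.log (1 / δ) ≤ K + C + Real.log 2 := by
  classical
  have := hν'.1.1
  -- The comparison weights mix `ν` boosted on `S` with `ν` itself. The factor `1 / (2 * δ)` keeps
  -- the total mass at most `1`, and the summand `1 / 2` keeps all weights positive at a cost of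
  -- `log 2`.
  let f : List (Fin N) → ℝ := fun w => (if w ∈ S then 1 else 0) * (1 / (2 * δ)) + 1 / 2
  have hf : ∀ w, 0 < f w := fun w => by
    simp only [f]
    split_ifs <;> positivity
  have h1 := cylEntropy_le ν' n (fun w => cylMeasure ν w * f w)
    (fun w => mul_nonneg (cylMeasure_nonneg _ _) (hf w).le) (by
      simp only [f, mul_add, ← mul_assoc]
      have e1 := measureReal_pref_mem ν S n
      have e2 := wordSum_cylMeasure ν n
      simp only [wordSum, Finset.sum_add_distrib] at e1 e2 ⊢
      rw [← Finset.sum_mul, ← Finset.sum_mul, ← e1, e2]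
      have : ν.real {x | pref x n ∈ S} * (1 / (2 * δ)) ≤ δ * (1 / (2 * δ)) :=
        mul_le_mul_of_nonneg_right hS (by positivity)
      have e3 : δ * (1 / (2 * δ)) = 1 / 2 := by field_simp
      linarith) (fun w _ hw => absurd hw (mul_pos (hG.pos w) (hf w)).ne')
  have h2 := hν'.le h n
  have h3 : ∀ x : Shift N, -K + u (pref x n) - n * logPressure u
      + (((if pref x n ∈ S then 1 else 0) * Real.log (1 / δ)) - Real.log 2) ≤
      Real.log (cylMeasure ν (pref x n) * f (pref x n)) := by
    intro x
    rw [Real.log_mul (hG.pos _).ne' (hf _).ne']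
    have a := hG.le_log (pref x n)
    rw [length_pref] at a
    refine add_le_add a ?_
    simp only [f]
    split_ifs
    · rw [one_mul, one_mul, ← Real.log_div (by positivity) (by norm_num)]
      refine Real.log_le_log (by positivity) ?_
      have : 1 / δ / 2 = 1 / (2 * δ) := by field_simp
      rw [this]
      linarith
    · rw [zero_mul, zero_mul, zero_sub, zero_add, one_div, Real.log_inv]
  have i1 := integrable_comp_pref ν' (fun w => -K + u w - n * logPressure u
      + (((if w ∈ S then 1 else 0) * Real.log (1 / δ)) - Real.log 2)) n
  have i2 := integrable_comp_pref ν' (fun w => Real.log (cylMeasure ν w * f w)) n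
  have h4 := integral_mono i1 i2 h3
  have i3 := integrable_comp_pref ν' (fun w => (if w ∈ S then (1 : ℝ) else 0)) n
  have e : ∫ x, (-K + u (pref x n) - n * logPressure u
      + (((if pref x n ∈ S then 1 else 0) * Real.log (1 / δ)) - Real.log 2)) ∂ν'
      = -K + ∫ x, u (pref x n) ∂ν' - n * logPressure u
      + (ν'.real {x | pref x n ∈ S} * Real.log (1 / δ) - Real.log 2) := by
    rw [integral_add (integrable_comp_pref ν' (fun w => -K + u w - n * logPressure u) n)
        (integrable_comp_pref ν' (fun w => (if w ∈ S then 1 else 0) * Real.log (1 / δ)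
          - Real.log 2) n),
      integral_sub (integrable_comp_pref ν' (fun w => -K + u w) n) (integrable_const _),
      integral_add (integrable_const _) (integrable_comp_pref ν' u n),
      integral_sub (i3.mul_const _) (integrable_const _), measureReal_pref_mem,
      ← integral_comp_pref ν' (fun w => (if w ∈ S then (1 : ℝ) else 0))]
    simp only [integral_const, probReal_univ, one_smul]
    rw [integral_mul_const]
  rw [e] at h4
  linarith

/-- The logarithmic bound makes `ν'` absolutely continuous with respect to `ν`; an invariant
probability measure absolutely continuous with respect to an ergodic one equals it. -/
lemma IsEquilibriumState.eq_of_isGibbs {u : List (Fin N) → ℝ} {C K : ℝ}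
    (h : IsAlmostAdditive u C) {ν ν' : Measure (Shift N)} (hν : ν ∈ invariantMeasures N)
    (hG : IsGibbs u K ν) (hν' : IsEquilibriumState (fun w => Real.exp (u w)) ν') : ν' = ν := by
  have := hν.1
  have := hν'.1.1
  refine (hG.ergodic h hν).eq_of_absolutelyContinuous hν'.1.2
    (Measure.AbsolutelyContinuous.mk fun B hB hB0 => ?_)
  rw [← measureReal_eq_zero_iff]
  refine le_antisymm ?_ measureReal_nonneg
  have hle : ∀ δ : ℝ, 0 < δ → δ < 1 →
      ν'.real B ≤ (K + C + Real.log 2) / Real.log (1 / δ) + δ := by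
    intro δ hδ hδ1
    -- Approximation in `ν + ν'` serves both measures with the same set.
    obtain ⟨n, S, h1, h2⟩ := exists_symmDiff_lt (ν + ν') hB hδ
    set E : Set (Shift N) := {x | pref x n ∈ S} with hE
    have hlog : 0 < Real.log (1 / δ) := Real.log_pos (by rw [lt_div_iff₀ hδ]; linarith)
    rw [measureReal_add_apply] at h1 h2
    have p1 : 0 ≤ ν'.real (E \ B) := measureReal_nonneg
    have p2 : 0 ≤ ν.real (B \ E) := measureReal_nonneg
    have hνE : ν.real E ≤ δ := by
      have hsub : E ⊆ (E \ B) ∪ B := fun x hx => by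
        by_cases hxB : x ∈ B
        · exact Or.inr hxB
        · exact Or.inl ⟨hx, hxB⟩
      have := (measureReal_mono (μ := ν) hsub).trans (measureReal_union_le _ _)
      rw [(measureReal_eq_zero_iff (μ := ν) (s := B)).2 hB0] at this
      linarith
    have h6 : ν'.real B ≤ ν'.real E + ν'.real (B \ E) := by
      have hsub : B ⊆ E ∪ (B \ E) := fun x hx => by
        by_cases hxE : x ∈ E
        · exact Or.inl hxE
        · exact Or.inr ⟨hx, hxE⟩
      exact (measureReal_mono (μ := ν') hsub).trans (measureReal_union_le _ _)
    have h7 := hν'.measureReal_mul_log_le h hG n S hδ hνE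
    rw [← le_div_iff₀ hlog] at h7
    linarith
  have hl : Tendsto (fun δ : ℝ => Real.log (1 / δ)) (𝓝[>] 0) atTop := by
    simp only [one_div]
    exact Real.tendsto_log_atTop.comp tendsto_inv_nhdsGT_zero
  have ht : Tendsto (fun δ : ℝ => (K + C + Real.log 2) / Real.log (1 / δ) + δ) (𝓝[>] 0)
      (𝓝 0) := by
    have := (tendsto_const_nhds (x := K + C + Real.log 2)).div_atTop hl |>.add
      (tendsto_id.mono_left (nhdsWithin_le_nhds (a := (0 : ℝ)) (s := Set.Ioi 0)))
    simpa using this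
  refine ge_of_tendsto ht ?_
  filter_upwards [Ioo_mem_nhdsGT (zero_lt_one' ℝ)] with δ hδ
  exact hle δ hδ.1 hδ.2

/-- The potential of an almost additive function has exactly one equilibrium state. -/
theorem existsUnique_isEquilibriumState [NeZero N] {u : List (Fin N) → ℝ} {C : ℝ}
    (h : IsAlmostAdditive u C) :
    ∃! ν : Measure (Shift N), IsEquilibriumState (fun w => Real.exp (u w)) ν := by
  obtain ⟨ν, hν, hG⟩ := exists_isGibbs h
  exact ⟨ν, hG.isEquilibriumState h hν, fun ν' hν' => hν'.eq_of_isGibbs h hν hG⟩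

/-! ### Linearity and bounds of rates -/

section Rate

variable {u v : List (Fin N) → ℝ} {C D : ℝ} {ν : Measure (Shift N)}

lemma rate_add (hu : IsAlmostAdditive u C) (hv : IsAlmostAdditive v D)
    (hν : ν ∈ invariantMeasures N) : rate (fun w => u w + v w) ν = rate u ν + rate v ν := by
  have := hν.1
  refine tendsto_nhds_unique (rate_spec (hu.add hv) hν).1
    (((rate_spec hu hν).1.add (rate_spec hv hν).1).congr fun n => ?_)
  rw [integral_add (integrable_comp_pref ν u n) (integrable_comp_pref ν v n)]
  ring

lemma rate_const_mul (hu : IsAlmostAdditive u C) (c : ℝ)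
    (hν : ν ∈ invariantMeasures N) : rate (fun w => c * u w) ν = c * rate u ν := by
  refine tendsto_nhds_unique (rate_spec (hu.const_mul c) hν).1
    (((rate_spec hu hν).1.const_mul c).congr fun n => ?_)
  rw [integral_const_mul]
  ring

lemma le_rate (hu : IsAlmostAdditive u C) (hν : ν ∈ invariantMeasures N) {κ : ℝ}
    (h : ∀ w, κ * w.length ≤ u w) : κ ≤ rate u ν := by
  have := hν.1
  refine ge_of_tendsto (rate_spec hu hν).1 ?_
  filter_upwards [eventually_gt_atTop 0] with n hn
  rw [le_div_iff₀ (by exact_mod_cast hn)]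
  have := integral_mono (integrable_const (κ * n)) (integrable_comp_pref ν u n) fun x => by
    have := h (pref x n)
    rwa [length_pref] at this
  simpa using this

lemma exists_abs_rate_le (hu : IsAlmostAdditive u C) :
    ∃ B, 0 ≤ B ∧ ∀ ν ∈ invariantMeasures N, |rate u ν| ≤ B := by
  refine ⟨∑ w : Fin 1 → Fin N, |u (List.ofFn w)| + C,
    add_nonneg (Finset.sum_nonneg fun _ _ => abs_nonneg _) hu.nonneg, fun ν hν => ?_⟩
  have := hν.1
  have h1 := (rate_spec hu hν).2 1
  have h2 := norm_integral_le_of_norm_le_const (μ := ν)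
    (C := ∑ w : Fin 1 → Fin N, |u (List.ofFn w)|)
    (f := fun x => u (pref x 1)) (Eventually.of_forall fun x => by
      exact Finset.single_le_sum (f := fun w : Fin 1 → Fin N => |u (List.ofFn w)|)
        (fun _ _ => abs_nonneg _) (Finset.mem_univ fun k : Fin 1 => x k))
  rw [Real.norm_eq_abs, probReal_univ, mul_one] at h2
  rw [Nat.cast_one, one_mul] at h1
  have := abs_sub_abs_le_abs_sub (rate u ν) (∫ x, u (pref x 1) ∂ν)
  rw [abs_sub_comm] at this
  linarith

end Rate

/-! ### Continuity of equilibrium states -/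

/-- Equilibrium states depend continuously on the potential. -/
lemma tendsto_rate {ι : Type*} {l : Filter ι} {U : ι → List (Fin N) → ℝ}
    {U₀ v : List (Fin N) → ℝ} {C D : ℝ} (hU : ∀ᶠ i in l, IsAlmostAdditive (U i) C)
    (hU₀ : IsAlmostAdditive U₀ C) (hlim : ∀ w, Tendsto (fun i => U i w) l (𝓝 (U₀ w)))
    (hP : ∀ᶠ i in l, logPressure (U i) = 0) (hP₀ : logPressure U₀ = 0)
    {ν : ι → Measure (Shift N)} {ν₀ : Measure (Shift N)}
    (hν : ∀ᶠ i in l, IsEquilibriumState (fun w => Real.exp (U i w)) (ν i))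
    (hν₀ : IsEquilibriumState (fun w => Real.exp (U₀ w)) ν₀) (hv : IsAlmostAdditive v D) :
    Tendsto (fun i => rate v (ν i)) l (𝓝 (rate v ν₀)) := by
  have := hν₀.1.1
  have := neZero_of_isProbabilityMeasure ν₀
  -- Along an ultrafilter the equilibrium states converge weakly; it remains to identify the limit.
  rw [tendsto_iff_ultrafilter]
  intro F hF
  have hνF := hν.filter_mono hF
  obtain ⟨m, hm, hmlim⟩ := exists_tendsto_cylMeasure F ν (hνF.mono fun i hi => hi.1.1)
  have hminv : m ∈ invariantMeasures N := by
    refine (mem_invariantMeasures_iff m).2 fun w => ?_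
    refine tendsto_nhds_unique ((tendsto_wordSum fun v => hmlim (v ++ w)).congr' ?_) (hmlim w)
    filter_upwards [hνF] with i hi
    have := hi.1.1
    exact (mem_invariantMeasures_iff (ν i)).1 hi.1 w
  -- The level `n` inequalities have the error `C` for every `i`, so they pass to the limit;
  -- uniqueness then gives `m = ν₀`.
  have hmeq : IsEquilibriumState (fun w => Real.exp (U₀ w)) m := by
    refine isEquilibriumState_of_le (K := C) hU₀ hminv fun n => ?_
    rw [hP₀, mul_zero, zero_sub, cylEntropy_eq, integral_comp_pref]
    have t1 : Tendsto (fun i => (wordSum n fun w => Real.negMulLog (cylMeasure (ν i) w))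
        + wordSum n fun w => cylMeasure (ν i) w * U i w) F
        (𝓝 ((wordSum n fun w => Real.negMulLog (cylMeasure m w))
          + wordSum n fun w => cylMeasure m w * U₀ w)) :=
      (tendsto_wordSum fun w => (Real.continuous_negMulLog.tendsto _).comp (hmlim w)).add
        (tendsto_wordSum fun w => (hmlim w).mul ((hlim w).mono_left hF))
    refine ge_of_tendsto t1 ?_
    filter_upwards [hνF, hU.filter_mono hF, hP.filter_mono hF] with i h1 h2 h3
    have := h1.1.1
    have := h1.le h2 n
    rwa [h3, mul_zero, zero_sub, cylEntropy_eq, integral_comp_pref] at this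
  have hmν : m = ν₀ := (existsUnique_isEquilibriumState hU₀).unique hmeq hν₀
  subst hmν
  rw [Metric.tendsto_nhds]
  intro ε hε
  -- Replacing a rate by its level `n` average costs `D / n` for each of the two measures; this `n`
  -- leaves a positive tolerance for the level `n` integrals.
  obtain ⟨n, hn⟩ := exists_nat_gt (3 * D / ε)
  have hD := hv.nonneg
  have hn0 : (0 : ℝ) < n := (div_nonneg (by positivity) hε.le).trans_lt hn
  have t2 : Tendsto (fun i => wordSum n fun w => cylMeasure (ν i) w * v w) F
      (𝓝 (wordSum n fun w => cylMeasure m w * v w)) :=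
    tendsto_wordSum fun w => (hmlim w).mul_const _
  have hpos : 0 < n * ε - 2 * D := by
    rw [div_lt_iff₀ hε] at hn
    nlinarith
  filter_upwards [hνF, Metric.tendsto_nhds.1 t2 _ hpos] with i h1 h2
  have := h1.1.1
  rw [Real.dist_eq, ← integral_comp_pref, ← integral_comp_pref, abs_lt] at h2
  have h3 := abs_le.1 ((rate_spec hv h1.1).2 n)
  have h4 := abs_le.1 ((rate_spec hv hminv).2 n)
  rw [Real.dist_eq, abs_lt]
  constructor
  · refine lt_of_mul_lt_mul_left ?_ hn0.le
    linarith
  · refine lt_of_mul_lt_mul_left ?_ hn0.le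
    linarith

/-! ### Differentiability of zeros of the pressure -/

/-- Using the supergradient inequality at `q` and at `x` squeezes the error of the linear
approximation between `(x - q) * (f x - f q)` and `0`. -/
lemma hasDerivAt_of_sub_le {t f : ℝ → ℝ} {O : Set ℝ} (hO : IsOpen O)
    (h : ∀ q ∈ O, ∀ q' ∈ O, t q - t q' ≤ (q - q') * f q') {q : ℝ} (hq : q ∈ O)
    (hf : ContinuousAt f q) : HasDerivAt t (f q) q := by
  rw [hasDerivAt_iff_isLittleO, Asymptotics.isLittleO_iff]
  intro c hc
  filter_upwards [hO.mem_nhds hq, Metric.tendsto_nhds.1 hf c hc] with x hx hfx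
  rw [Real.dist_eq] at hfx
  have h1 := h x hx q hq
  have h2 := h q hq x hx
  rw [smul_eq_mul, Real.norm_eq_abs, Real.norm_eq_abs, abs_le]
  have h3 : |(x - q) * (f x - f q)| ≤ c * |x - q| := by
    rw [abs_mul, mul_comm c]
    exact mul_le_mul_of_nonneg_left hfx.le (abs_nonneg _)
  have h4 := abs_le.1 h3
  constructor
  · linarith
  · have : 0 ≤ c * |x - q| := by positivity
    linarith

lemma contDiffOn_one_of_hasDerivAt {t f : ℝ → ℝ} {O : Set ℝ} (hO : IsOpen O)
    (h : ∀ q ∈ O, HasDerivAt t (f q) q) (hf : ContinuousOn f O) : ContDiffOn ℝ 1 t O := by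
  have : (1 : WithTop ℕ∞) = 0 + 1 := by simp
  rw [this, contDiffOn_succ_iff_deriv_of_isOpen hO]
  refine ⟨fun q hq => (h q hq).differentiableAt.differentiableWithinAt, by simp, ?_⟩
  rw [contDiffOn_zero]
  exact hf.congr fun q hq => (h q hq).deriv

section Zero

variable {w₀ u v : List (Fin N) → ℝ} {C₀ C₁ C₂ κ : ℝ} {t : ℝ → ℝ} {O : Set ℝ}

lemma IsAlmostAdditive.affine (h₀ : IsAlmostAdditive w₀ C₀) (hu : IsAlmostAdditive u C₁)
    (hv : IsAlmostAdditive v C₂) (a b : ℝ) :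
    IsAlmostAdditive (fun w => w₀ w + (a * u w + b * v w)) (C₀ + (|a| * C₁ + |b| * C₂)) :=
  h₀.add ((hu.const_mul a).add (hv.const_mul b))

lemma rate_affine (h₀ : IsAlmostAdditive w₀ C₀) (hu : IsAlmostAdditive u C₁)
    (hv : IsAlmostAdditive v C₂) (a b : ℝ) {ν : Measure (Shift N)}
    (hν : ν ∈ invariantMeasures N) :
    rate (fun w => w₀ w + (a * u w + b * v w)) ν
      = rate w₀ ν + (a * rate u ν + b * rate v ν) := by
  rw [rate_add h₀ ((hu.const_mul a).add (hv.const_mul b)) hν,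
    rate_add (hu.const_mul a) (hv.const_mul b) hν, rate_const_mul hu a hν,
    rate_const_mul hv b hν]

/-- The implicitly defined zero of the pressure along a two-parameter affine family of potentials
is continuously differentiable. -/
theorem hasDerivAt_zero_of_logPressure [NeZero N] (h₀ : IsAlmostAdditive w₀ C₀)
    (hu : IsAlmostAdditive u C₁) (hv : IsAlmostAdditive v C₂) (hκ : 0 < κ)
    (hvκ : ∀ w, κ * w.length ≤ v w) (hO : IsOpen O)
    (ht : ∀ q ∈ O, logPressure (fun w => w₀ w + (q * u w + t q * v w)) = 0) :
    ContDiffOn ℝ 1 t O ∧ ∀ q ∈ O, ∀ ν,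
      IsEquilibriumState (fun w => Real.exp (w₀ w + (q * u w + t q * v w))) ν →
      HasDerivAt t (-(rate u ν / rate v ν)) q := by
  have hex : ∀ q, ∃ ν : Measure (Shift N),
      IsEquilibriumState (fun w => Real.exp (w₀ w + (q * u w + t q * v w))) ν := fun q =>
    exists_isEquilibriumState (h₀.affine hu hv q (t q))
  choose ν hν using hex
  have hvpos : ∀ q, κ ≤ rate v (ν q) := fun q => le_rate hv (hν q).1 hvκ
  let f : ℝ → ℝ := fun q => -(rate u (ν q) / rate v (ν q))
  -- The variational inequality at `q` is tested on the equilibrium state of `q'`, for which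
  -- equality holds at `q'`. Subtracting eliminates the entropy and `w₀`.
  have hsub : ∀ q ∈ O, ∀ q' ∈ O, t q - t q' ≤ (q - q') * f q' := by
    intro q hq q' hq'
    have h1 := entropy_add_rate_le (h₀.affine hu hv q (t q)) (hν q').1
    have h2 := (isEquilibriumState_iff (hν q').1).1 (hν q')
    rw [ht q hq] at h1
    rw [ht q' hq'] at h2
    rw [rate_affine h₀ hu hv _ _ (hν q').1] at h1 h2
    have hpos : 0 < rate v (ν q') := hκ.trans_le (hvpos q')
    have : (q - q') * f q' = -((q - q') * rate u (ν q')) / rate v (ν q') := by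
      simp only [f]
      ring
    rw [this, le_div_iff₀ hpos]
    linarith
  obtain ⟨B, hB0, hB⟩ := exists_abs_rate_le hu
  have hfB : ∀ q, |f q| ≤ B / κ := by
    intro q
    have hpos : 0 < rate v (ν q) := hκ.trans_le (hvpos q)
    simp only [f]
    rw [abs_neg, abs_div, abs_of_pos hpos]
    exact div_le_div₀ hB0 (hB _ (hν q).1) hκ (hvpos q)
  -- Bounded supergradients force a Lipschitz bound. Continuity of `t` must precede that of `f`,
  -- because the potentials themselves depend on `t`.
  have htc : ∀ q ∈ O, ContinuousAt t q := by
    intro q hq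
    rw [ContinuousAt, tendsto_iff_dist_tendsto_zero]
    have hz : Tendsto (fun x => B / κ * |x - q|) (𝓝 q) (𝓝 0) := by
      have : Continuous fun x => B / κ * |x - q| := by fun_prop
      simpa using this.tendsto q
    refine squeeze_zero' (Eventually.of_forall fun _ => dist_nonneg) ?_ hz
    filter_upwards [hO.mem_nhds hq] with x hx
    rw [Real.dist_eq, abs_le]
    have h1 := hsub x hx q hq
    have h2 := hsub q hq x hx
    have key : ∀ y, (x - q) * f y ≤ B / κ * |x - q| ∧ -(B / κ * |x - q|) ≤ (x - q) * f y := by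
      intro y
      have : |(x - q) * f y| ≤ B / κ * |x - q| := by
        rw [abs_mul, mul_comm]
        exact mul_le_mul_of_nonneg_right (hfB y) (abs_nonneg _)
      exact ⟨(abs_le.1 this).2, (abs_le.1 this).1⟩
    constructor
    · linarith [(key x).2]
    · linarith [(key q).1]
  have hcont : ∀ q ∈ O, ∀ {y : List (Fin N) → ℝ} {D : ℝ}, IsAlmostAdditive y D →
      Tendsto (fun x => rate y (ν x)) (𝓝 q) (𝓝 (rate y (ν q))) := by
    intro q hq y D hy
    -- One almost-additivity constant for all parameters near `q`, as `tendsto_rate` requires.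
    set M := C₀ + ((|q| + 1) * C₁ + (|t q| + 1) * C₂) with hM
    have hb : ∀ a b : ℝ, |a| ≤ |q| + 1 → |b| ≤ |t q| + 1 →
        IsAlmostAdditive (fun w => w₀ w + (a * u w + b * v w)) M := by
      intro a b ha hb
      refine (h₀.affine hu hv a b).mono ?_
      have := mul_le_mul_of_nonneg_right ha hu.nonneg
      have := mul_le_mul_of_nonneg_right hb hv.nonneg
      linarith
    refine tendsto_rate (C := M) (U := fun x w => w₀ w + (x * u w + t x * v w))
      (U₀ := fun w => w₀ w + (q * u w + t q * v w)) ?_ (hb _ _ (by linarith) (by linarith)) ?_ ?_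
      (ht q hq) (Eventually.of_forall hν) (hν q) hy
    · have e1 : ∀ᶠ x in 𝓝 q, |x| < |q| + 1 :=
        continuous_abs.continuousAt.eventually_lt continuousAt_const (by linarith)
      have e2 : ∀ᶠ x in 𝓝 q, |t x| < |t q| + 1 :=
        (htc q hq).abs.eventually_lt continuousAt_const (by linarith)
      filter_upwards [e1, e2] with x h1 h2
      exact hb _ _ h1.le h2.le
    · intro w
      exact tendsto_const_nhds.add ((tendsto_id.mul_const _).add ((htc q hq).mul_const _))
    · filter_upwards [hO.mem_nhds hq] with x hx
      exact ht x hx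
  have hfc : ∀ q ∈ O, ContinuousAt f q := fun q hq =>
    ((hcont q hq hu).div (hcont q hq hv) (hκ.trans_le (hvpos q)).ne').neg
  have hd : ∀ q ∈ O, HasDerivAt t (f q) q := fun q hq => hasDerivAt_of_sub_le hO hsub hq (hfc q hq)
  refine ⟨contDiffOn_one_of_hasDerivAt hO hd fun q hq => (hfc q hq).continuousWithinAt,
    fun q hq ν' hν' => ?_⟩
  rw [(existsUnique_isEquilibriumState (h₀.affine hu hv q (t q))).unique hν' (hν q)]
  exact hd q hq

end Zero

/-! ### Quasi-geodesics stay close to geodesics -/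

/-- A sequence with bounded steps has bounded excursions above a level if every maximal excursion
has bounded length. -/
lemma le_of_excursion_length_le {H : ℕ → ℝ} {n : ℕ} {T K L : ℝ} (hK0 : 0 ≤ K) (hL0 : 0 ≤ L)
    (h0 : H 0 ≤ T) (hn : H n ≤ T) (hK : ∀ i < n, |H i - H (i + 1)| ≤ K)
    (hL : ∀ l b, l ≤ b → b ≤ n → H l ≤ T → H b ≤ T + K → (∀ j, l < j → j ≤ b → T < H j) →
      (b : ℝ) - l ≤ L) (i : ℕ) (hi : i ≤ n) : H i ≤ T + K * L := by
  have hstep : ∀ l m, l + m ≤ n → H (l + m) ≤ H l + K * m := by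
    intro l m
    induction m with
    | zero => simp
    | succ m ih =>
      intro hm
      have h1 := ih (by omega)
      have h2 := abs_le.1 (hK (l + m) (by omega))
      rw [← add_assoc]
      push_cast
      linarith
  rcases le_or_gt (H i) T with hiT | hiT
  · nlinarith
  classical
  set l := Nat.findGreatest (fun l => H l ≤ T) i with hl
  have hlT : H l ≤ T := Nat.findGreatest_spec (P := fun l => H l ≤ T) (Nat.zero_le i) h0
  have hli : l ≤ i := Nat.findGreatest_le i
  have hlgt : ∀ j, l < j → j ≤ i → T < H j := fun j h1 h2 =>
    not_le.1 (Nat.findGreatest_is_greatest h1 h2)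
  have hex : ∃ r, i ≤ r ∧ H r ≤ T := ⟨n, hi, hn⟩
  obtain ⟨hir, hrT⟩ := Nat.find_spec hex
  have hrn : Nat.find hex ≤ n := Nat.find_min' hex ⟨hi, hn⟩
  have hrlt : ∀ j, i ≤ j → j < Nat.find hex → T < H j := fun j h1 h2 => by
    have := Nat.find_min hex h2
    push Not at this
    exact this h1
  set r := Nat.find hex
  have hir' : i < r := lt_of_le_of_ne hir fun h => by
    rw [← h] at hrT
    exact absurd hrT (not_le.2 hiT)
  -- The excursion ends at `r - 1`, one step before the return, so its last value exceeds `T` by at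
  -- most `K`.
  have hb := abs_le.1 (hK (r - 1) (by omega))
  have hr1 : r - 1 + 1 = r := by omega
  rw [hr1] at hb
  have h1 := hL l (r - 1) (by omega) (by omega) hlT (by linarith) fun j hj1 hj2 => by
    rcases le_total j i with h | h
    · exact hlgt j hj1 h
    · exact hrlt j h (by omega)
  have h2 := hstep l (i - l) (by omega)
  rw [Nat.add_sub_cancel' hli] at h2
  have h3 : ((i - l : ℕ) : ℝ) ≤ L := by
    refine le_trans ?_ h1
    rw [Nat.cast_sub hli]
    have : (i : ℝ) ≤ ((r - 1 : ℕ) : ℝ) := by exact_mod_cast (by omega : i ≤ r - 1)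
    linarith
  have := mul_le_mul_of_nonneg_left h3 hK0
  linarith

/-- A sequence with small steps that is positive at the end and can vanish only early is positive
on every long interval starting or ending at an endpoint. -/
lemma sub_pos_of_large_gaps {E : ℕ → ℝ} {n m : ℕ} {K : ℝ} (hE : 0 < E 0 - E n)
    (hK : ∀ i < n, |E i - E (i + 1)| ≤ K)
    (hgap : ∀ i j, i ≤ j → j ≤ n → m ≤ j - i → K < |E i - E j|) (k : ℕ) (hk : k ≤ n) :
    (m ≤ k → 0 < E 0 - E k) ∧ (m ≤ n - k → 0 < E k - E n) := by
  constructor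
  · have key : ∀ r, r ≤ n → m ≤ n - r → 0 < E 0 - E (n - r) := by
      intro r
      induction r with
      | zero => simpa using fun _ => hE
      | succ r ih =>
        intro h1 h2
        have h3 := ih (by omega) (by omega)
        have h4 := abs_le.1 (hK (n - (r + 1)) (by omega))
        have h5 : n - (r + 1) + 1 = n - r := by omega
        rw [h5] at h4
        have h6 := hgap 0 (n - (r + 1)) (by omega) (by omega) (by omega)
        rcases lt_abs.1 h6 with h | h <;> linarith [h4.1, (abs_nonneg _).trans (hK 0 (by omega))]
    intro hm
    have := key (n - k) (by omega) (by omega)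
    rwa [Nat.sub_sub_self hk] at this
  · have key : ∀ r, r ≤ n → m ≤ n - r → 0 < E r - E n := by
      intro r
      induction r with
      | zero => exact fun _ _ => hE
      | succ r ih =>
        intro h1 h2
        have h3 := ih (by omega) (by omega)
        have h4 := abs_le.1 (hK r (by omega))
        have h6 := hgap (r + 1) n (by omega) (by omega) (by omega)
        rcases lt_abs.1 h6 with h | h <;> linarith [h4.2, (abs_nonneg _).trans (hK 0 (by omega))]
    exact key k hk

/-- Norm growth along an orbit: `F` and `G` are the logarithms of the norms of the images of two
vectors under the products of matrices, `D` is the logarithm of the area that they span, and `a`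
is the logarithm of the norms of the products. If the products expand area-normalized vectors at a
definite rate, then the norm along the orbit of the most expanded vector is comparable to the norm
of the products. -/
lemma exists_growth_defect {K K₁ l c : ℝ} (hK : 0 ≤ K) (hK₁ : 0 ≤ K₁) (hl : 0 < l)
    (hc : 0 ≤ c) :
    ∃ M : ℝ, ∀ (n : ℕ) (F G D : ℕ → ℝ) (a : ℕ → ℕ → ℝ),
      (∀ i ≤ n, 0 ≤ F i + G i - D i) → F 0 + G 0 - D 0 = 0 → F n + G n - D n = 0 →
      F 0 - F n = a 0 n →
      (∀ i j, i ≤ j → j ≤ n →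
        a i j ≤ F j + G j - D j + Real.log 2 + max (F i - F j) (G i - G j)) →
      (∀ i < n, |F i - F (i + 1)| ≤ K) → (∀ i < n, |G i - G (i + 1)| ≤ K) →
      (∀ i < n, |D i - D (i + 1)| ≤ 2 * K) →
      (∀ i < n, |F i - G i - (F (i + 1) - G (i + 1))|
        ≤ K₁ * Real.exp (-(F (i + 1) + G (i + 1) - D (i + 1)))) →
      (∀ i j, i ≤ j → j ≤ n → a i j ≤ K * ((j : ℝ) - i)) →
      (∀ i j, i ≤ j → j ≤ n → l * ((j : ℝ) - i) - c ≤ 2 * a i j - (D i - D j)) →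
      ∀ k ≤ n, a 0 k - M ≤ F 0 - F k ∧ a k n - M ≤ F k - F n := by
  have hlog2 : 0 < Real.log 2 := Real.log_pos (by norm_num)
  -- Above the level `T` the two vectors are so nearly parallel that `F - G` drifts at less than the
  -- domination rate: by at most `l / 2` per step.
  obtain ⟨T, hT0, hT⟩ : ∃ T : ℝ, 0 ≤ T ∧ K₁ * Real.exp (-T) ≤ l / 2 := by
    have : Tendsto (fun T : ℝ => K₁ * Real.exp (-T)) atTop (𝓝 (K₁ * 0)) :=
      (Real.tendsto_exp_neg_atTop_nhds_zero).const_mul _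
    rw [mul_zero] at this
    obtain ⟨T, h1, h2⟩ := ((eventually_ge_atTop 0).and
      (this.eventually_le_const (by positivity : (0 : ℝ) < l / 2))).exists
    exact ⟨T, h1, h2⟩
  -- The bound on the length of an excursion, obtained by playing the drift `l / 2` against the rate
  -- `l`.
  set L := 2 / l * (3 * T + 8 * K + 2 * Real.log 2 + c) with hL
  have hL0 : 0 ≤ L := by positivity
  set H₀ := T + 4 * K * L with hH₀
  have hH₀0 : 0 ≤ H₀ := by positivity
  -- From length `m` on, the gap of `F - G` exceeds its largest step `2 * K`, even after the loss `c
  -- + 3 * H₀ + 2 * Real.log 2`.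
  obtain ⟨m, hm⟩ := exists_nat_gt ((c + 3 * H₀ + 2 * Real.log 2 + 2 * K) / l)
  rw [div_lt_iff₀ hl] at hm
  refine ⟨2 * H₀ + Real.log 2 + 2 * K * m, ?_⟩
  intro n F G D a hH hH0 hHn hFn ha hF hG hD hFG haK hal
  have hHstep : ∀ i < n, |F i + G i - D i - (F (i + 1) + G (i + 1) - D (i + 1))| ≤ 4 * K := by
    intro i hi
    have h1 := abs_le.1 (hF i hi)
    have h2 := abs_le.1 (hG i hi)
    have h3 := abs_le.1 (hD i hi)
    rw [abs_le]
    constructor <;> linarith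
  -- `F + G - D` is minus the logarithm of the sine of the angle between the two images; its upper
  -- bound keeps the angle away from zero.
  have hbound : ∀ i ≤ n, F i + G i - D i ≤ H₀ := by
    refine fun i hi => le_of_excursion_length_le (H := fun i => F i + G i - D i)
      (by positivity) hL0 (by linarith) (by linarith) hHstep ?_ i hi
    intro p b hpb hbn hpT hbT hgt
    have hdrift : ∀ r, r ≤ b - p → |F (b - r) - G (b - r) - (F b - G b)| ≤ l / 2 * r := by
      intro r
      induction r with
      | zero => simp
      | succ r ih =>
        intro hr
        have h1 := abs_le.1 (ih (by omega))
        have h2 := hFG (b - (r + 1)) (by omega)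
        have h3 : b - (r + 1) + 1 = b - r := by omega
        rw [h3] at h2
        have h4 : K₁ * Real.exp (-(F (b - r) + G (b - r) - D (b - r))) ≤ l / 2 := by
          refine le_trans (mul_le_mul_of_nonneg_left (Real.exp_le_exp.2 ?_) hK₁) hT
          linarith [hgt (b - r) (by omega) (by omega)]
        have h5 := abs_le.1 (h2.trans h4)
        push_cast
        rw [abs_le]
        constructor <;> linarith
    have h1 := hdrift (b - p) le_rfl
    rw [Nat.sub_sub_self hpb, Nat.cast_sub hpb] at h1
    have h1' := abs_le.1 h1
    have h2 := ha p b hpb hbn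
    have h3 := hal p b hpb hbn
    have h4 := hH b hbn
    have h6 : max (F p - F b) (G p - G b) ≤ (T + (D p - D b)) / 2 + l / 4 * ((b : ℝ) - p) := by
      refine max_le ?_ ?_ <;> linarith
    have h7 : l / 2 * ((b : ℝ) - p) ≤ 3 * T + 8 * K + 2 * Real.log 2 + c := by linarith
    rw [hL, div_mul_eq_mul_div, le_div_iff₀ hl]
    linarith
  -- With the angle under control, the norm of the product is carried by one of the two vectors, and
  -- domination separates their growth.
  have hmax : ∀ i j, i ≤ j → j ≤ n →
      2 * a i j - (D i - D j) - (3 * H₀ + 2 * Real.log 2)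
        ≤ |F i - G i - (F j - G j)| := by
    intro i j hij hjn
    have h1 := ha i j hij hjn
    have h2 := hbound i (hij.trans hjn)
    have h3 := hbound j hjn
    have h4 := hH j hjn
    rcases max_cases (F i - F j) (G i - G j) with h | h
    · have := le_abs_self (F i - G i - (F j - G j))
      linarith
    · have := neg_abs_le (F i - G i - (F j - G j))
      linarith
  have hstepsum : ∀ j, j ≤ n → ∀ r, r ≤ j → |F (j - r) - F j| ≤ K * r := by
    intro j hj r
    induction r with
    | zero => simp
    | succ r ih =>
      intro hr
      have h1 := abs_le.1 (ih (by omega))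
      have h2 := abs_le.1 (hF (j - (r + 1)) (by omega))
      have h3 : j - (r + 1) + 1 = j - r := by omega
      rw [h3] at h2
      push_cast
      rw [abs_le]
      constructor <;> linarith
  have hshort : ∀ i j, i ≤ j → j ≤ n → j - i < m → a i j - 2 * K * m ≤ F i - F j := by
    intro i j hij hj hlt
    have h1 := abs_le.1 (hstepsum j hj (j - i) (by omega))
    rw [Nat.sub_sub_self hij] at h1
    have h2 := haK i j hij hj
    have h3 : ((j - i : ℕ) : ℝ) ≤ m := by exact_mod_cast hlt.le
    have h4 := mul_le_mul_of_nonneg_left h3 hK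
    rw [Nat.cast_sub hij] at h1 h4
    linarith
  have hlong : ∀ i j, i ≤ j → j ≤ n → 0 < F i - G i - (F j - G j) →
      a i j - (2 * H₀ + Real.log 2) ≤ F i - F j := by
    intro i j hij hj hpos
    have h1 := hmax i j hij hj
    rw [abs_of_pos hpos] at h1
    have h2 := hbound j hj
    have h3 := hH i (hij.trans hj)
    linarith
  intro k hk
  have hKm : 0 ≤ 2 * K * m := by positivity
  rcases lt_or_ge n m with hnm | hnm
  · have h1 := hshort 0 k (by omega) hk (by omega)
    have h2 := hshort k n hk le_rfl (by omega)
    constructor <;> linarith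
  · have hmn : (m : ℝ) ≤ n := by exact_mod_cast hnm
    -- The sign of `F - G` decides which vector carries the growth. Over the whole word it is the
    -- first one, and large gaps transmit this to all long initial and final pieces.
    have hpos := sub_pos_of_large_gaps (E := fun i => F i - G i) (n := n) (m := m) (K := 2 * K)
      (by
        have h1 := hal 0 n (Nat.zero_le n) le_rfl
        rw [Nat.cast_zero, sub_zero] at h1
        have h2 := mul_le_mul_of_nonneg_left hmn hl.le
        linarith) (fun i hi => by
        have h1 := abs_le.1 (hF i hi)
        have h2 := abs_le.1 (hG i hi)
        rw [abs_le]
        constructor <;> linarith) (fun i j hij hj hgap => by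
        have h1 := hmax i j hij hj
        have h2 := hal i j hij hj
        have h3 : (m : ℝ) ≤ (j : ℝ) - i := by
          rw [← Nat.cast_sub hij]
          exact_mod_cast hgap
        have h4 := mul_le_mul_of_nonneg_left h3 hl.le
        linarith) k hk
    constructor
    · rcases lt_or_ge k m with h | h
      · linarith [hshort 0 k (by omega) hk (by omega)]
      · linarith [hlong 0 k (by omega) hk (hpos.1 h)]
    · rcases lt_or_ge (n - k) m with h | h
      · linarith [hshort k n hk le_rfl (by omega)]
      · linarith [hlong k n hk le_rfl (hpos.2 h)]

/-! ### Singular values of `2 × 2` matrices -/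

/-- The Euclidean plane. -/
abbrev Plane : Type := EuclideanSpace ℝ (Fin 2)

/-- The signed area spanned by two vectors of the plane. -/
def wedge (x y : Plane) : ℝ := x 0 * y 1 - x 1 * y 0

/-- The continuous linear map given by a matrix. -/
abbrev act (M : Matrix (Fin 2) (Fin 2) ℝ) : Plane →L[ℝ] Plane :=
  Matrix.toEuclideanCLM (n := Fin 2) (𝕜 := ℝ) M

lemma plane_norm_sq (x : Plane) : ‖x‖ ^ 2 = x 0 ^ 2 + x 1 ^ 2 := by
  rw [EuclideanSpace.real_norm_sq_eq, Fin.sum_univ_two]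

lemma act_apply (M : Matrix (Fin 2) (Fin 2) ℝ) (x : Plane) (i : Fin 2) :
    act M x i = M i 0 * x 0 + M i 1 * x 1 := by
  have : act M x i = (M.mulVec x.ofLp) i := rfl
  rw [this, Matrix.mulVec, dotProduct, Fin.sum_univ_two]

lemma act_mul (M M' : Matrix (Fin 2) (Fin 2) ℝ) (x : Plane) :
    act (M * M') x = act M (act M' x) := by
  simp only [act, map_mul]
  rfl

lemma act_one (x : Plane) : act 1 x = x := by
  simp only [act, map_one]
  rfl

lemma norm_act_le (M : Matrix (Fin 2) (Fin 2) ℝ) (x : Plane) : ‖act M x‖ ≤ opNorm M * ‖x‖ :=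
  (act M).le_opNorm x

lemma opNorm_mul_le (M M' : Matrix (Fin 2) (Fin 2) ℝ) : opNorm (M * M') ≤ opNorm M * opNorm M' := by
  simp only [opNorm, map_mul]
  exact norm_mul_le _ _

lemma wedge_act (M : Matrix (Fin 2) (Fin 2) ℝ) (x y : Plane) :
    wedge (act M x) (act M y) = M.det * wedge x y := by
  simp only [wedge, act_apply, Matrix.det_fin_two]
  ring

lemma abs_wedge_le (x y : Plane) : |wedge x y| ≤ ‖x‖ * ‖y‖ := by
  refine abs_le_of_sq_le_sq ?_ (by positivity)
  rw [mul_pow, plane_norm_sq, plane_norm_sq, wedge]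
  nlinarith [sq_nonneg (x 0 * y 0 + x 1 * y 1)]

/-- Cramer's rule expands an arbitrary `z` in the basis `x`, `y` with coefficients `wedge z y` and
`wedge x z`, up to the factor `wedge x y`. -/
lemma opNorm_mul_abs_wedge_le (M : Matrix (Fin 2) (Fin 2) ℝ) (x y : Plane) :
    opNorm M * |wedge x y| ≤ ‖act M x‖ * ‖y‖ + ‖act M y‖ * ‖x‖ := by
  rcases (abs_nonneg (wedge x y)).eq_or_lt with h | h
  · rw [← h, mul_zero]
    positivity
  · rw [← le_div_iff₀ h]
    refine ContinuousLinearMap.opNorm_le_bound _ (by positivity) fun z => ?_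
    rw [div_mul_eq_mul_div, le_div_iff₀ h]
    have e : wedge x y • act M z = wedge z y • act M x + wedge x z • act M y := by
      ext i
      simp only [PiLp.smul_apply, PiLp.add_apply, smul_eq_mul, act_apply, wedge]
      ring
    have h1 := congrArg norm e
    rw [norm_smul, Real.norm_eq_abs] at h1
    have h2 := norm_add_le (wedge z y • act M x) (wedge x z • act M y)
    rw [norm_smul, norm_smul, Real.norm_eq_abs, Real.norm_eq_abs] at h2
    have h3 := mul_le_mul_of_nonneg_right (abs_wedge_le z y) (norm_nonneg (act M x))
    have h4 := mul_le_mul_of_nonneg_right (abs_wedge_le x z) (norm_nonneg (act M y))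
    change ‖act M z‖ * |wedge x y| ≤ _
    linarith

/-- Right singular vectors. -/
lemma exists_singular_vectors (M : Matrix (Fin 2) (Fin 2) ℝ) :
    ∃ v s : Plane, ‖v‖ = 1 ∧ ‖s‖ = 1 ∧ wedge v s = 1 ∧ ‖act M v‖ = opNorm M ∧
      ‖act M v‖ * ‖act M s‖ = |M.det| := by
  have hne : (Metric.sphere (0 : Plane) 1).Nonempty := NormedSpace.sphere_nonempty.2 zero_le_one
  obtain ⟨v, hv, hmax⟩ := (isCompact_sphere (0 : Plane) 1).exists_isMaxOn hne
    ((act M).continuous.norm.continuousOn)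
  have hv1 : ‖v‖ = 1 := by simpa using hv
  have hnorm : ‖act M v‖ = opNorm M := by
    refine le_antisymm ?_ ?_
    · simpa [hv1] using norm_act_le M v
    · refine ContinuousLinearMap.opNorm_le_of_unit_norm (norm_nonneg _) fun x hx => ?_
      exact hmax (by simpa using hx)
  have hvsq := plane_norm_sq v
  rw [hv1, one_pow] at hvsq
  let s : Plane := !₂[-v 1, v 0]
  have s0 : s 0 = -v 1 := rfl
  have s1 : s 1 = v 0 := rfl
  have hs1 : ‖s‖ = 1 := by
    have := plane_norm_sq s
    rw [s0, s1, neg_sq, add_comm, ← hvsq] at this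
    nlinarith [norm_nonneg s]
  have hw : wedge v s = 1 := by
    rw [wedge, s0, s1, hvsq]
    ring
  set p := act M v 0 * act M s 0 + act M v 1 * act M s 1 with hp
  -- Maximality of `v` tested on the perturbation `v + t • s`: the first-order term is twice the
  -- inner product `p` of the images, so `p` must vanish.
  have hvar : ∀ t : ℝ, 2 * t * p ≤ t ^ 2 * opNorm M ^ 2 := by
    intro t
    have h1 := norm_act_le M (v + t • s)
    have h2 := pow_le_pow_left₀ (norm_nonneg _) h1 2
    have h3 : ‖v + t • s‖ ^ 2 = 1 + t ^ 2 := by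
      rw [plane_norm_sq]
      simp only [PiLp.add_apply, PiLp.smul_apply, smul_eq_mul, s0, s1]
      linear_combination (-(1 + t ^ 2)) * hvsq
    have h4 : ‖act M (v + t • s)‖ ^ 2 = ‖act M v‖ ^ 2 + 2 * t * p + t ^ 2 * ‖act M s‖ ^ 2 := by
      rw [map_add, map_smul, plane_norm_sq, plane_norm_sq, plane_norm_sq]
      simp only [PiLp.add_apply, PiLp.smul_apply, smul_eq_mul, hp]
      ring
    rw [mul_pow, h3, h4, hnorm] at h2
    have : 0 ≤ t ^ 2 * ‖act M s‖ ^ 2 := by positivity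
    linarith
  have hp0 : p = 0 := by
    set R := opNorm M ^ 2 with hR
    have hR0 : 0 ≤ R := sq_nonneg _
    have h1 := hvar (p / (R + 1))
    have h2 : 2 * (p / (R + 1)) * p * (R + 1) ^ 2 ≤ (p / (R + 1)) ^ 2 * R * (R + 1) ^ 2 :=
      mul_le_mul_of_nonneg_right h1 (by positivity)
    have h3 : 2 * (p / (R + 1)) * p * (R + 1) ^ 2 = 2 * p ^ 2 * (R + 1) := by field_simp
    have h4 : (p / (R + 1)) ^ 2 * R * (R + 1) ^ 2 = p ^ 2 * R := by field_simp
    rw [h3, h4] at h2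
    have h5 : p ^ 2 = 0 := by nlinarith [mul_nonneg (sq_nonneg p) hR0, sq_nonneg p]
    exact pow_eq_zero_iff (two_ne_zero) |>.1 h5
  refine ⟨v, s, hv1, hs1, hw, hnorm, ?_⟩
  have h1 := wedge_act M v s
  rw [hw, mul_one] at h1
  rw [← h1, ← sq_eq_sq₀ (by positivity) (abs_nonneg _), sq_abs, mul_pow, plane_norm_sq,
    plane_norm_sq, wedge]
  rw [hp] at hp0
  -- Lagrange's identity: for orthogonal images the product of the norms is the absolute area.
  linear_combination (act M v 0 * act M s 0 + act M v 1 * act M s 1) * hp0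

lemma det_ne_zero (g : GL (Fin 2) ℝ) : (g : Matrix (Fin 2) (Fin 2) ℝ).det ≠ 0 :=
  Matrix.GeneralLinearGroup.det_ne_zero g

lemma opNorm_pos (g : GL (Fin 2) ℝ) : 0 < opNorm (g : Matrix (Fin 2) (Fin 2) ℝ) := by
  obtain ⟨v, s, -, -, -, h, h'⟩ := exists_singular_vectors (g : Matrix (Fin 2) (Fin 2) ℝ)
  refine lt_of_le_of_ne (norm_nonneg _) fun h0 => ?_
  change 0 = opNorm _ at h0
  rw [h, ← h0, zero_mul] at h'
  exact det_ne_zero g (abs_eq_zero.1 h'.symm)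

lemma act_inv_act (g : GL (Fin 2) ℝ) (x : Plane) :
    act ((g⁻¹ : GL (Fin 2) ℝ) : Matrix (Fin 2) (Fin 2) ℝ) (act (g : Matrix (Fin 2) (Fin 2) ℝ) x)
      = x := by
  rw [← act_mul, ← Units.val_mul, inv_mul_cancel, Units.val_one, act_one]

/-- The inverse must expand the image of the least expanded unit vector `s`, of length `|det g| /
‖g‖`, back to length `1`. -/
lemma opNorm_le_opNorm_inv_mul (g : GL (Fin 2) ℝ) :
    opNorm (g : Matrix (Fin 2) (Fin 2) ℝ) ≤ opNorm ((g⁻¹ : GL (Fin 2) ℝ) :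
      Matrix (Fin 2) (Fin 2) ℝ) * |(g : Matrix (Fin 2) (Fin 2) ℝ).det| := by
  obtain ⟨v, s, -, hs, -, h, h'⟩ := exists_singular_vectors (g : Matrix (Fin 2) (Fin 2) ℝ)
  have h1 := norm_act_le ((g⁻¹ : GL (Fin 2) ℝ) : Matrix (Fin 2) (Fin 2) ℝ)
    (act (g : Matrix (Fin 2) (Fin 2) ℝ) s)
  rw [act_inv_act, hs] at h1
  rw [h] at h'
  have := mul_le_mul_of_nonneg_left h1 (opNorm_pos g).le
  rw [← h']
  linarith

lemma opNorm_inv (g : GL (Fin 2) ℝ) :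
    opNorm ((g⁻¹ : GL (Fin 2) ℝ) : Matrix (Fin 2) (Fin 2) ℝ)
      = opNorm (g : Matrix (Fin 2) (Fin 2) ℝ) / |(g : Matrix (Fin 2) (Fin 2) ℝ).det| := by
  have hd : 0 < |(g : Matrix (Fin 2) (Fin 2) ℝ).det| := abs_pos.2 (det_ne_zero g)
  refine le_antisymm ?_ ?_
  · have h := opNorm_le_opNorm_inv_mul g⁻¹
    rw [inv_inv] at h
    have hdet : ((g⁻¹ : GL (Fin 2) ℝ) : Matrix (Fin 2) (Fin 2) ℝ).det
        * (g : Matrix (Fin 2) (Fin 2) ℝ).det = 1 := by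
      rw [← Matrix.det_mul, ← Units.val_mul, inv_mul_cancel, Units.val_one, Matrix.det_one]
    have : |((g⁻¹ : GL (Fin 2) ℝ) : Matrix (Fin 2) (Fin 2) ℝ).det|
        = |(g : Matrix (Fin 2) (Fin 2) ℝ).det|⁻¹ := by
      refine eq_inv_of_mul_eq_one_left ?_
      rw [← abs_mul, hdet, abs_one]
    rwa [this] at h
  · rw [div_le_iff₀ hd]
    exact opNorm_le_opNorm_inv_mul g

lemma abs_log_norm_act_sub_le {M : Matrix (Fin 2) (Fin 2) ℝ} {K : ℝ}
    (h1 : ∀ x, ‖act M x‖ ≤ Real.exp K * ‖x‖) (h2 : ∀ x, ‖x‖ ≤ Real.exp K * ‖act M x‖) {x : Plane}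
    (hx : x ≠ 0) : |Real.log ‖act M x‖ - Real.log ‖x‖| ≤ K := by
  have hx' : 0 < ‖x‖ := norm_pos_iff.2 hx
  have hM : 0 < ‖act M x‖ := pos_of_mul_pos_right (hx'.trans_le (h2 x)) (Real.exp_pos K).le
  have e1 := Real.log_le_log hM (h1 x)
  have e2 := Real.log_le_log hx' (h2 x)
  rw [Real.log_mul (Real.exp_pos K).ne' hx'.ne', Real.log_exp] at e1
  rw [Real.log_mul (Real.exp_pos K).ne' hM.ne', Real.log_exp] at e2
  rw [abs_le]
  constructor <;> linarith

/-- Nearly parallel unit vectors are expanded nearly equally. -/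
lemma log_norm_act_le_of_unit {M : Matrix (Fin 2) (Fin 2) ℝ} {K : ℝ}
    (h1 : ∀ x, ‖act M x‖ ≤ Real.exp K * ‖x‖) (h2 : ∀ x, ‖x‖ ≤ Real.exp K * ‖act M x‖) {x y : Plane}
    (hx : ‖x‖ = 1) (hy : ‖y‖ = 1) :
    Real.log ‖act M x‖ ≤ Real.log ‖act M y‖ + 2 * Real.exp (2 * K) * |wedge x y| := by
  have hxsq := plane_norm_sq x
  have hysq := plane_norm_sq y
  rw [hx, one_pow] at hxsq
  rw [hy, one_pow] at hysq
  have hid : (x 0 * y 0 + x 1 * y 1) ^ 2 + wedge x y ^ 2 = 1 := by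
    rw [wedge]
    linear_combination (-(x 0 ^ 2 + x 1 ^ 2)) * hysq - hxsq
  -- The sign `ε` turns `y` so that its angle with `x` is at most a right angle; then `x - ε • y` is
  -- controlled by the sine of the angle.
  obtain ⟨ε, hε, hεc⟩ : ∃ ε : ℝ, ε ^ 2 = 1 ∧ 0 ≤ ε * (x 0 * y 0 + x 1 * y 1) := by
    rcases le_total 0 (x 0 * y 0 + x 1 * y 1) with h | h
    · exact ⟨1, by norm_num, by linarith⟩
    · exact ⟨-1, by norm_num, by linarith⟩
  have hεabs : |ε| = 1 := by
    rwa [← sq_eq_sq₀ (abs_nonneg ε) zero_le_one, sq_abs, one_pow]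
  have hdist : ‖x - ε • y‖ ≤ 2 * |wedge x y| := by
    refine le_of_sq_le_sq ?_ (by positivity)
    rw [plane_norm_sq, mul_pow, sq_abs]
    simp only [PiLp.sub_apply, PiLp.smul_apply, smul_eq_mul]
    set c := x 0 * y 0 + x 1 * y 1 with hc
    have e : (x 0 - ε * y 0) ^ 2 + (x 1 - ε * y 1) ^ 2 = 2 - 2 * (ε * c) := by
      rw [hc]
      linear_combination -hxsq - ε ^ 2 * hysq + hε
    have e2 : (ε * c) ^ 2 + wedge x y ^ 2 = 1 := by rw [mul_pow, hε, one_mul, hid]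
    rw [e]
    nlinarith [sq_nonneg (wedge x y), sq_nonneg (1 - ε * c)]
  have hpx : 0 < ‖act M x‖ := by
    have := h2 x
    rw [hx] at this
    exact pos_of_mul_pos_right (zero_lt_one.trans_le this) (Real.exp_pos K).le
  have hpy : 0 < ‖act M y‖ := by
    have := h2 y
    rw [hy] at this
    exact pos_of_mul_pos_right (zero_lt_one.trans_le this) (Real.exp_pos K).le
  have h3 : ‖act M x‖ ≤ ‖act M y‖ + Real.exp K * (2 * |wedge x y|) := by
    have e : act M x = ε • act M y + act M (x - ε • y) := by
      rw [map_sub, map_smul]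
      abel
    rw [e]
    refine (norm_add_le _ _).trans ?_
    rw [norm_smul, Real.norm_eq_abs, hεabs, one_mul]
    have := (h1 (x - ε • y)).trans (mul_le_mul_of_nonneg_left hdist (Real.exp_pos K).le)
    linarith
  have h4 := Real.log_le_sub_one_of_pos (div_pos hpx hpy)
  rw [Real.log_div hpx.ne' hpy.ne'] at h4
  have h5 : ‖act M x‖ / ‖act M y‖ - 1 ≤ 2 * Real.exp (2 * K) * |wedge x y| := by
    rw [div_sub_one hpy.ne', div_le_iff₀ hpy]
    have h6 := h2 y
    rw [hy] at h6
    have e : Real.exp (2 * K) = Real.exp K * Real.exp K := by rw [← Real.exp_add, two_mul]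
    rw [e]
    have : 0 ≤ 2 * Real.exp K * |wedge x y| := by positivity
    have := mul_le_mul_of_nonneg_left h6 this
    linarith
  linarith

/-- Normalization reduces this to unit vectors. The quotient on the right is the sine of the angle,
so one matrix changes the ratio of two norms little when the vectors are nearly parallel. -/
lemma abs_log_norm_act_sub_sub_le {M : Matrix (Fin 2) (Fin 2) ℝ} {K : ℝ}
    (h1 : ∀ x, ‖act M x‖ ≤ Real.exp K * ‖x‖) (h2 : ∀ x, ‖x‖ ≤ Real.exp K * ‖act M x‖) {x y : Plane}
    (hx : x ≠ 0) (hy : y ≠ 0) :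
    |Real.log ‖act M x‖ - Real.log ‖act M y‖ - (Real.log ‖x‖ - Real.log ‖y‖)|
      ≤ 2 * Real.exp (2 * K) * (|wedge x y| / (‖x‖ * ‖y‖)) := by
  have key : ∀ x y : Plane, x ≠ 0 → y ≠ 0 →
      Real.log ‖act M x‖ - Real.log ‖act M y‖ - (Real.log ‖x‖ - Real.log ‖y‖)
        ≤ 2 * Real.exp (2 * K) * (|wedge x y| / (‖x‖ * ‖y‖)) := by
    intro x y hx hy
    have hx' : 0 < ‖x‖ := norm_pos_iff.2 hx
    have hy' : 0 < ‖y‖ := norm_pos_iff.2 hy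
    have hMx : 0 < ‖act M x‖ := pos_of_mul_pos_right (hx'.trans_le (h2 x)) (Real.exp_pos K).le
    have hMy : 0 < ‖act M y‖ := pos_of_mul_pos_right (hy'.trans_le (h2 y)) (Real.exp_pos K).le
    have h := log_norm_act_le_of_unit h1 h2 (norm_smul_inv_norm (𝕜 := ℝ) hx)
      (norm_smul_inv_norm (𝕜 := ℝ) hy)
    have hw : wedge (((‖x‖ : ℝ)⁻¹ : ℝ) • x) (((‖y‖ : ℝ)⁻¹ : ℝ) • y)
        = wedge x y / (‖x‖ * ‖y‖) := by
      simp only [wedge, PiLp.smul_apply, smul_eq_mul]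
      field_simp
    simp only [RCLike.ofReal_real_eq_id, id_eq] at h
    rw [hw, map_smul, map_smul, norm_smul, norm_smul, norm_inv, norm_inv, norm_norm, norm_norm,
      Real.log_mul (inv_pos.2 hx').ne' hMx.ne', Real.log_mul (inv_pos.2 hy').ne' hMy.ne',
      Real.log_inv, Real.log_inv, abs_div, abs_of_pos (mul_pos hx' hy')] at h
    linarith
  have e1 := key x y hx hy
  have e2 := key y x hy hx
  have : |wedge y x| = |wedge x y| := by
    rw [← abs_neg]
    congr 1
    simp only [wedge]
    ring
  rw [this, mul_comm ‖y‖] at e2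
  rw [abs_le]
  constructor <;> linarith

/-! ### Dominated tuples -/

section Dominated

variable (A : Fin N → GL (Fin 2) ℝ)

/-- The matrix of a word. -/
abbrev mat (w : List (Fin N)) : Matrix (Fin 2) (Fin 2) ℝ := (wordMat A w : Matrix (Fin 2) (Fin 2) ℝ)

/-- The logarithm of the larger singular value. -/
def la1 (w : List (Fin N)) : ℝ := Real.log (alpha1 A w)

/-- The logarithm of the absolute value of the determinant. -/
def ldet (w : List (Fin N)) : ℝ := Real.log |(mat A w).det|

/-- The logarithm of the smaller singular value. -/
def la2 (w : List (Fin N)) : ℝ := ldet A w - la1 A w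

lemma mat_append (u v : List (Fin N)) : mat A (u ++ v) = mat A u * mat A v := by
  simp [mat, wordMat]

lemma mat_cons (i : Fin N) (v : List (Fin N)) :
    mat A (i :: v) = (A i : Matrix (Fin 2) (Fin 2) ℝ) * mat A v := by
  simp [mat, wordMat]

lemma mat_nil : mat A [] = 1 := by simp [mat, wordMat]

lemma abs_det_mat_pos (w : List (Fin N)) : 0 < |(mat A w).det| := abs_pos.2 (det_ne_zero _)

lemma alpha1_pos (w : List (Fin N)) : 0 < alpha1 A w := opNorm_pos _

lemma exp_la1 (w : List (Fin N)) : Real.exp (la1 A w) = alpha1 A w := Real.exp_log (alpha1_pos A w)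

lemma alpha2_eq (w : List (Fin N)) : alpha2 A w = Real.exp (la2 A w) := by
  rw [alpha2, opNorm_inv, la2, ldet, Real.exp_sub, Real.exp_log (abs_det_mat_pos A w), exp_la1,
    inv_div]
  rfl

lemma ldet_append (u v : List (Fin N)) : ldet A (u ++ v) = ldet A u + ldet A v := by
  rw [ldet, mat_append, Matrix.det_mul, abs_mul,
    Real.log_mul (abs_det_mat_pos A u).ne' (abs_det_mat_pos A v).ne', ldet, ldet]

lemma isAlmostAdditive_ldet : IsAlmostAdditive (ldet A) 0 := fun u v => by
  rw [ldet_append]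
  simp

lemma la1_append_le (u v : List (Fin N)) : la1 A (u ++ v) ≤ la1 A u + la1 A v := by
  rw [← Real.exp_le_exp, Real.exp_add, exp_la1, exp_la1, exp_la1, alpha1]
  change opNorm (mat A (u ++ v)) ≤ _
  rw [mat_append]
  exact opNorm_mul_le _ _

lemma la1_cons_le (i : Fin N) (v : List (Fin N)) : la1 A (i :: v) ≤ la1 A [i] + la1 A v :=
  la1_append_le A [i] v

lemma la1_nil : la1 A [] = 0 := by
  have h : opNorm (1 : Matrix (Fin 2) (Fin 2) ℝ) = 1 := by
    simp [opNorm]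
  rw [la1, alpha1]
  change Real.log (opNorm (mat A [])) = 0
  rw [mat_nil, h, Real.log_one]

lemma la1_le_of_letter {κ : ℝ} (h : ∀ i, la1 A [i] ≤ κ) (w : List (Fin N)) :
    la1 A w ≤ κ * w.length := by
  induction w with
  | nil => simp [la1_nil]
  | cons i w ih =>
    have := la1_cons_le A i w
    have := h i
    rw [List.length_cons]
    push_cast
    linarith

lemma alpha1_singleton (i : Fin N) : alpha1 A [i] = opNorm (A i : Matrix (Fin 2) (Fin 2) ℝ) := by
  simp [alpha1, wordMat]

lemma exists_la1_le (hA : IsContractive A) : ∃ κ, 0 < κ ∧ ∀ w, la1 A w ≤ -(κ * w.length) := by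
  have : ∃ κ, 0 < κ ∧ ∀ i, κ ≤ -la1 A [i] := by
    have hneg : ∀ i, 0 < -la1 A [i] := fun i => by
      rw [neg_pos, la1, alpha1_singleton]
      exact Real.log_neg (opNorm_pos _) (hA i)
    rcases isEmpty_or_nonempty (Fin N) with he | he
    · exact ⟨1, one_pos, fun i => he.elim i⟩
    · obtain ⟨i, hi⟩ := Finite.exists_min fun i => -la1 A [i]
      exact ⟨_, hneg i, hi⟩
  obtain ⟨κ, hκ, h⟩ := this
  refine ⟨κ, hκ, fun w => ?_⟩
  have := la1_le_of_letter A (κ := -κ) (fun i => by linarith [h i]) w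
  linarith

lemma la2_le_la1 (w : List (Fin N)) : la2 A w ≤ la1 A w := by
  obtain ⟨v, s, -, hs, -, h, h'⟩ := exists_singular_vectors (mat A w)
  have h1 := norm_act_le (mat A w) s
  rw [hs, mul_one] at h1
  have h2 : |(mat A w).det| ≤ alpha1 A w * alpha1 A w := by
    rw [← h', h]
    exact mul_le_mul_of_nonneg_left h1 (opNorm_pos _).le
  have h3 := Real.log_le_log (abs_det_mat_pos A w) h2
  rw [Real.log_mul (alpha1_pos A w).ne' (alpha1_pos A w).ne'] at h3
  rw [la2, ldet, la1]
  linarith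

lemma exists_norm_act_letter_le : ∃ K, 0 ≤ K ∧ ∀ i : Fin N,
    (∀ x, ‖act (A i : Matrix (Fin 2) (Fin 2) ℝ) x‖ ≤ Real.exp K * ‖x‖) ∧
    (∀ x, ‖x‖ ≤ Real.exp K * ‖act (A i : Matrix (Fin 2) (Fin 2) ℝ) x‖) := by
  let f : Fin N → ℝ := fun i => |Real.log (opNorm (A i : Matrix (Fin 2) (Fin 2) ℝ))|
    + |Real.log (opNorm ((A i)⁻¹ : GL (Fin 2) ℝ))|
  have hf : ∀ i, f i ≤ ∑ i, f i := fun i =>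
    Finset.single_le_sum (fun i _ => by positivity) (Finset.mem_univ i)
  refine ⟨∑ i, f i, Finset.sum_nonneg fun i _ => by positivity, fun i => ⟨fun x => ?_, fun x => ?_⟩⟩
  · refine (norm_act_le _ x).trans (mul_le_mul_of_nonneg_right ?_ (norm_nonneg x))
    rw [← Real.log_le_iff_le_exp (opNorm_pos _)]
    refine le_trans ?_ (hf i)
    have := le_abs_self (Real.log (opNorm (A i : Matrix (Fin 2) (Fin 2) ℝ)))
    have := abs_nonneg (Real.log (opNorm ((A i)⁻¹ : GL (Fin 2) ℝ)))
    simp only [f]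
    linarith
  · have h := norm_act_le (((A i)⁻¹ : GL (Fin 2) ℝ) : Matrix (Fin 2) (Fin 2) ℝ)
      (act (A i : Matrix (Fin 2) (Fin 2) ℝ) x)
    rw [act_inv_act] at h
    refine h.trans (mul_le_mul_of_nonneg_right ?_ (norm_nonneg _))
    rw [← Real.log_le_iff_le_exp (opNorm_pos _)]
    refine le_trans ?_ (hf i)
    have := abs_nonneg (Real.log (opNorm (A i : Matrix (Fin 2) (Fin 2) ℝ)))
    have := le_abs_self (Real.log (opNorm ((A i)⁻¹ : GL (Fin 2) ℝ)))
    simp only [f]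
    linarith

lemma act_mat_ne_zero (w : List (Fin N)) {x : Plane} (hx : x ≠ 0) : act (mat A w) x ≠ 0 := by
  intro h
  have := act_inv_act (wordMat A w) x
  rw [h, map_zero] at this
  exact hx this.symm

/-- The larger singular values of a dominated tuple are almost multiplicative. -/
theorem exists_isAlmostAdditive_la1 (hA : IsDominated A) : ∃ C, IsAlmostAdditive (la1 A) C := by
  obtain ⟨C, ρ, hC, hρ, hρ1, hdom⟩ := hA
  obtain ⟨K, hK, hlet⟩ := exists_norm_act_letter_le A
  have hl : 0 < -Real.log ρ := neg_pos.2 (Real.log_neg hρ hρ1)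
  obtain ⟨M, hM⟩ := exists_growth_defect hK (K₁ := 2 * Real.exp (2 * K)) (by positivity) hl
    (abs_nonneg (Real.log C))
  have hletter : ∀ i, la1 A [i] ≤ K := fun i => by
    rw [la1, alpha1_singleton, Real.log_le_iff_le_exp (opNorm_pos _)]
    exact ContinuousLinearMap.opNorm_le_bound _ (Real.exp_pos K).le (hlet i).1
  have hdomlog : ∀ w, -Real.log ρ * w.length - |Real.log C| ≤ 2 * la1 A w - ldet A w := by
    intro w
    have h := hdom w
    rw [alpha2_eq, ← exp_la1, ← Real.exp_log hC, ← Real.exp_log hρ, ← Real.exp_nat_mul,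
      ← Real.exp_add, ← Real.exp_add, Real.exp_le_exp, la2] at h
    have := le_abs_self (Real.log C)
    linarith
  refine ⟨2 * M, fun u v => ?_⟩
  obtain ⟨x, s, hx1, hs1, hw, hxn, hxs⟩ := exists_singular_vectors (mat A (u ++ v))
  set w := u ++ v with hwdef
  have hx : x ≠ 0 := norm_pos_iff.1 (by rw [hx1]; exact one_pos)
  have hs : s ≠ 0 := norm_pos_iff.1 (by rw [hs1]; exact one_pos)
  -- Suffix products are used because the rightmost letter acts first: passing from `i + 1` to `i`
  -- applies the single matrix `A w[i]`.
  let F : ℕ → ℝ := fun i => Real.log ‖act (mat A (w.drop i)) x‖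
  let G : ℕ → ℝ := fun i => Real.log ‖act (mat A (w.drop i)) s‖
  let D : ℕ → ℝ := fun i => ldet A (w.drop i)
  let a : ℕ → ℕ → ℝ := fun i j => la1 A ((w.drop i).take (j - i))
  have hFexp : ∀ i, Real.exp (F i) = ‖act (mat A (w.drop i)) x‖ := fun i =>
    Real.exp_log (norm_pos_iff.2 (act_mat_ne_zero A _ hx))
  have hGexp : ∀ i, Real.exp (G i) = ‖act (mat A (w.drop i)) s‖ := fun i =>
    Real.exp_log (norm_pos_iff.2 (act_mat_ne_zero A _ hs))
  have hDexp : ∀ i, Real.exp (D i)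
      = |wedge (act (mat A (w.drop i)) x) (act (mat A (w.drop i)) s)| := fun i => by
    rw [wedge_act, hw, mul_one]
    exact Real.exp_log (abs_det_mat_pos A _)
  have hsplit : ∀ i j, i ≤ j → w.drop i = (w.drop i).take (j - i) ++ w.drop j := by
    intro i j hij
    conv_lhs => rw [← List.take_append_drop (j - i) (w.drop i)]
    rw [List.drop_drop, Nat.add_sub_cancel' hij]
  have hstep : ∀ i (hi : i < w.length), w.drop i = w[i] :: w.drop (i + 1) := fun i hi =>
    List.drop_eq_getElem_cons hi
  have hlen : ∀ i j, i ≤ j → j ≤ w.length → (((w.drop i).take (j - i)).length : ℝ) = (j : ℝ) - i := by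
    intro i j hij hj
    rw [List.length_take, List.length_drop, min_eq_left (by omega), Nat.cast_sub hij]
  have hFn : F w.length = 0 := by simp [F, mat_nil, hx1]
  have hGn : G w.length = 0 := by simp [G, mat_nil, hs1]
  have hDn : D w.length = 0 := by simp [D, ldet, mat_nil]
  have hF0 : F 0 = la1 A w := by
    simp only [F, List.drop_zero]
    rw [hxn]
    rfl
  have hG0 : F 0 + G 0 = D 0 := by
    rw [← Real.exp_eq_exp, Real.exp_add, hFexp, hGexp, List.drop_zero, hxs]
    exact (Real.exp_log (abs_det_mat_pos A _)).symm
  have main := hM w.length F G D a ?_ (by linarith) (by linarith) ?_ ?_ ?_ ?_ ?_ ?_ ?_ ?_ u.length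
    (by simp [hwdef])
  · have e1 : a 0 u.length = la1 A u := by simp [a, hwdef]
    have e2 : a u.length w.length = la1 A v := by simp [a, hwdef]
    rw [e1, e2, hF0, hFn, sub_zero] at main
    have := la1_append_le A u v
    rw [abs_le]
    -- Nonnegativity of `M` is read off from `hM` on the trivial data with `n = 0`; the upper bound
    -- `0` from submultiplicativity is then below `2 * M`.
    have hM0 : 0 ≤ M := by
      have := hM 0 (fun _ => 0) (fun _ => 0) (fun _ => 0) (fun _ _ => 0) (by simp) (by simp)
        (by simp) (by simp) (fun _ _ _ _ => by simp [Real.log_nonneg]) (by simp) (by simp) (by simp)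
        (by simp) (fun i j h1 h2 => by
          have : (i : ℝ) ≤ j := by exact_mod_cast h1
          exact mul_nonneg hK (by linarith)) (fun i j h1 h2 => by
          have hi : i = 0 := by omega
          have hj : j = 0 := by omega
          subst hi hj
          simp) 0 le_rfl
      linarith [this.1]
    constructor <;> linarith [main.1, main.2]
  · intro i _
    have := abs_wedge_le (act (mat A (w.drop i)) x) (act (mat A (w.drop i)) s)
    rw [← hFexp, ← hGexp, ← hDexp, ← Real.exp_add, Real.exp_le_exp] at this
    linarith
  · rw [hFn, hF0, sub_zero]
    simp [a]
  · intro i j hij _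
    have h := opNorm_mul_abs_wedge_le (mat A ((w.drop i).take (j - i)))
      (act (mat A (w.drop j)) x) (act (mat A (w.drop j)) s)
    rw [← act_mul, ← act_mul, ← mat_append, ← hsplit i j hij, ← hDexp, ← hFexp, ← hFexp, ← hGexp,
      ← hGexp] at h
    change alpha1 A _ * _ ≤ _ at h
    rw [← exp_la1, ← Real.exp_add, ← Real.exp_add, ← Real.exp_add] at h
    have h2 : Real.exp (la1 A ((w.drop i).take (j - i)) + D j)
        ≤ Real.exp (Real.log 2 + (F j + G j + max (F i - F j) (G i - G j))) := by
      refine h.trans ?_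
      rw [Real.exp_add (Real.log 2), Real.exp_log two_pos, two_mul]
      refine add_le_add (Real.exp_le_exp.2 ?_) (Real.exp_le_exp.2 ?_)
      · linarith [le_max_left (F i - F j) (G i - G j)]
      · linarith [le_max_right (F i - F j) (G i - G j)]
    rw [Real.exp_le_exp] at h2
    simp only [a]
    linarith
  · intro i hi
    simp only [F]
    rw [hstep i hi, mat_cons, act_mul]
    exact abs_log_norm_act_sub_le (hlet _).1 (hlet _).2 (act_mat_ne_zero A _ hx)
  · intro i hi
    simp only [G]
    rw [hstep i hi, mat_cons, act_mul]
    exact abs_log_norm_act_sub_le (hlet _).1 (hlet _).2 (act_mat_ne_zero A _ hs)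
  · intro i hi
    have e : D i - D (i + 1) = ldet A [w[i]] := by
      simp only [D]
      rw [hstep i hi, ← List.singleton_append, ldet_append]
      ring
    rw [e]
    obtain ⟨v', s', hv1, hs1', -, -, h⟩ := exists_singular_vectors (mat A [w[i]])
    have hv' : v' ≠ 0 := norm_pos_iff.1 (by rw [hv1]; exact one_pos)
    have hs' : s' ≠ 0 := norm_pos_iff.1 (by rw [hs1']; exact one_pos)
    have hm : mat A [w[i]] = (A w[i] : Matrix (Fin 2) (Fin 2) ℝ) := by simp [mat, wordMat]
    have p1 := norm_pos_iff.2 (act_mat_ne_zero A [w[i]] hv')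
    have p2 := norm_pos_iff.2 (act_mat_ne_zero A [w[i]] hs')
    rw [ldet, ← h, Real.log_mul p1.ne' p2.ne', hm]
    have h1 := abs_log_norm_act_sub_le (hlet w[i]).1 (hlet w[i]).2 hv'
    have h2 := abs_log_norm_act_sub_le (hlet w[i]).1 (hlet w[i]).2 hs'
    rw [hv1, Real.log_one, sub_zero] at h1
    rw [hs1', Real.log_one, sub_zero] at h2
    refine (abs_add_le _ _).trans ?_
    linarith
  · intro i hi
    have h := abs_log_norm_act_sub_sub_le (hlet w[i]).1 (hlet w[i]).2
      (act_mat_ne_zero A (w.drop (i + 1)) hx) (act_mat_ne_zero A (w.drop (i + 1)) hs)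
    rw [← hFexp, ← hGexp, ← hDexp, ← Real.exp_add, ← Real.exp_sub] at h
    rw [neg_sub]
    simp only [F, G]
    rw [hstep i hi, mat_cons, act_mul, act_mul]
    simpa only [F, G, Real.log_exp] using h
  · intro i j hij hj
    rw [← hlen i j hij hj]
    exact la1_le_of_letter A hletter _
  · intro i j hij hj
    have e : D i - D j = ldet A ((w.drop i).take (j - i)) := by
      simp only [D]
      conv_lhs => rw [hsplit i j hij, ldet_append]
      ring
    rw [e, ← hlen i j hij hj]
    exact hdomlog _

end Dominated

/-! ### Comparison of pressures -/

lemma IsAlmostAdditive.exists_abs_le {u : List (Fin N) → ℝ} {C : ℝ} (h : IsAlmostAdditive u C) :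
    ∃ B, 0 ≤ B ∧ ∀ w, |u w| ≤ B * w.length + C := by
  refine ⟨∑ i, |u [i]| + C, add_nonneg (Finset.sum_nonneg fun _ _ => abs_nonneg _) h.nonneg,
    fun w => ?_⟩
  induction w with
  | nil => simpa using h [] []
  | cons i w ih =>
    have h1 : |u [i]| ≤ ∑ i, |u [i]| :=
      Finset.single_le_sum (f := fun i => |u [i]|) (fun _ _ => abs_nonneg _) (Finset.mem_univ i)
    have h2 := abs_le.1 (h [i] w)
    rw [List.singleton_append] at h2
    have h3 := abs_le.1 ih
    have h4 := abs_le.1 h1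
    rw [List.length_cons]
    push_cast
    rw [abs_le]
    constructor <;> linarith

/-- The pressure is monotone and sees linear growth exactly, while bounded errors disappear; this
transfers wordwise comparisons to pressures. -/
lemma logPressure_add_le [NeZero N] {u u' : List (Fin N) → ℝ} {C C' c d : ℝ}
    (hu : IsAlmostAdditive u C) (hu' : IsAlmostAdditive u' C')
    (h : ∀ w, u w + c * w.length - d ≤ u' w) : logPressure u + c ≤ logPressure u' := by
  have hz : Tendsto (fun n : ℕ => logPart u n / n + (c - d / (n : ℝ))) atTop
      (𝓝 (logPressure u + (c - 0))) :=
    (logPressure_spec hu).1.add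
      (tendsto_const_nhds.sub (tendsto_const_div_atTop_nhds_zero_nat d))
  rw [sub_zero] at hz
  refine le_of_tendsto_of_tendsto hz (logPressure_spec hu').1 ?_
  filter_upwards [eventually_gt_atTop 0] with n hn
  have hn' : (0 : ℝ) < n := by exact_mod_cast hn
  have h1 : Real.exp (c * n - d + logPart u n) ≤ Real.exp (logPart u' n) := by
    rw [exp_logPart u']
    refine exp_mul_wordSum_le u n _ _ fun w hw => Real.exp_le_exp.2 ?_
    have := h w
    rw [hw] at this
    linarith
  rw [Real.exp_le_exp] at h1
  rw [le_div_iff₀ hn', add_mul, sub_mul, div_mul_cancel₀ _ hn'.ne', div_mul_cancel₀ _ hn'.ne']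
  linarith

lemma rate_le_neg {ν : Measure (Shift N)} (hν : ν ∈ invariantMeasures N) {u : List (Fin N) → ℝ}
    {D : ℝ} (hu : IsAlmostAdditive u D) {c : ℝ} (hc : ∀ w, u w ≤ -(c * w.length)) :
    rate u ν ≤ -c := by
  have h1 := le_rate (hu.const_mul (-1)) hν (κ := c) fun w => by linarith [hc w]
  rw [rate_const_mul hu _ hν] at h1
  linarith

/-! ### Zeros of decreasing functions -/

/-- The function `g` is decreasing with slopes between `-K` and `-κ`. -/
def HasSlopes (κ K : ℝ) (g : ℝ → ℝ) : Prop :=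
  ∀ s s', s ≤ s' → g s - K * (s' - s) ≤ g s' ∧ g s' ≤ g s - κ * (s' - s)

namespace HasSlopes

variable {κ K : ℝ} {g : ℝ → ℝ}

lemma strictAnti (hg : HasSlopes κ K g) (hκ : 0 < κ) : StrictAnti g := fun s s' h => by
  have := (hg s s' h.le).2
  have := mul_pos hκ (sub_pos.2 h)
  linarith

lemma continuous (hg : HasSlopes κ K g) (hκ : 0 < κ) : Continuous g := by
  have key : ∀ s s', s ≤ s' → |g s - g s'| ≤ K * |s - s'| := fun s s' h => by
    have h1 := hg s s' h
    have h2 := mul_nonneg hκ.le (sub_nonneg.2 h)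
    rw [abs_of_nonneg (by linarith), abs_of_nonpos (by linarith)]
    linarith
  have hK : 0 ≤ K := by
    have := (abs_nonneg _).trans (key 0 1 zero_le_one)
    simpa using this
  refine (LipschitzWith.of_dist_le_mul (K := ⟨K, hK⟩) fun s s' => ?_).continuous
  rw [Real.dist_eq, Real.dist_eq]
  change |g s - g s'| ≤ K * |s - s'|
  rcases le_total s s' with h | h
  · exact key s s' h
  · rw [abs_sub_comm, abs_sub_comm s]
    exact key s' s h

lemma existsUnique_zero (hg : HasSlopes κ K g) (hκ : 0 < κ) (h0 : 0 ≤ g 0) :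
    ∃! s, 0 ≤ s ∧ g s = 0 := by
  -- With slope at most `-κ`, the function has dropped to zero by `g 0 / κ`.
  have hb : 0 ≤ g 0 / κ := div_nonneg h0 hκ.le
  have h1 := (hg 0 (g 0 / κ) hb).2
  rw [sub_zero, mul_div_cancel₀ _ hκ.ne', sub_self] at h1
  obtain ⟨s, hs, hs0⟩ := intermediate_value_Icc' hb (hg.continuous hκ).continuousOn ⟨h1, h0⟩
  exact ⟨s, ⟨hs.1, hs0⟩, fun s' hs' => (hg.strictAnti hκ).injective (hs'.2.trans hs0.symm)⟩

end HasSlopes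

lemma sInf_mem_of_existsUnique {S : Set ℝ} (hS : ∃! s, s ∈ S) : sInf S ∈ S := by
  obtain ⟨s, hs, hu⟩ := hS
  rwa [Set.eq_singleton_iff_unique_mem.2 ⟨hs, hu⟩, csInf_singleton,
    ← Set.eq_singleton_iff_unique_mem.2 ⟨hs, hu⟩]

/-! ### The singular value function -/

/-- The weight of the larger singular value in the singular value function. -/
def wt1 (s : ℝ) : ℝ := if s < 1 then s else if s < 2 then 1 else s / 2

/-- The weight of the smaller singular value in the singular value function. -/
def wt2 (s : ℝ) : ℝ := if s < 1 then 0 else if s < 2 then s - 1 else s / 2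

lemma wt1_add_wt2 (s : ℝ) : wt1 s + wt2 s = s := by
  simp only [wt1, wt2]
  split_ifs <;> ring

lemma wt1_mono : Monotone wt1 := fun s s' h => by
  simp only [wt1]
  split_ifs <;> linarith

lemma wt2_mono : Monotone wt2 := fun s s' h => by
  simp only [wt2]
  split_ifs <;> linarith

/-- Both weights increase and their sum is `s`, so an increment of `s` is split into nonnegative
parts multiplying `x` and `y`. -/
lemma hasSlopes_wt {x y κ K : ℝ} (hx : x ≤ -κ) (hx' : -K ≤ x) (hy : y ≤ -κ) (hy' : -K ≤ y) :
    HasSlopes κ K fun s => wt1 s * x + wt2 s * y := by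
  intro s s' h
  have h1 := sub_nonneg.2 (wt1_mono h)
  have h2 := sub_nonneg.2 (wt2_mono h)
  have h3 := wt1_add_wt2 s
  have h4 := wt1_add_wt2 s'
  have e : s' - s = (wt1 s' - wt1 s) + (wt2 s' - wt2 s) := by linarith
  have m1 := mul_le_mul_of_nonneg_left hx h1
  have m2 := mul_le_mul_of_nonneg_left hx' h1
  have m3 := mul_le_mul_of_nonneg_left hy h2
  have m4 := mul_le_mul_of_nonneg_left hy' h2
  rw [e]
  constructor <;> linarith

variable (A : Fin N → GL (Fin 2) ℝ)

/-- The logarithm of the singular value function. -/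
def lsv (s : ℝ) (w : List (Fin N)) : ℝ := wt1 s * la1 A w + wt2 s * la2 A w

lemma svf_eq (s : ℝ) (w : List (Fin N)) : svf A s w = Real.exp (lsv A s w) := by
  have hdet : |(wordMat A w : Matrix (Fin 2) (Fin 2) ℝ).det| = Real.exp (la1 A w + la2 A w) := by
    rw [la2, add_sub_cancel]
    exact (Real.exp_log (abs_det_mat_pos A w)).symm
  rw [svf, hdet, alpha2_eq, ← exp_la1, ← Real.exp_mul, ← Real.exp_mul, ← Real.exp_add,
    ← Real.exp_mul]
  simp only [lsv, wt1, wt2]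
  split_ifs <;> congr 1 <;> ring

/-- Two-sided bounds of the logarithms of the singular values. -/
lemma exists_la_bounds (hc : IsContractive A) : ∃ κ K, 0 < κ ∧ ∀ w,
    la1 A w ≤ -(κ * w.length) ∧ la2 A w ≤ -(κ * w.length) ∧
    -(K * w.length) ≤ la1 A w ∧ -(K * w.length) ≤ la2 A w := by
  obtain ⟨κ, hκ, h1⟩ := exists_la1_le A hc
  obtain ⟨B, -, hB⟩ := (isAlmostAdditive_ldet A).exists_abs_le
  refine ⟨κ, B, hκ, fun w => ?_⟩
  have h2 := la2_le_la1 A w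
  have h3 := h1 w
  have h4 := abs_le.1 (hB w)
  have h5 : 0 ≤ κ * w.length := by positivity
  have h6 : la2 A w = ldet A w - la1 A w := rfl
  refine ⟨h3, by linarith, by linarith, by linarith⟩

/-! ### The potentials `ψ` -/

/-- The logarithm of the measures of cylinders. -/
def lmu (μ : Measure (Shift N)) (w : List (Fin N)) : ℝ := Real.log (cylMeasure μ w)

section QuasiBernoulli

variable {μ : Measure (Shift N)} [IsProbabilityMeasure μ]

lemma IsQuasiBernoulli.cylMeasure_pos (hμ : IsQuasiBernoulli μ) (w : List (Fin N)) :
    0 < cylMeasure μ w := ENNReal.toReal_pos (hμ.1 w).ne' (measure_ne_top _ _)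

lemma IsQuasiBernoulli.exp_lmu (hμ : IsQuasiBernoulli μ) (w : List (Fin N)) :
    Real.exp (lmu μ w) = cylMeasure μ w := Real.exp_log (hμ.cylMeasure_pos w)

lemma lmu_nonpos (w : List (Fin N)) : lmu μ w ≤ 0 :=
  Real.log_nonpos (cylMeasure_nonneg μ w) measureReal_le_one

lemma IsQuasiBernoulli.exists_isAlmostAdditive (hμ : IsQuasiBernoulli μ) :
    ∃ C, IsAlmostAdditive (lmu μ) C := by
  obtain ⟨C, hC, h1, h2⟩ := hμ.2
  have hC0 : 0 < C := by linarith
  refine ⟨Real.log C, fun v w => ?_⟩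
  have pv := hμ.cylMeasure_pos v
  have pw := hμ.cylMeasure_pos w
  have pvw := hμ.cylMeasure_pos (v ++ w)
  have e1 : cylMeasure μ (v ++ w) ≤ C * cylMeasure μ v * cylMeasure μ w := by
    have := h1 v w
    simp only at this
    refine le_of_mul_le_mul_left ?_ hC0
    linarith
  have e2 : cylMeasure μ v * cylMeasure μ w ≤ C * cylMeasure μ (v ++ w) := by
    have := h2 v w
    simp only [one_div, ← mul_inv] at this
    have := (inv_le_inv₀ (by positivity) (by positivity)).1 this
    have h3 := mul_le_mul_of_nonneg_left this (by positivity : 0 ≤ C * C)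
    have h4 : C * C * (C⁻¹ * cylMeasure μ v * (C⁻¹ * cylMeasure μ w))
        = cylMeasure μ v * cylMeasure μ w := by field_simp
    have h5 : C * C * (C⁻¹ * cylMeasure μ (v ++ w)) = C * cylMeasure μ (v ++ w) := by field_simp
    rwa [h4, h5] at h3
  have l1 := Real.log_le_log pvw e1
  have l2 := Real.log_le_log (mul_pos pv pw) e2
  rw [Real.log_mul (by positivity) pw.ne', Real.log_mul hC0.ne' pv.ne'] at l1
  rw [Real.log_mul pv.ne' pw.ne', Real.log_mul hC0.ne' pvw.ne'] at l2
  simp only [lmu]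
  rw [abs_le]
  constructor <;> linarith

/-- The logarithm of `ψ^{q,s}`. -/
def lpsi (μ : Measure (Shift N)) (q s : ℝ) (w : List (Fin N)) : ℝ :=
  q * lmu μ w + (1 - q) * lsv A s w

lemma psi_eq (hμ : IsQuasiBernoulli μ) (q s : ℝ) :
    psi A μ q s = fun w => Real.exp (lpsi A μ q s w) := by
  funext w
  rw [psi, svf_eq, ← hμ.exp_lmu, ← Real.exp_mul, ← Real.exp_mul, ← Real.exp_add, lpsi]
  congr 1
  ring

/-- The normalized pressure, decreasing in `s`. -/
def npress (μ : Measure (Shift N)) (q s : ℝ) : ℝ :=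
  logPressure (lpsi A μ q s) / (1 - q)

lemma logPressure_lmu (hμ : IsQuasiBernoulli μ) :
    logPressure (lmu μ) = 0 := by
  refine Tendsto.limUnder_eq (tendsto_const_nhds.congr fun n => ?_)
  have : ∑ w : Fin n → Fin N, Real.exp (lmu μ (List.ofFn w)) = 1 := by
    simp only [hμ.exp_lmu]
    exact wordSum_cylMeasure μ n
  rw [this, Real.log_one, mul_zero]

lemma mem_pressureZeros_iff (hμ : IsQuasiBernoulli μ) {q : ℝ}
    (hq : q ≠ 1) (s : ℝ) : s ∈ pressureZeros A μ q ↔ 0 ≤ s ∧ npress A μ q s = 0 := by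
  rw [pressureZeros, Set.mem_ofPred_eq, psi_eq A hμ, npress, div_eq_zero_iff,
    or_iff_left (sub_ne_zero.2 hq.symm), logPressure]

end QuasiBernoulli

/-! ### Regularity of the potentials and the zero of the pressure -/

/-- The potentials are almost additive. -/
structure IsRegular (μ : Measure (Shift N)) (C C' κ K : ℝ) : Prop where
  lmu : IsAlmostAdditive (lmu μ) C
  la1 : IsAlmostAdditive (la1 A) C'
  pos : 0 < κ
  la1_le : ∀ w, SelfAffine.la1 A w ≤ -(κ * w.length)
  la2_le : ∀ w, la2 A w ≤ -(κ * w.length)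
  le_la1 : ∀ w, -(K * w.length) ≤ SelfAffine.la1 A w
  le_la2 : ∀ w, -(K * w.length) ≤ la2 A w

namespace IsRegular

variable {A} {μ : Measure (Shift N)} {C C' κ K : ℝ}

lemma la2 (h : IsRegular A μ C C' κ K) : IsAlmostAdditive (la2 A) C' := fun v w => by
  have := h.la1 v w
  rw [SelfAffine.la2, SelfAffine.la2, SelfAffine.la2, ldet_append, ← abs_neg]
  convert this using 2
  ring

lemma lsv (h : IsRegular A μ C C' κ K) (s : ℝ) :
    IsAlmostAdditive (lsv A s) (|wt1 s| * C' + |wt2 s| * C') :=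
  (h.la1.const_mul _).add (h.la2.const_mul _)

lemma lpsi (h : IsRegular A μ C C' κ K) (q s : ℝ) :
    IsAlmostAdditive (lpsi A μ q s) (|q| * C + |1 - q| * (|wt1 s| * C' + |wt2 s| * C')) :=
  (h.lmu.const_mul _).add ((h.lsv s).const_mul _)

lemma rate_lsv (h : IsRegular A μ C C' κ K) (s : ℝ) {ν : Measure (Shift N)}
    (hν : ν ∈ invariantMeasures N) :
    rate (SelfAffine.lsv A s) ν
      = wt1 s * rate (SelfAffine.la1 A) ν + wt2 s * rate (SelfAffine.la2 A) ν := by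
  rw [← rate_const_mul h.la1 _ hν, ← rate_const_mul h.la2 _ hν]
  exact rate_add (h.la1.const_mul _) (h.la2.const_mul _) hν

lemma hasSlopes_lsv (h : IsRegular A μ C C' κ K) (w : List (Fin N)) :
    HasSlopes (κ * w.length) (K * w.length) fun s => SelfAffine.lsv A s w :=
  hasSlopes_wt (h.la1_le w) (h.le_la1 w) (h.la2_le w) (h.le_la2 w)

lemma hasSlopes_rate (h : IsRegular A μ C C' κ K) {ν : Measure (Shift N)}
    (hν : ν ∈ invariantMeasures N) (c : ℝ) :
    HasSlopes κ K fun s => c + rate (SelfAffine.lsv A s) ν := by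
  have := hasSlopes_wt (rate_le_neg hν h.la1 h.la1_le)
    (le_rate h.la1 hν (κ := -K) fun w => by linarith [h.le_la1 w])
    (rate_le_neg hν h.la2 h.la2_le)
    (le_rate h.la2 hν (κ := -K) fun w => by linarith [h.le_la2 w])
  intro s s' hs
  have := this s s' hs
  simp only [h.rate_lsv _ hν] at this ⊢
  constructor <;> linarith

variable [NeZero N]

/-- Division by `1 - q` compensates the exponent of `φ^s`, whose sign changes at `q = 1`; the slopes
are then those of `log φ^s` per letter. -/
lemma hasSlopes_npress (h : IsRegular A μ C C' κ K) {q : ℝ} (hq : q ≠ 1) :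
    HasSlopes κ K (npress A μ q) := by
  intro s s' hs
  have hw := fun w => h.hasSlopes_lsv w s s' hs
  simp only [npress]
  rcases lt_or_gt_of_ne hq with hq | hq
  · have hq' : 0 < 1 - q := by linarith
    have h1 := logPressure_add_le (c := -((1 - q) * (K * (s' - s)))) (d := 0) (h.lpsi q s)
      (h.lpsi q s') fun w => by
        have := mul_le_mul_of_nonneg_left (hw w).1 hq'.le
        simp only [SelfAffine.lpsi]
        linarith
    have h2 := logPressure_add_le (c := (1 - q) * (κ * (s' - s))) (d := 0) (h.lpsi q s')
      (h.lpsi q s) fun w => by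
        have := mul_le_mul_of_nonneg_left (hw w).2 hq'.le
        simp only [SelfAffine.lpsi]
        linarith
    rw [le_div_iff₀ hq', div_le_iff₀ hq', sub_mul, sub_mul, div_mul_cancel₀ _ hq'.ne']
    constructor <;> linarith
  · have hq' : 0 < q - 1 := by linarith
    have h1 := logPressure_add_le (c := (q - 1) * (κ * (s' - s))) (d := 0) (h.lpsi q s)
      (h.lpsi q s') fun w => by
        have := mul_le_mul_of_nonneg_left (hw w).2 hq'.le
        simp only [SelfAffine.lpsi]
        linarith
    have h2 := logPressure_add_le (c := -((q - 1) * (K * (s' - s)))) (d := 0) (h.lpsi q s')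
      (h.lpsi q s) fun w => by
        have := mul_le_mul_of_nonneg_left (hw w).1 hq'.le
        simp only [SelfAffine.lpsi]
        linarith
    have e : ∀ x : ℝ, x / (1 - q) = -(x / (q - 1)) := fun x => by
      rw [← neg_sub q 1, div_neg]
    rw [e, e]
    have e1 : logPressure (SelfAffine.lpsi A μ q s) / (q - 1) + κ * (s' - s)
        ≤ logPressure (SelfAffine.lpsi A μ q s') / (q - 1) := by
      rw [le_div_iff₀ hq', add_mul, div_mul_cancel₀ _ hq'.ne']
      linarith
    have e2 : logPressure (SelfAffine.lpsi A μ q s') / (q - 1)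
        ≤ logPressure (SelfAffine.lpsi A μ q s) / (q - 1) + K * (s' - s) := by
      rw [div_le_iff₀ hq', add_mul, div_mul_cancel₀ _ hq'.ne']
      linarith
    constructor <;> linarith

/-- At `s = 0` the potential is `μ([w])^q`. It is compared with `μ([w])`, which has pressure zero,
using `μ([w]) ≤ 1`. -/
lemma npress_zero_nonneg [IsProbabilityMeasure μ] (h : IsRegular A μ C C' κ K)
    (hμ : IsQuasiBernoulli μ) {q : ℝ} (hq : q ≠ 1) : 0 ≤ npress A μ q 0 := by
  have h0 : ∀ w, SelfAffine.lsv A 0 w = 0 := fun w => by simp [SelfAffine.lsv, wt1, wt2]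
  have hP := logPressure_lmu hμ
  rcases lt_or_gt_of_ne hq with hq | hq
  · refine div_nonneg ?_ (by linarith)
    have := logPressure_add_le (c := 0) (d := 0) h.lmu (h.lpsi q 0) fun w => by
      rw [SelfAffine.lpsi, h0]
      have := mul_nonneg_of_nonpos_of_nonpos (lmu_nonpos (μ := μ) w) (by linarith : q - 1 ≤ 0)
      linarith
    linarith
  · refine div_nonneg_of_nonpos ?_ (by linarith)
    have := logPressure_add_le (c := 0) (d := 0) (h.lpsi q 0) h.lmu fun w => by
      rw [SelfAffine.lpsi, h0]
      have := mul_nonpos_of_nonpos_of_nonneg (lmu_nonpos (μ := μ) w) (by linarith : 0 ≤ q - 1)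
      linarith
    linarith

lemma continuousAt_npress (h : IsRegular A μ C C' κ K) (s : ℝ) {q : ℝ} (hq : q ≠ 1) :
    ContinuousAt (fun q => npress A μ q s) q := by
  refine ContinuousAt.div ?_ (by fun_prop) (sub_ne_zero.2 hq.symm)
  obtain ⟨B, hB0, hB⟩ := (h.lmu.add ((h.lsv s).const_mul (-1))).exists_abs_le
  have key : ∀ a b, logPressure (SelfAffine.lpsi A μ a s)
      ≤ logPressure (SelfAffine.lpsi A μ b s) + B * |a - b| := by
    intro a b
    set D := C + |(-1 : ℝ)| * (|wt1 s| * C' + |wt2 s| * C')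
    have := logPressure_add_le (c := -(B * |a - b|)) (d := |a - b| * D) (h.lpsi a s)
      (h.lpsi b s) fun w => by
        have h1 : |(b - a) * (SelfAffine.lmu μ w + -1 * SelfAffine.lsv A s w)|
            ≤ |a - b| * (B * w.length + D) := by
          rw [abs_mul, abs_sub_comm b a]
          exact mul_le_mul_of_nonneg_left (hB w) (abs_nonneg _)
        have h2 := (abs_le.1 h1).1
        simp only [SelfAffine.lpsi]
        linarith
    linarith
  refine (LipschitzWith.of_dist_le_mul (K := ⟨B, hB0⟩) fun a b => ?_).continuous.continuousAt
  rw [Real.dist_eq, Real.dist_eq]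
  change _ ≤ B * |a - b|
  have h1 := key a b
  have h2 := key b a
  rw [abs_sub_comm b a] at h2
  rw [abs_le]
  constructor <;> linarith

lemma existsUnique_mem_pressureZeros [IsProbabilityMeasure μ] (h : IsRegular A μ C C' κ K)
    (hμ : IsQuasiBernoulli μ) {q : ℝ} (hq : q ≠ 1) : ∃! s, s ∈ pressureZeros A μ q := by
  simp only [mem_pressureZeros_iff A hμ hq]
  exact (h.hasSlopes_npress hq).existsUnique_zero h.pos (h.npress_zero_nonneg hμ hq)

lemma npress_sInf [IsProbabilityMeasure μ] (h : IsRegular A μ C C' κ K)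
    (hμ : IsQuasiBernoulli μ) {q : ℝ} (hq : q ≠ 1) :
    npress A μ q (sInf (pressureZeros A μ q)) = 0 :=
  ((mem_pressureZeros_iff A hμ hq _).1
    (sInf_mem_of_existsUnique (h.existsUnique_mem_pressureZeros hμ hq))).2

/-- A decreasing function locates its zero by its signs on either side, and for fixed `s` these
signs persist under small changes of `q`. -/
lemma continuousAt_sInf_pressureZeros [IsProbabilityMeasure μ] (h : IsRegular A μ C C' κ K)
    (hμ : IsQuasiBernoulli μ) {q : ℝ} (hq : q ≠ 1) :
    ContinuousAt (fun q => sInf (pressureZeros A μ q)) q := by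
  have hne : ∀ᶠ x in 𝓝 q, x ≠ 1 := isOpen_ne.mem_nhds hq
  have h0 := h.npress_sInf hμ hq
  have hanti := (h.hasSlopes_npress hq).strictAnti h.pos
  refine tendsto_order.2 ⟨fun a ha => ?_, fun a ha => ?_⟩
  · have h1 : 0 < npress A μ q a := by
      rw [← h0]
      exact hanti ha
    filter_upwards [hne, continuousAt_const.eventually_lt (h.continuousAt_npress a hq) h1]
      with x hx h2
    rw [← h.npress_sInf hμ hx] at h2
    exact ((h.hasSlopes_npress hx).strictAnti h.pos).lt_iff_gt.1 h2
  · have h1 : npress A μ q a < 0 := by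
      rw [← h0]
      exact hanti ha
    filter_upwards [hne, (h.continuousAt_npress a hq).eventually_lt continuousAt_const h1]
      with x hx h2
    rw [← h.npress_sInf hμ hx] at h2
    exact ((h.hasSlopes_npress hx).strictAnti h.pos).lt_iff_gt.1 h2

lemma isOpen_regime [IsProbabilityMeasure μ] (h : IsRegular A μ C C' κ K)
    (hμ : IsQuasiBernoulli μ) {I : Set ℝ} (hI : IsOpen I) :
    IsOpen ({q | q ≠ 1} ∩ (fun q => sInf (pressureZeros A μ q)) ⁻¹' I) :=
  ContinuousOn.isOpen_inter_preimage (fun _ hq =>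
    (h.continuousAt_sInf_pressureZeros hμ hq).continuousWithinAt) isOpen_ne hI

/-- If the potentials `ψ` are affine in `q` and `τ(q)` in a regime, then the `L^q`-spectrum is
continuously differentiable there. -/
lemma regime [IsProbabilityMeasure μ] (h : IsRegular A μ C C' κ K) (hμ : IsQuasiBernoulli μ)
    {I : Set ℝ} (hI : IsOpen I) {w₀ u v : List (Fin N) → ℝ} {C₀ C₁ C₂ : ℝ}
    (h₀ : IsAlmostAdditive w₀ C₀) (hu : IsAlmostAdditive u C₁) (hv : IsAlmostAdditive v C₂)
    (hvκ : ∀ w, κ * w.length ≤ v w)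
    (hpsi : ∀ q s, s ∈ I → SelfAffine.lpsi A μ q s
      = fun w => w₀ w + (q * u w + (q - 1) * s * v w))
    {q : ℝ} (hq : q ≠ 1) (hqI : sInf (pressureZeros A μ q) ∈ I) :
    (∃ U : Set ℝ, IsOpen U ∧ q ∈ U ∧ ContDiffOn ℝ 1 (tau A μ) U) ∧
    ∀ ν, IsEquilibriumState (psi A μ q (sInf (pressureZeros A μ q))) ν →
      deriv (tau A μ) q = -(rate u ν / rate v ν) := by
  obtain ⟨h1, h2⟩ := hasDerivAt_zero_of_logPressure (t := tau A μ) h₀ hu hv h.pos hvκ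
    (h.isOpen_regime hμ hI) fun x hx => by
      have := h.npress_sInf hμ hx.1
      rw [npress, div_eq_zero_iff, or_iff_left (sub_ne_zero.2 (Ne.symm hx.1)),
        hpsi x _ hx.2] at this
      exact this
  refine ⟨⟨_, h.isOpen_regime hμ hI, ⟨hq, hqI⟩, h1⟩, fun ν hν => ?_⟩
  rw [psi_eq A hμ, hpsi q _ hqI] at hν
  exact (h2 q ⟨hq, hqI⟩ ν hν).deriv

end IsRegular

/-! ### Lyapunov exponents and cross-entropy as rates -/

lemma lyap1_eq (ν : Measure (Shift N)) : lyap1 A ν = rate (la1 A) ν := by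
  rw [lyap1, rate]
  congr 1
  funext w
  exact (exp_la1 A w).symm

lemma IsRegular.lyap2_eq {A} {μ : Measure (Shift N)} {C C' κ K : ℝ}
    (h : IsRegular A μ C C' κ K) {ν : Measure (Shift N)} (hν : ν ∈ invariantMeasures N) :
    lyap2 A ν = rate (SelfAffine.la2 A) ν := by
  have := rate_const_mul h.la2 (-1) hν
  rw [lyap2, ← neg_eq_iff_eq_neg.2 (this.trans (neg_one_mul _)), neg_inj, rate]
  congr 1
  funext w
  rw [alpha2_eq, one_div, ← Real.exp_neg, neg_one_mul]

lemma IsQuasiBernoulli.crossEntropy_eq {μ : Measure (Shift N)} [IsProbabilityMeasure μ]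
    (hμ : IsQuasiBernoulli μ) (ν : Measure (Shift N)) :
    crossEntropy μ ν = -rate (lmu μ) ν := by
  rw [crossEntropy, rate]
  congr 2
  funext w
  exact (hμ.exp_lmu w).symm

lemma Lam_svf (s : ℝ) (ν : Measure (Shift N)) : Lam (svf A s) ν = rate (lsv A s) ν := by
  rw [rate]
  congr 1
  funext w
  exact svf_eq A s w

/-! ### Derivative formulas and the Lyapunov cross-dimension -/

namespace IsRegular

variable {A : Fin N → GL (Fin 2) ℝ} {μ : Measure (Shift N)} {C C' κ K : ℝ}

lemma regime_lt_one [NeZero N] [IsProbabilityMeasure μ]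
    (h : IsRegular A μ C C' κ K) (hμ : IsQuasiBernoulli μ) {q : ℝ} (hq : q ≠ 1)
    (hs : sInf (pressureZeros A μ q) < 1) :
    (∃ U : Set ℝ, IsOpen U ∧ q ∈ U ∧ ContDiffOn ℝ 1 (tau A μ) U) ∧
    ∀ ν, IsEquilibriumState (psi A μ q (sInf (pressureZeros A μ q))) ν →
      deriv (tau A μ) q = -(crossEntropy μ ν / lyap1 A ν) := by
  -- The open half-line, rather than the interval from `0` to `1`, also covers `s_q = 0`.
  obtain ⟨h1, h2⟩ := h.regime hμ (isOpen_Iio (a := (1 : ℝ))) (w₀ := fun _ => 0) (C₀ := 0)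
    (fun _ _ => by simp) h.lmu (h.la1.const_mul (-1)) (fun w => by linarith [h.la1_le w])
    (fun q s (hs : s < 1) => by
      funext w
      simp only [SelfAffine.lpsi, SelfAffine.lsv, wt1, wt2, if_pos hs]
      ring) hq hs
  refine ⟨h1, fun ν hν => ?_⟩
  rw [h2 ν hν, rate_const_mul h.la1 _ hν.1, hμ.crossEntropy_eq, lyap1_eq, neg_one_mul, div_neg,
    neg_div]

lemma regime_one_two [NeZero N] [IsProbabilityMeasure μ]
    (h : IsRegular A μ C C' κ K) (hμ : IsQuasiBernoulli μ) {q : ℝ} (hq : q ≠ 1)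
    (hs : sInf (pressureZeros A μ q) ∈ Set.Ioo 1 2) :
    (∃ U : Set ℝ, IsOpen U ∧ q ∈ U ∧ ContDiffOn ℝ 1 (tau A μ) U) ∧
    ∀ ν, IsEquilibriumState (psi A μ q (sInf (pressureZeros A μ q))) ν →
      deriv (tau A μ) q = 1 - (crossEntropy μ ν + lyap1 A ν) / lyap2 A ν := by
  -- Expanding `(1 - q) (log α₁ + (s - 1) log α₂)` in `q` and `(q - 1) s` leaves the constant term
  -- `log α₁ - log α₂` and adds `log α₂ - log α₁` to the coefficient of `q`.
  obtain ⟨h1, h2⟩ := h.regime hμ (isOpen_Ioo (a := (1 : ℝ)) (b := 2))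
    (h.la1.add (h.la2.const_mul (-1)))
    (h.lmu.add ((h.la1.const_mul (-1)).add h.la2)) (h.la2.const_mul (-1))
    (fun w => by linarith [h.la2_le w])
    (fun q s hs => by
      funext w
      simp only [SelfAffine.lpsi, SelfAffine.lsv, wt1, wt2, if_neg (not_lt.2 hs.1.le), if_pos hs.2]
      ring) hq hs
  refine ⟨h1, fun ν hν => ?_⟩
  have hneg := rate_le_neg hν.1 h.la2 h.la2_le
  have hpos := h.pos
  have hne : rate (SelfAffine.la2 A) ν ≠ 0 := by linarith
  rw [h2 ν hν, rate_const_mul h.la2 _ hν.1, hμ.crossEntropy_eq, lyap1_eq, h.lyap2_eq hν.1,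
    rate_add h.lmu ((h.la1.const_mul (-1)).add h.la2) hν.1,
    rate_add (h.la1.const_mul (-1)) h.la2 hν.1, rate_const_mul h.la1 _ hν.1]
  field_simp
  ring

lemma regime_two_lt [NeZero N] [IsProbabilityMeasure μ]
    (h : IsRegular A μ C C' κ K) (hμ : IsQuasiBernoulli μ) {q : ℝ} (hq : q ≠ 1)
    (hs : 2 < sInf (pressureZeros A μ q)) :
    (∃ U : Set ℝ, IsOpen U ∧ q ∈ U ∧ ContDiffOn ℝ 1 (tau A μ) U) ∧
    ∀ ν, IsEquilibriumState (psi A μ q (sInf (pressureZeros A μ q))) ν →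
      deriv (tau A μ) q = -(2 * crossEntropy μ ν / (lyap1 A ν + lyap2 A ν)) := by
  obtain ⟨h1, h2⟩ := h.regime hμ (isOpen_Ioi (a := (2 : ℝ))) (w₀ := fun _ => 0) (C₀ := 0)
    (fun _ _ => by simp) h.lmu ((h.la1.add h.la2).const_mul (-(1 / 2)))
    (fun w => by linarith [h.la1_le w, h.la2_le w])
    (fun q s (hs : 2 < s) => by
      funext w
      simp only [SelfAffine.lpsi, SelfAffine.lsv, wt1, wt2, if_neg (not_lt.2 hs.le),
        if_neg (not_lt.2 (one_lt_two.trans hs).le)]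
      ring) hq hs
  refine ⟨h1, fun ν hν => ?_⟩
  have hneg1 := rate_le_neg hν.1 h.la1 h.la1_le
  have hneg2 := rate_le_neg hν.1 h.la2 h.la2_le
  have hpos := h.pos
  have hne : rate (SelfAffine.la1 A) ν + rate (SelfAffine.la2 A) ν ≠ 0 := by linarith
  rw [h2 ν hν, rate_const_mul (h.la1.add h.la2) _ hν.1, rate_add h.la1 h.la2 hν.1,
    hμ.crossEntropy_eq, lyap1_eq, h.lyap2_eq hν.1]
  field_simp

lemma mem_crossDimSet_iff (h : IsRegular A μ C C' κ K) {ν : Measure (Shift N)}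
    (hν : ν ∈ invariantMeasures N) (s : ℝ) :
    s ∈ crossDimSet A μ ν ↔
      0 ≤ s ∧ crossEntropy μ ν + (wt1 s * lyap1 A ν + wt2 s * lyap2 A ν) = 0 := by
  rw [crossDimSet, Set.mem_ofPred_eq, Lam_svf, h.rate_lsv s hν, lyap1_eq, h.lyap2_eq hν]

/-- At `s = 0` the function is the cross-entropy, which is nonnegative since `μ([w]) ≤ 1`; negative
Lyapunov exponents bounded away from zero give the slope. -/
lemma existsUnique_mem_crossDimSet [IsProbabilityMeasure μ]
    (h : IsRegular A μ C C' κ K) (hμ : IsQuasiBernoulli μ)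
    {ν : Measure (Shift N)} (hν : ν ∈ invariantMeasures N) : ∃! s, s ∈ crossDimSet A μ ν := by
  have h0 : 0 ≤ crossEntropy μ ν := by
    have := rate_le_neg hν h.lmu (c := 0) fun w => by simpa using lmu_nonpos (μ := μ) w
    rw [hμ.crossEntropy_eq]
    linarith
  have := (h.hasSlopes_rate hν (crossEntropy μ ν)).existsUnique_zero h.pos (by
    rw [h.rate_lsv 0 hν]
    simpa [wt1, wt2] using h0)
  simpa only [crossDimSet, Lam_svf, Set.mem_ofPred_eq] using this

lemma eq_lyapCrossDim [IsProbabilityMeasure μ]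
    (h : IsRegular A μ C C' κ K) (hμ : IsQuasiBernoulli μ)
    {ν : Measure (Shift N)} (hν : ν ∈ invariantMeasures N) {s : ℝ} (hs : s ∈ crossDimSet A μ ν) :
    s = lyapCrossDim A μ ν :=
  (h.existsUnique_mem_crossDimSet hμ hν).unique hs
    (sInf_mem_of_existsUnique (h.existsUnique_mem_crossDimSet hμ hν))

end IsRegular

/-- A tuple and a measure as in the main theorem satisfy the standing regularity assumption. -/
lemma exists_isRegular (A : Fin N → GL (Fin 2) ℝ) (hcontr : IsContractive A) (hdom : IsDominated A)
    (μ : Measure (Shift N)) [IsProbabilityMeasure μ] (hμ : IsQuasiBernoulli μ) :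
    ∃ C C' κ K, IsRegular A μ C C' κ K := by
  obtain ⟨C, hC⟩ := hμ.exists_isAlmostAdditive
  obtain ⟨C', hC'⟩ := exists_isAlmostAdditive_la1 A hdom
  obtain ⟨κ, K, hκ, hb⟩ := exists_la_bounds A hcontr
  exact ⟨C, C', κ, K, hC, hC', hκ, fun w => (hb w).1, fun w => (hb w).2.1,
    fun w => (hb w).2.2.1, fun w => (hb w).2.2.2⟩

end SelfAffine

end

/-! ### The main theorem -/

theorem mainTheorem6 {N : ℕ} (A : Fin N → GL (Fin 2) ℝ)
    (hcontr : SelfAffine.IsContractive A) (hdom : SelfAffine.IsDominated A)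
    (μ : Measure (SelfAffine.Shift N)) [IsProbabilityMeasure μ]
    (hμ : SelfAffine.IsQuasiBernoulli μ) (q : ℝ) (hq : q ≠ 1) :
    -- the objects in the claim are well defined: the zero `s_q` and the equilibrium state
    (∃! s : ℝ, s ∈ SelfAffine.pressureZeros A μ q) ∧
    (∃! ν : Measure (SelfAffine.Shift N), SelfAffine.IsEquilibriumState
      (SelfAffine.psi A μ q (SelfAffine.tau A μ q / (q - 1))) ν) ∧
    -- continuous differentiability on a neighbourhood of `q`
    (SelfAffine.tau A μ q / (q - 1) ≠ 1 → SelfAffine.tau A μ q / (q - 1) ≠ 2 →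
      ∃ U : Set ℝ, IsOpen U ∧ q ∈ U ∧ ContDiffOn ℝ 1 (SelfAffine.tau A μ) U) ∧
    ∀ ν : Measure (SelfAffine.Shift N),
      SelfAffine.IsEquilibriumState
        (SelfAffine.psi A μ q (SelfAffine.tau A μ q / (q - 1))) ν →
      -- the formulas for the derivative
      (SelfAffine.tau A μ q / (q - 1) ∈ Set.Ioo 0 1 →
        deriv (SelfAffine.tau A μ) q
          = -(SelfAffine.crossEntropy μ ν / SelfAffine.lyap1 A ν)) ∧
      (SelfAffine.tau A μ q / (q - 1) ∈ Set.Ioo 1 2 →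
        deriv (SelfAffine.tau A μ) q
          = 1 - (SelfAffine.crossEntropy μ ν + SelfAffine.lyap1 A ν) / SelfAffine.lyap2 A ν) ∧
      (SelfAffine.tau A μ q / (q - 1) ∈ Set.Ioi 2 →
        deriv (SelfAffine.tau A μ) q
          = -(2 * SelfAffine.crossEntropy μ ν
              / (SelfAffine.lyap1 A ν + SelfAffine.lyap2 A ν))) ∧
      -- the Lyapunov exponents in the denominators are negative
      SelfAffine.lyap1 A ν < 0 ∧ SelfAffine.lyap2 A ν < 0 ∧
      -- the Lyapunov cross-dimension is well defined, and it is the derivative if the latter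
      -- and `τ(q)/(q-1)` lie in the same interval
      (∃! s : ℝ, s ∈ SelfAffine.crossDimSet A μ ν) ∧
      ∀ I : Set ℝ, I = Set.Ioo 0 1 ∨ I = Set.Ioo 1 2 ∨ I = Set.Ioi 2 →
        deriv (SelfAffine.tau A μ) q ∈ I → SelfAffine.tau A μ q / (q - 1) ∈ I →
        deriv (SelfAffine.tau A μ) q = SelfAffine.lyapCrossDim A μ ν := by
  have := SelfAffine.neZero_of_isProbabilityMeasure μ
  obtain ⟨C, C', κ, K, h⟩ := SelfAffine.exists_isRegular A hcontr hdom μ hμ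
  have hτ : SelfAffine.tau A μ q / (q - 1) = sInf (SelfAffine.pressureZeros A μ q) := by
    rw [SelfAffine.tau, mul_div_cancel_left₀ _ (sub_ne_zero.2 hq)]
  rw [hτ]
  refine ⟨h.existsUnique_mem_pressureZeros hμ hq, ?_, fun h1 h2 => ?_, fun ν hν => ?_⟩
  · rw [SelfAffine.psi_eq A hμ]
    exact SelfAffine.existsUnique_isEquilibriumState (h.lpsi q _)
  · rcases lt_or_gt_of_ne h1 with h1 | h1
    · exact (h.regime_lt_one hμ hq h1).1
    · rcases lt_or_gt_of_ne h2 with h2 | h2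
      · exact (h.regime_one_two hμ hq ⟨h1, h2⟩).1
      · exact (h.regime_two_lt hμ hq h2).1
  · have hν' := hν.1
    have hpos := h.pos
    have l1 : SelfAffine.lyap1 A ν < 0 := by
      rw [SelfAffine.lyap1_eq]
      linarith [SelfAffine.rate_le_neg hν' h.la1 h.la1_le]
    have l2 : SelfAffine.lyap2 A ν < 0 := by
      rw [h.lyap2_eq hν']
      linarith [SelfAffine.rate_le_neg hν' h.la2 h.la2_le]
    have r1 := fun hs => (h.regime_lt_one hμ hq hs).2 ν hν
    have r2 := fun hs => (h.regime_one_two hμ hq hs).2 ν hν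
    have r3 := fun hs => (h.regime_two_lt hμ hq hs).2 ν hν
    refine ⟨fun hs => r1 hs.2, r2, r3, l1, l2, h.existsUnique_mem_crossDimSet hμ hν',
      fun I hI hd hs => h.eq_lyapCrossDim hμ hν' ((h.mem_crossDimSet_iff hν' _).2 ?_)⟩
    set d := deriv (SelfAffine.tau A μ) q
    have n1 := l1.ne
    have n2 := l2.ne
    rcases hI with rfl | rfl | rfl
    -- In each case membership of `d` selects the weights of `φ^d` and membership of `s_q` selects
    -- the derivative formula; substituting that formula solves the cross-dimension equation.
    · refine ⟨hd.1.le, ?_⟩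
      have e := r1 hs.2
      simp only [SelfAffine.wt1, SelfAffine.wt2, if_pos hd.2]
      rw [e]
      field_simp
      ring
    · refine ⟨zero_le_one.trans hd.1.le, ?_⟩
      have e := r2 hs
      simp only [SelfAffine.wt1, SelfAffine.wt2, if_neg (not_lt.2 hd.1.le), if_pos hd.2]
      rw [e]
      field_simp
      ring
    · refine ⟨zero_le_two.trans (le_of_lt hd), ?_⟩
      have e := r3 hs
      have hd' : 2 < d := hd
      simp only [SelfAffine.wt1, SelfAffine.wt2, if_neg (not_lt.2 hd'.le),
        if_neg (not_lt.2 (one_lt_two.trans hd').le)]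
      rw [e]
      have : SelfAffine.lyap1 A ν + SelfAffine.lyap2 A ν ≠ 0 := by linarith
      field_simp
      ring
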